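/- Let $W$ be the group with generators $s_0,s_1,s_2,s_3$ and defining relations $$s_0^2=s_1^2=s_2^2=s_3^2=1,\quad (s_0s_1)^5=(s_1s_2)^3=(s_2s_3)^5=1,\quad s_0s_2=s_2s_0,\ s_1s_3=s_3s_1,\ s_0s_3=s_3s_0,\quad (s_1s_2s_3)^5=1,$$ that is, the Coxeter group $[5,3,5]$ with the extra relation $(s_1s_2s_3)^5=1$. Let $\mathcal P$ be the poset whose faces of rank $i$ ($-1\le i\le 4$) are the left cosets in $W$ of the subgroup $\langle s_j : j\neq i\rangle$ (for $i=-1$ and $i=4$ this is $W$ itself, giving a least and a greatest face), where a face of rank $i$ is below a face of rank $j$ if and only if $i\le j$ and the two cosets intersect. Theorem. $W$ is a string C-group with respect to $s_0,s_1,s_2,s_3$: the $s_i$ generate $W$ and have order exactly $2$, $s_is_j=s_js_i$ whenever $|i-j|\ge 2$, and $\langle s_i : i\in I\rangle\cap\langle s_i : i\in J\rangle=\langle s_i : i\in I\cap J\rangle$ for all $I,J\subseteq\{0,1,2,3\}$. The poset $\mathcal P$ is an abstract regular polytope of rank $4$ and of Schläfli type $\{5,3,5\}$, and the action of $W$ by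 left multiplication of cosets is an isomorphism from $W$ onto the automorphism group of $\mathcal P$. Every facet of $\mathcal P$ is isomorphic to (the face lattice of) the dodecahedron, and every vertex figure of $\mathcal P$ is isomorphic to the hemi-icosahedron, that is, to the polytope with 6 vertices, 15 edges and 10 triangles that is obtained from the icosahedron by identifying antipodal points. -/

import Mathlib

namespace AbstractPolytope

/-! ### Abstract polytopes -/

/-- Two flags are adjacent if they differ in exactly one element. -/
def FlagAdjacent {α : Type*} [PartialOrder α] (Φ Ψ : Flag α) : Prop :=
  ((Φ : Set α) \ (Ψ : Set α)).encard = 1 ∧ ((Ψ : Set α) \ (Φ : Set α)).encard = 1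

/-- A partially ordered set with least and greatest elements is an abstract polytope of rank `n`
if every flag has exactly `n + 2` elements, the diamond condition holds, and the set is strongly
flag-connected. The rank of a face `F`, which is `-1` for the least face, is
`Order.height F - 1`. -/
structure IsPolytope (n : ℕ) (α : Type*) [PartialOrder α] [BoundedOrder α] : Prop where
  flag_card : ∀ Φ : Flag α, (Φ : Set α).encard = n + 2
  diamond : ∀ F G : α, F < G → Order.height G = Order.height F + 2 →
    (Set.Ioo F G).encard = 2
  strongly_flag_connected : ∀ Φ Ψ : Flag α,
    Relation.ReflTransGen
      (fun Φ₁ Φ₂ : Flag α => FlagAdjacent Φ₁ Φ₂ ∧ (Φ : Set α) ∩ (Ψ : Set α) ⊆ (Φ₂ : Set α)) Φ Ψ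

/-- The automorphism group acts transitively on the flags. -/
def IsRegular (α : Type*) [PartialOrder α] : Prop :=
  ∀ Φ Ψ : Flag α, ∃ e : α ≃o α, e '' (Φ : Set α) = (Ψ : Set α)

/-- The face lattice of the `p`-gon, for `p ≥ 3`: the empty face, the vertices `{i}`, the edges
`{i, i + 1}`, and the whole polygon, where `i` is an integer modulo `p`. -/
abbrev Polygon (p : ℕ) : Type :=
  {F : Set (ZMod p) // F = Set.univ ∨ ∃ i : ZMod p, F ⊆ {i, i + 1}}

/-- A polytope of rank `m + 1` has Schläfli type `{p 0, …, p (m - 1)}` if, for every `i`, each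
section `G / F` with `F` of rank `i - 1` and `G` of rank `i + 2` is a `p i`-gon
(ranks are heights minus one). -/
def HasSchlafliType (α : Type*) [PartialOrder α] {m : ℕ} (p : Fin m → ℕ) : Prop :=
  ∀ (i : Fin m) (F G : α), F ≤ G →
    Order.height F = ((i : ℕ) : ℕ∞) → Order.height G = ((i : ℕ) : ℕ∞) + 3 →
    Nonempty (Set.Icc F G ≃o Polygon (p i))

/-! ### The icosahedron, the dodecahedron and the hemi-icosahedron -/

/-- The 12 vertices of the icosahedron. `(v, false)` and `(v, true)` are antipodal. `(none, false)`
is the north pole, the `(some i, false)` form, in cyclic order, the pentagon around it,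
and `(none, true)` is the south pole. -/
abbrev IcosahedronVertex : Type := Option (ZMod 5) × Bool

/-- The 20 triangles of the icosahedron: for each of the two poles, the five triangles that contain
the pole, and the five triangles sharing an edge with one of these. -/
def IsIcosahedronTriangle (t : Finset IcosahedronVertex) : Prop :=
  ∃ (i : ZMod 5) (b : Bool),
    t = {(none, b), (some i, b), (some (i + 1), b)} ∨
    t = {(some i, b), (some (i + 1), b), (some (i + 3), !b)}

/-- The face lattice of the icosahedron: the empty face, vertices, edges and triangles, and the
whole icosahedron; faces are given by their sets of vertices and ordered by inclusion. -/
abbrev Icosahedron : Type :=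
  {F : Finset IcosahedronVertex // F = Finset.univ ∨ ∃ t, IsIcosahedronTriangle t ∧ F ⊆ t}

/-- The face lattice of the dodecahedron, the dual of the icosahedron. -/
abbrev Dodecahedron : Type := Icosahedronᵒᵈ

/-- The face lattice of the hemi-icosahedron, which is obtained from the icosahedron by identifying
antipodal points: it has 6 vertices, 15 edges and 10 triangles, faces are given by their sets of
vertices, and `Prod.fst` maps a vertex of the icosahedron to its antipodal pair. -/
abbrev HemiIcosahedron : Type :=
  {F : Finset (Option (ZMod 5)) //
    F = Finset.univ ∨ ∃ t, IsIcosahedronTriangle t ∧ F ⊆ t.image Prod.fst}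

/-! ### String C-groups and the poset of a string C-group -/

section Group

variable {G : Type*} [Group G] {n : ℕ}

/-- Generators with indices that are not adjacent commute. -/
def IsString (s : Fin n → G) : Prop :=
  ∀ i j : Fin n, (i : ℕ) + 1 < (j : ℕ) → s i * s j = s j * s i

/-- `G` is a string C-group with respect to the distinguished generators `s 0, …, s (n - 1)`. -/
structure IsStringCGroup (s : Fin n → G) : Prop where
  involution : ∀ i, orderOf (s i) = 2
  generates : Subgroup.closure (Set.range s) = ⊤
  string : IsString s
  intersection : ∀ I J : Set (Fin n),
    Subgroup.closure (s '' I) ⊓ Subgroup.closure (s '' J) = Subgroup.closure (s '' (I ∩ J))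

/-- The stabiliser of the base face of rank `i - 1`: it is generated by all the generators
other than `s (i - 1)`. For the two improper ranks (`i = 0` and `i = n + 1`) these are all the
generators. -/
def faceSubgroup (s : Fin n → G) (i : Fin (n + 2)) : Subgroup G :=
  Subgroup.closure (s '' {j | (j : ℕ) + 1 ≠ (i : ℕ)})

/-- The faces of the poset of `G`: those of rank `i - 1` are the left cosets of
`faceSubgroup s i`. -/
def CosetFace (s : Fin n → G) : Type _ := Σ i : Fin (n + 2), G ⧸ faceSubgroup s i

/-- A face is below another one if its rank is at most that of the other, and the two cosets
have an element in common. -/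
def CosetFace.Below {s : Fin n → G} (x y : CosetFace s) : Prop :=
  x.1 ≤ y.1 ∧ ∃ g : G, (g : G ⧸ faceSubgroup s x.1) = x.2 ∧ (g : G ⧸ faceSubgroup s y.1) = y.2

theorem exists_mul_of_mem_faceSubgroup {s : Fin n → G} (hs : IsString s)
    {i j k : Fin (n + 2)} (hij : i ≤ j) (hjk : j ≤ k) {g : G} (hg : g ∈ faceSubgroup s j) :
    ∃ u ∈ faceSubgroup s i, ∃ v ∈ faceSubgroup s k, g = u * v := by
  rcases hij.eq_or_lt with rfl | hij
  · exact ⟨g, hg, 1, one_mem _, by simp⟩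
  rcases hjk.eq_or_lt with rfl | hjk
  · exact ⟨1, one_mem _, g, hg, by simp⟩
  rw [Fin.lt_def] at hij hjk
  set A : Subgroup G := Subgroup.closure (s '' {m | (j : ℕ) < (m : ℕ) + 1}) with hA
  set B : Subgroup G := Subgroup.closure (s '' {m | (m : ℕ) + 1 < (j : ℕ)}) with hB
  have hAi : A ≤ faceSubgroup s i :=
    Subgroup.closure_mono (Set.image_mono fun m hm => by
      simp only [Set.mem_ofPred_eq] at hm ⊢; omega)
  have hBk : B ≤ faceSubgroup s k :=
    Subgroup.closure_mono (Set.image_mono fun m hm => by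
      simp only [Set.mem_ofPred_eq] at hm ⊢; omega)
  have hcomm : ∀ a ∈ A, ∀ b ∈ B, a * b = b * a := by
    have h : A ≤ Subgroup.centralizer (B : Set G) := by
      rw [hB, Subgroup.centralizer_closure, hA, Subgroup.closure_le]
      rintro _ ⟨m, hm, rfl⟩
      rw [SetLike.mem_coe, Subgroup.mem_centralizer_iff]
      rintro _ ⟨l, hl, rfl⟩
      exact hs l m (by simp only [Set.mem_ofPred_eq] at hm hl; omega)
    intro a ha b hb
    exact (Subgroup.mem_centralizer_iff.1 (h ha) b hb).symm
  have key : ∃ u ∈ A, ∃ v ∈ B, g = u * v := by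
    refine Subgroup.closure_induction (p := fun g _ => ∃ u ∈ A, ∃ v ∈ B, g = u * v)
      ?_ ?_ ?_ ?_ hg
    · rintro _ ⟨m, hm, rfl⟩
      simp only [Set.mem_ofPred_eq] at hm
      rcases lt_or_gt_of_ne hm with h | h
      · exact ⟨1, one_mem _, s m, Subgroup.subset_closure ⟨m, h, rfl⟩, by simp⟩
      · exact ⟨s m, Subgroup.subset_closure ⟨m, h, rfl⟩, 1, one_mem _, by simp⟩
    · exact ⟨1, one_mem _, 1, one_mem _, by simp⟩
    · rintro _ _ _ _ ⟨u, hu, v, hv, rfl⟩ ⟨u', hu', v', hv', rfl⟩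
      refine ⟨u * u', mul_mem hu hu', v * v', mul_mem hv hv', ?_⟩
      have := hcomm u' hu' v hv
      simp only [mul_assoc]
      rw [← mul_assoc v, ← this, mul_assoc]
    · rintro _ _ ⟨u, hu, v, hv, rfl⟩
      refine ⟨u⁻¹, inv_mem hu, v⁻¹, inv_mem hv, ?_⟩
      rw [mul_inv_rev, hcomm _ (inv_mem hu) _ (inv_mem hv)]
  obtain ⟨u, hu, v, hv, rfl⟩ := key
  exact ⟨u, hAi hu, v, hBk hv, rfl⟩

/-- The poset of cosets. -/
abbrev cosetPartialOrder (s : Fin n → G) (hs : IsString s) : PartialOrder (CosetFace s) where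
  le := CosetFace.Below
  le_refl := by
    rintro ⟨i, x⟩
    obtain ⟨g, rfl⟩ := QuotientGroup.mk_surjective x
    exact ⟨le_rfl, g, rfl, rfl⟩
  le_trans := by
    rintro ⟨i, x⟩ ⟨j, y⟩ ⟨k, z⟩ ⟨hij, a, ha, ha'⟩ ⟨hjk, b, hb, hb'⟩
    dsimp only at *
    subst ha hb'
    obtain ⟨u, hu, v, hv, huv⟩ := exists_mul_of_mem_faceSubgroup hs hij hjk
      (QuotientGroup.eq.1 (ha'.trans hb.symm))
    refine ⟨hij.trans hjk, a * u, QuotientGroup.eq.2 ?_, QuotientGroup.eq.2 ?_⟩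
    · simpa using hu
    · have : (a * u)⁻¹ * b = v := by
        rw [mul_inv_rev, mul_assoc, huv, inv_mul_cancel_left]
      rwa [this]
  le_antisymm := by
    rintro ⟨i, x⟩ ⟨j, y⟩ ⟨hij, a, ha, ha'⟩ ⟨hji, -⟩
    dsimp only at *
    obtain rfl := le_antisymm hij hji
    rw [← ha, ← ha']

theorem faceSubgroup_improper {s : Fin n → G} (hs : Subgroup.closure (Set.range s) = ⊤)
    {i : Fin (n + 2)} (hi : i = 0 ∨ i = Fin.last (n + 1)) : faceSubgroup s i = ⊤ := by
  rw [← hs, faceSubgroup, ← Set.image_univ]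
  congr 2
  ext j
  have := j.isLt
  rcases hi with rfl | rfl <;> (simp; try omega)

/-- The least and the greatest face of the poset of cosets. -/
abbrev cosetBoundedOrder (s : Fin n → G) (hs : IsString s)
    (hgen : Subgroup.closure (Set.range s) = ⊤) :
    letI := cosetPartialOrder s hs
    BoundedOrder (CosetFace s) :=
  letI := cosetPartialOrder s hs
  { bot := ⟨0, ((1 : G) : G ⧸ faceSubgroup s 0)⟩
    top := ⟨Fin.last (n + 1), ((1 : G) : G ⧸ faceSubgroup s (Fin.last (n + 1)))⟩
    bot_le := by
      rintro ⟨i, x⟩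
      obtain ⟨g, rfl⟩ := QuotientGroup.mk_surjective x
      refine ⟨Fin.zero_le _, g, QuotientGroup.eq.2 ?_, rfl⟩
      rw [faceSubgroup_improper hgen (Or.inl rfl)]
      trivial
    le_top := by
      rintro ⟨i, x⟩
      obtain ⟨g, rfl⟩ := QuotientGroup.mk_surjective x
      refine ⟨Fin.le_last _, g, rfl, QuotientGroup.eq.2 ?_⟩
      rw [faceSubgroup_improper hgen (Or.inr rfl)]
      trivial }

end Group

/-! ### The group `W` and its poset -/

/-- The relators of `W`: those of the Coxeter group `[5,3,5]`, and `(s₁ s₂ s₃)⁵`. -/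
def relatorsW : Set (FreeGroup (Fin 4)) :=
  let s : Fin 4 → FreeGroup (Fin 4) := FreeGroup.of
  {s 0 ^ 2, s 1 ^ 2, s 2 ^ 2, s 3 ^ 2,
    (s 0 * s 1) ^ 5, (s 1 * s 2) ^ 3, (s 2 * s 3) ^ 5,
    (s 0 * s 2) * (s 2 * s 0)⁻¹, (s 1 * s 3) * (s 3 * s 1)⁻¹, (s 0 * s 3) * (s 3 * s 0)⁻¹,
    (s 1 * s 2 * s 3) ^ 5}

/-- The Coxeter group `[5,3,5]` with the extra relation `(s₁ s₂ s₃)⁵ = 1`. -/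
abbrev W : Type := PresentedGroup relatorsW

/-- The generators `s₀, s₁, s₂, s₃` of `W`. -/
def sW (i : Fin 4) : W := PresentedGroup.of i

theorem sW_isString : IsString sW := by
  have key : ∀ a b : Fin 4,
      (FreeGroup.of a * FreeGroup.of b) * (FreeGroup.of b * FreeGroup.of a)⁻¹ ∈ relatorsW →
      sW a * sW b = sW b * sW a := by
    intro a b h
    have h1 := PresentedGroup.one_of_mem h
    rw [map_mul, map_inv, mul_inv_eq_one, map_mul, map_mul] at h1
    exact h1
  intro i j hij
  have hc : (i = 0 ∧ j = 2) ∨ (i = 0 ∧ j = 3) ∨ (i = 1 ∧ j = 3) := by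
    revert i j; decide
  rcases hc with ⟨rfl, rfl⟩ | ⟨rfl, rfl⟩ | ⟨rfl, rfl⟩ <;>
    exact key _ _ (by simp only [relatorsW, Set.mem_insert_iff]; tauto)

theorem closure_range_sW : Subgroup.closure (Set.range sW) = ⊤ :=
  PresentedGroup.closure_range_of relatorsW

/-- The poset of `W` with respect to its generators `s₀, s₁, s₂, s₃`. -/
def P : Type := CosetFace sW

instance : PartialOrder P := cosetPartialOrder sW sW_isString

instance : BoundedOrder P := cosetBoundedOrder sW sW_isString closure_range_sW

/-- The action of an element of `W` on the faces, by left multiplication of cosets. -/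
def leftMul (g : W) (x : P) : P := ⟨x.1, g • x.2⟩

end AbstractPolytope

namespace AbstractPolytope

/-! ### Products of commuting subgroups. -/

section Commuting

variable {G : Type*} [Group G]

/-! The general half of the argument holds for every string C-group. The decisive fact is that the
cosets in a chain have a common group element (`exists_forall_eq_cosetFace`). Hence the flags
correspond to the group elements, and the flag of `g` is adjacent to that of `g * s m`. The diamond
condition, strong flag-connectedness, regularity and the description of the automorphism group
follow (`isPolytope_cosetPoset`, `isRegular_cosetPoset`, `exists_mulEquiv_orderIso`). Moreover a
section is the coset poset of the subgroup generated by consecutive generators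
(`exists_icc_orderIso`). It remains to prove the intersection property of `W` and to recognise the
sections of ranks two and three.

In rank three, both `⟨s₁, s₂, s₃⟩` and `⟨s₀, s₁, s₂⟩` with its generators reversed satisfy the
relations of the Coxeter group `[3,5]`, whose central involution is `z = (abc)⁵`. The twelve
vertices of the icosahedron label the rank-zero faces of such a coset poset, labels of different
antipodal pairs give different faces, and a face is determined by its vertices (`VertexLE.le`). The
poset is the hemi-icosahedron if `z = 1` and the icosahedron if `z` lies outside the vertex
stabiliser. For the vertex figure, `z = 1` is the extra relation. For the facet, a representation of
`W` by matrices of size 7 over the field with 11 elements shows that `z` does not commute with `s₃`,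
so `z ≠ 1`, and the vertex stabiliser, dihedral of order 10, has trivial centre.

The same computation gives `s₃ ∉ ⟨s₀, s₁, s₂⟩`, since `z` is central there. This yields the
intersection property: by `IsString.intersectionOn_step` the essential point is `⟨s₀, s₁, s₂⟩ ∩ ⟨s₁,
s₂, s₃⟩ = ⟨s₁, s₂⟩`, and `⟨s₁, s₂⟩`, a triangle stabiliser of the hemi-icosahedron, is a maximal
subgroup of `⟨s₁, s₂, s₃⟩`. The order of `W` never enters. -/

theorem commute_closure {A B : Set G} (hAB : ∀ a ∈ A, ∀ b ∈ B, a * b = b * a) {a b : G}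
    (ha : a ∈ Subgroup.closure A) (hb : b ∈ Subgroup.closure B) : a * b = b * a := by
  have : Subgroup.closure A ≤ Subgroup.centralizer (Subgroup.closure B : Set G) := by
    rw [Subgroup.centralizer_closure, Subgroup.closure_le]
    exact fun a ha => Subgroup.mem_centralizer_iff.2 fun b hb => (hAB a ha b hb).symm
  exact (Subgroup.mem_centralizer_iff.1 (this ha) b hb).symm

theorem exists_mul_of_mem_closure_union {A B : Set G} (hAB : ∀ a ∈ A, ∀ b ∈ B, a * b = b * a)
    {g : G} (hg : g ∈ Subgroup.closure (A ∪ B)) :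
    ∃ u ∈ Subgroup.closure A, ∃ v ∈ Subgroup.closure B, g = u * v := by
  induction hg using Subgroup.closure_induction with
  | mem x hx =>
    rcases hx with hx | hx
    · exact ⟨x, Subgroup.subset_closure hx, 1, one_mem _, by simp⟩
    · exact ⟨1, one_mem _, x, Subgroup.subset_closure hx, by simp⟩
  | one => exact ⟨1, one_mem _, 1, one_mem _, by simp⟩
  | mul x y _ _ hx hy =>
    obtain ⟨u, hu, v, hv, rfl⟩ := hx
    obtain ⟨u', hu', v', hv', rfl⟩ := hy
    refine ⟨u * u', mul_mem hu hu', v * v', mul_mem hv hv', ?_⟩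
    rw [mul_assoc, ← mul_assoc v, ← commute_closure hAB hu' hv]
    simp only [mul_assoc]
  | inv x _ hx =>
    obtain ⟨u, hu, v, hv, rfl⟩ := hx
    refine ⟨u⁻¹, inv_mem hu, v⁻¹, inv_mem hv, ?_⟩
    rw [mul_inv_rev, commute_closure hAB (inv_mem hu) (inv_mem hv)]

/-- If the indices in `A` and those in `B` are never adjacent or equal, then an element of the
subgroup generated by the generators with index in `A ∪ B` is a product. -/
theorem IsString.exists_mul_of_mem_closure {n : ℕ} {s : Fin n → G} (hs : IsString s)
    {I A B : Set (Fin n)} (hI : I ⊆ A ∪ B)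
    (hAB : ∀ a ∈ A, ∀ b ∈ B, (a : ℕ) + 1 < b ∨ (b : ℕ) + 1 < a) {g : G}
    (hg : g ∈ Subgroup.closure (s '' I)) :
    ∃ u ∈ Subgroup.closure (s '' A), ∃ v ∈ Subgroup.closure (s '' B),
      g = u * v ∧ u * v = v * u := by
  have hAB' : ∀ a ∈ s '' A, ∀ b ∈ s '' B, a * b = b * a := by
    rintro _ ⟨a, ha, rfl⟩ _ ⟨b, hb, rfl⟩
    rcases hAB a ha b hb with hab | hab
    · exact hs a b hab
    · exact (hs b a hab).symm
  obtain ⟨u, hu, v, hv, e⟩ := exists_mul_of_mem_closure_union hAB'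
    (Subgroup.closure_mono ((Set.image_mono hI).trans (Set.image_union _ _ _).subset) hg)
  exact ⟨u, hu, v, hv, e, commute_closure hAB' hu hv⟩

theorem closure_image_mono {ι : Type*} (s : ι → G) {I J : Set ι} (hIJ : I ⊆ J) :
    Subgroup.closure (s '' I) ≤ Subgroup.closure (s '' J) :=
  Subgroup.closure_mono (Set.image_mono hIJ)

end Commuting

/-! ### The coset poset and its chains. -/

section CosetPoset

variable {G : Type*} [Group G] {n : ℕ} {s : Fin n → G}

/-- The poset of cosets of a string C-group. -/
def CosetPoset (_h : IsStringCGroup s) : Type _ := CosetFace s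

variable {h : IsStringCGroup s}

instance : PartialOrder (CosetPoset h) := cosetPartialOrder s h.string

instance : BoundedOrder (CosetPoset h) := cosetBoundedOrder s h.string h.generates

instance : MulAction G (CosetPoset h) where
  smul g x := ⟨x.1, g • x.2⟩
  one_smul x := Sigma.ext rfl (heq_of_eq (one_smul G x.2))
  mul_smul a b x := Sigma.ext rfl (heq_of_eq (mul_smul a b x.2))

/-- The face of the given rank that contains a group element. -/
def cosetFace (h : IsStringCGroup s) (i : Fin (n + 2)) (g : G) : CosetPoset h :=
  ⟨i, (g : G ⧸ faceSubgroup s i)⟩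

/-- The index of a face, which is one more than its rank. -/
def CosetPoset.index (x : CosetPoset h) : Fin (n + 2) := x.1

@[simp] theorem index_cosetFace (i : Fin (n + 2)) (g : G) : (cosetFace h i g).index = i := rfl

@[simp] theorem index_smul (g : G) (x : CosetPoset h) : (g • x).index = x.index := rfl

@[simp] theorem smul_cosetFace (g : G) (i : Fin (n + 2)) (k : G) :
    g • cosetFace h i k = cosetFace h i (g * k) := rfl

theorem cosetFace_eq_smul (i : Fin (n + 2)) (g : G) :
    cosetFace h i g = g • cosetFace h i 1 := by simp

theorem exists_eq_cosetFace (x : CosetPoset h) : ∃ g, x = cosetFace h x.index g := by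
  obtain ⟨i, x⟩ := x
  obtain ⟨g, rfl⟩ := QuotientGroup.mk_surjective x
  exact ⟨g, rfl⟩

theorem cosetFace_eq_iff {i : Fin (n + 2)} {g k : G} :
    cosetFace h i g = cosetFace h i k ↔ g⁻¹ * k ∈ faceSubgroup s i := by
  rw [← QuotientGroup.eq]
  refine ⟨fun e => ?_, fun e => Sigma.ext rfl (heq_of_eq e)⟩
  exact eq_of_heq (Sigma.mk.inj e).2

theorem cosetFace_eq_one_iff {i : Fin (n + 2)} {g : G} :
    cosetFace h i g = cosetFace h i 1 ↔ g ∈ faceSubgroup s i := by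
  rw [cosetFace_eq_iff, mul_one, inv_mem_iff]

theorem index_eq_of_cosetFace_eq {i j : Fin (n + 2)} {g k : G}
    (e : cosetFace h i g = cosetFace h j k) : i = j := congrArg CosetPoset.index e

theorem le_iff_exists {x y : CosetPoset h} :
    x ≤ y ↔ x.index ≤ y.index ∧ ∃ g, x = cosetFace h x.index g ∧ y = cosetFace h y.index g := by
  obtain ⟨i, x⟩ := x
  obtain ⟨j, y⟩ := y
  refine and_congr Iff.rfl (exists_congr fun g => ?_)
  exact ⟨fun ⟨e, e'⟩ => ⟨Sigma.ext rfl (heq_of_eq e.symm), Sigma.ext rfl (heq_of_eq e'.symm)⟩,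
    fun ⟨e, e'⟩ => ⟨(eq_of_heq (Sigma.mk.inj e).2).symm, (eq_of_heq (Sigma.mk.inj e').2).symm⟩⟩

theorem cosetFace_le_cosetFace {i j : Fin (n + 2)} (hij : i ≤ j) (g : G) :
    cosetFace h i g ≤ cosetFace h j g :=
  le_iff_exists.2 ⟨hij, g, rfl, rfl⟩

theorem index_mono {x y : CosetPoset h} (hxy : x ≤ y) : x.index ≤ y.index :=
  (le_iff_exists.1 hxy).1

theorem eq_of_le_of_index_eq {x y : CosetPoset h} (hxy : x ≤ y) (e : x.index = y.index) :
    x = y := by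
  obtain ⟨-, g, hx, hy⟩ := le_iff_exists.1 hxy
  rw [hx, hy, e]

theorem index_strictMono : StrictMono (CosetPoset.index (h := h)) := fun _ _ hxy =>
  lt_of_le_of_ne (index_mono hxy.le) fun e => hxy.ne (eq_of_le_of_index_eq hxy.le e)

theorem bot_eq_cosetFace (g : G) : (⊥ : CosetPoset h) = cosetFace h 0 g :=
  le_antisymm bot_le ((cosetFace_le_cosetFace (Fin.zero_le _) g).trans
    (le_of_eq (cosetFace_eq_one_iff.2 (by
      rw [faceSubgroup_improper h.generates (Or.inl rfl)]; trivial))))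

theorem top_eq_cosetFace (g : G) : (⊤ : CosetPoset h) = cosetFace h (Fin.last _) g :=
  le_antisymm (le_trans (le_of_eq (cosetFace_eq_one_iff.2 (by
      rw [faceSubgroup_improper h.generates (Or.inr rfl)]; trivial)).symm)
        (cosetFace_le_cosetFace (Fin.le_last _) g)) le_top

theorem smul_le_smul_cosetPoset (g : G) {x y : CosetPoset h} (hxy : x ≤ y) : g • x ≤ g • y := by
  obtain ⟨hij, k, hx, hy⟩ := le_iff_exists.1 hxy
  rw [hx, hy]
  exact cosetFace_le_cosetFace hij _

/-- Left multiplication of cosets, as an automorphism of the poset. -/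
def smulOrderIso (h : IsStringCGroup s) (g : G) : CosetPoset h ≃o CosetPoset h where
  toEquiv := MulAction.toPerm g
  map_rel_iff' {x y} := ⟨fun hxy => by
    simpa using smul_le_smul_cosetPoset g⁻¹ hxy, smul_le_smul_cosetPoset g⟩

@[simp] theorem smulOrderIso_apply (g : G) (x : CosetPoset h) :
    smulOrderIso h g x = g • x := rfl

/-- The faces of a chain have a common group element. -/
theorem exists_forall_eq_cosetFace {c : Set (CosetPoset h)} (hc : IsChain (· ≤ ·) c) :
    ∃ g, ∀ x ∈ c, x = cosetFace h x.index g := by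
  -- Induction on the index bound `k`. The element `g` represents all faces of the chain of index
  -- below `k`, and `j` is the largest index met so far; `j = 0`, the index of the least face,
  -- serves as default when there is none.
  have key : ∀ k : ℕ, ∃ g, ∃ j : Fin (n + 2), (∀ y ∈ c, (y.index : ℕ) < k →
      y.index ≤ j ∧ y = cosetFace h y.index g) ∧ ((j : ℕ) = 0 ∨ cosetFace h j g ∈ c) ∧
        (j : ℕ) ≤ k := by
    intro k
    induction k with
    | zero => exact ⟨1, 0, fun y _ hy => absurd hy (Nat.not_lt_zero _), Or.inl rfl, le_rfl⟩
    | succ k ih =>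
      obtain ⟨g, j, h1, h2, h3⟩ := ih
      by_cases hx : ∃ x ∈ c, (x.index : ℕ) = k
      · obtain ⟨x, hxc, hxk⟩ := hx
        have hjx : cosetFace h j g ≤ x := by
          rcases h2 with h2 | h2
          · obtain rfl : j = 0 := Fin.ext h2
            rw [← bot_eq_cosetFace g]
            exact bot_le
          · rcases hc.total h2 hxc with h4 | h4
            · exact h4
            · have h5 : j = x.index := Fin.ext (le_antisymm (by omega) (index_mono h4))
              exact (eq_of_le_of_index_eq h4 h5.symm).ge
        obtain ⟨hij, k', e1, e2⟩ := le_iff_exists.1 hjx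
        rw [index_cosetFace] at e1 hij
        have h6 := cosetFace_eq_iff.1 e1
        -- The correction from `g` to `k'` avoids the generator with `m + 1 = j`, so it splits into
        -- a part `u` from generators with `m + 1 > j`, which fixes every base face of index at most
        -- `j`, and a part `v` from generators with `m + 1 < j`, which fixes the base face of the
        -- index of `x`. Replacing `g` by `g * u` reaches `x` and keeps the earlier faces.
        have h7 : ∃ u v, (∀ i, i ≤ j → u ∈ faceSubgroup s i) ∧ v ∈ faceSubgroup s x.index ∧
            g⁻¹ * k' = u * v := by
          rcases hij.eq_or_lt with e | hlt
          · exact ⟨1, g⁻¹ * k', fun _ _ => one_mem _, e ▸ h6, by simp⟩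
          rw [Fin.lt_def] at hlt
          obtain ⟨u, hu, v, hv, e, -⟩ := h.string.exists_mul_of_mem_closure
            (A := {m | (j : ℕ) < (m : ℕ) + 1}) (B := {m | (m : ℕ) + 1 < j})
            (fun m hm => by simp only [Set.mem_union, Set.mem_ofPred_eq] at hm ⊢; omega)
            (fun a ha b hb => by simp only [Set.mem_ofPred_eq] at ha hb; omega) h6
          have hv : v ∈ faceSubgroup s x.index := closure_image_mono s (fun m hm => by
            simp only [Set.mem_ofPred_eq] at hm ⊢; omega) hv
          refine ⟨u, v, fun i hi => ?_, hv, e⟩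
          refine Subgroup.closure_mono (Set.image_mono fun m hm => ?_) hu
          simp only [Set.mem_ofPred_eq] at hm ⊢
          rw [Fin.le_def] at hi
          omega
        obtain ⟨u, v, hu, hv, e⟩ := h7
        have e3 : x = cosetFace h x.index (g * u) := by
          rw [e2]
          simp only [index_cosetFace]
          rw [eq_comm, cosetFace_eq_iff]
          have : (g * u)⁻¹ * k' = v := by
            rw [mul_inv_rev, mul_assoc, e, inv_mul_cancel_left]
          rwa [this]
        refine ⟨g * u, x.index, fun y hy hyk => ?_, Or.inr (e3 ▸ hxc), by omega⟩
        rcases (Nat.lt_succ_iff_lt_or_eq.1 hyk) with hyk | hyk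
        · obtain ⟨h9, e4⟩ := h1 y hy hyk
          refine ⟨h9.trans hij, e4.trans ?_⟩
          rw [cosetFace_eq_iff]
          simpa using hu _ h9
        · have e5 : y.index = x.index := Fin.ext (by omega)
          have e6 : y = x := by
            rcases hc.total hy hxc with h4 | h4
            · exact eq_of_le_of_index_eq h4 e5
            · exact (eq_of_le_of_index_eq h4 e5.symm).symm
          rw [e6]
          exact ⟨le_rfl, e3⟩
      · refine ⟨g, j, fun y hy hyk => h1 y hy ?_, h2, by omega⟩
        rcases (Nat.lt_succ_iff_lt_or_eq.1 hyk) with hyk | hyk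
        · exact hyk
        · exact absurd ⟨y, hy, hyk⟩ hx
  obtain ⟨g, j, h1, -⟩ := key (n + 2)
  exact ⟨g, fun x hx => (h1 x hx x.index.isLt).2⟩

end CosetPoset

end AbstractPolytope

namespace AbstractPolytope

/-! ### Flags, and the regular polytope of a string C-group. -/

section Flags

variable {G : Type*} [Group G] {n : ℕ} {s : Fin n → G}

theorem IsStringCGroup.mem_closure_inter (h : IsStringCGroup s) {I J : Set (Fin n)} {g : G}
    (hI : g ∈ Subgroup.closure (s '' I)) (hJ : g ∈ Subgroup.closure (s '' J)) :
    g ∈ Subgroup.closure (s '' (I ∩ J)) := by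
  rw [← h.intersection]
  exact ⟨hI, hJ⟩

theorem IsStringCGroup.mem_closure_of_forall (h : IsStringCGroup s) (I : Set (Fin (n + 2)))
    {g : G} (hg : ∀ i ∈ I, g ∈ faceSubgroup s i) :
    g ∈ Subgroup.closure (s '' {m | ∀ i ∈ I, (m : ℕ) + 1 ≠ i}) := by
  induction I, I.toFinite using Set.Finite.induction_on with
  | empty =>
    have : {m : Fin n | ∀ i ∈ (∅ : Set (Fin (n + 2))), (m : ℕ) + 1 ≠ i} = Set.univ := by
      ext; simp
    rw [this, Set.image_univ, h.generates]
    trivial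
  | @insert j I _ _ ih =>
    refine closure_image_mono s ?_ (h.mem_closure_inter
      (hg j (Set.mem_insert _ _)) (ih fun i hi => hg i (Set.mem_insert_of_mem _ hi)))
    rintro m ⟨hm, hm'⟩ i (rfl | hi)
    · exact hm
    · exact hm' i hi

theorem IsStringCGroup.ne_one (h : IsStringCGroup s) (i : Fin n) : s i ≠ 1 := fun e => by
  simpa [e] using h.involution i

/-- By the intersection property, `s m` would lie in the subgroup generated by no generator at all.
Index `m + 1` is the only one at which `s m` moves the base face. -/
theorem IsStringCGroup.notMem_faceSubgroup (h : IsStringCGroup s) (m : Fin n) :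
    s m ∉ faceSubgroup s m.succ.castSucc := fun hm => by
  have h1 : s m ∈ Subgroup.closure (s '' {m}) := Subgroup.subset_closure ⟨m, rfl, rfl⟩
  have h2 := h.mem_closure_inter h1 hm
  have h3 : ({m} ∩ {j : Fin n | (j : ℕ) + 1 ≠ (m.succ.castSucc : Fin (n + 2))}) = ∅ := by
    ext j
    simp
  rw [h3, Set.image_empty, Subgroup.closure_empty, Subgroup.mem_bot] at h2
  exact h.ne_one m h2

theorem mem_faceSubgroup {m : Fin n} {i : Fin (n + 2)} (hm : (m : ℕ) + 1 ≠ i) :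
    s m ∈ faceSubgroup s i :=
  Subgroup.subset_closure ⟨m, hm, rfl⟩

variable {h : IsStringCGroup s}

theorem exists_smul_of_le {x y : CosetPoset h} (hxy : x ≤ y) :
    ∃ g : G, x = g • cosetFace h x.index 1 ∧ y = g • cosetFace h y.index 1 := by
  obtain ⟨-, g, hx, hy⟩ := le_iff_exists.1 hxy
  exact ⟨g, by rwa [← cosetFace_eq_smul], by rwa [← cosetFace_eq_smul]⟩

/-- The faces that contain a group element form a flag. -/
def cosetFlag (h : IsStringCGroup s) (g : G) : Flag (CosetPoset h) where
  carrier := Set.range fun i => cosetFace h i g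
  Chain' := by
    rintro _ ⟨i, rfl⟩ _ ⟨j, rfl⟩ -
    exact (le_total i j).imp (fun hij => cosetFace_le_cosetFace hij g)
      fun hij => cosetFace_le_cosetFace hij g
  max_chain' := fun c hc hsub => by
    refine hsub.antisymm fun x hx => ?_
    obtain ⟨k, hk⟩ := exists_forall_eq_cosetFace hc
    refine ⟨x.index, ?_⟩
    rw [hk x hx]
    exact hk _ (hsub ⟨x.index, rfl⟩)

theorem mem_cosetFlag {g : G} {x : CosetPoset h} :
    x ∈ cosetFlag h g ↔ x = cosetFace h x.index g := by
  refine ⟨?_, fun hx => ⟨x.index, hx.symm⟩⟩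
  rintro ⟨i, rfl⟩
  rfl

theorem exists_eq_cosetFlag (Φ : Flag (CosetPoset h)) : ∃ g, Φ = cosetFlag h g := by
  obtain ⟨g, hg⟩ := exists_forall_eq_cosetFace Φ.chain_le
  refine ⟨g, Flag.ext (Φ.max_chain' (cosetFlag h g).chain_le fun x hx => ?_)⟩
  exact mem_cosetFlag.2 (hg x hx)

/-- The index is strictly monotone, which bounds the height above; the faces of smaller index
through one group element form a chain that attains the bound. -/
theorem height_eq_index (x : CosetPoset h) : Order.height x = ((x.index : ℕ) : ℕ∞) := by
  refine le_antisymm ?_ ?_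
  · have := Order.height_le_height_apply_of_strictMono
      (fun x : CosetPoset h => (x.index : ℕ)) (fun _ _ hxy => index_strictMono hxy) x
    simpa using this
  · obtain ⟨g, hx⟩ := exists_eq_cosetFace x
    rw [hx, index_cosetFace]
    generalize x.index = i
    induction i using Fin.induction with
    | zero => simp
    | succ i ih =>
      refine le_trans ?_ (Order.height_add_one_le (a := cosetFace h i.castSucc g) ?_)
      · simpa using add_le_add_left ih 1
      · refine lt_of_le_of_ne (cosetFace_le_cosetFace (Fin.castSucc_lt_succ).le g) fun e => ?_
        exact (Fin.castSucc_lt_succ (i := i)).ne (index_eq_of_cosetFace_eq e)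

theorem index_orderIso (e : CosetPoset h ≃o CosetPoset h) (x : CosetPoset h) :
    (e x).index = x.index := by
  have := Order.height_orderIso e x
  rw [height_eq_index, height_eq_index] at this
  exact Fin.ext (by exact_mod_cast this)

/-- The faces between two faces of one coset flag whose indices differ by two. -/
theorem eq_or_eq_of_lt_of_lt {m : Fin n} {i j : Fin (n + 2)} (hi : (i : ℕ) = m)
    (hj : (j : ℕ) = m + 2) {g : G} {x : CosetPoset h} (hx : cosetFace h i g < x)
    (hx' : x < cosetFace h j g) :
    x = cosetFace h m.succ.castSucc g ∨ x = cosetFace h m.succ.castSucc (g * s m) := by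
  have h1 := index_strictMono hx
  have h2 := index_strictMono hx'
  simp only [index_cosetFace, Fin.lt_def] at h1 h2
  have h3 : x.index = m.succ.castSucc := Fin.ext (by simp; omega)
  have hc : IsChain (· ≤ ·) ({cosetFace h i g, x, cosetFace h j g} : Set (CosetPoset h)) := by
    refine (IsChain.singleton.insert ?_).insert ?_
    · rintro _ rfl -
      exact Or.inl hx'.le
    · rintro _ (rfl | rfl) -
      · exact Or.inl hx.le
      · exact Or.inl (hx.le.trans hx'.le)
  obtain ⟨k, hk⟩ := exists_forall_eq_cosetFace hc
  have e1 := hk (cosetFace h i g) (by simp)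
  have e2 := hk x (by simp)
  have e3 := hk (cosetFace h j g) (by simp)
  simp only [index_cosetFace] at e1 e3
  -- The element `g⁻¹ * k` fixes the base faces of indices `m` and `m + 2`, so it avoids both
  -- neighbours of `s m`. It is therefore a power of `s m` times an element `v` that fixes the base
  -- face of index `m + 1`.
  have h4 := h.mem_closure_inter (cosetFace_eq_iff.1 e1) (cosetFace_eq_iff.1 e3)
  obtain ⟨u, hu, v, hv, e, -⟩ := h.string.exists_mul_of_mem_closure (A := {m})
    (B := {l | (l : ℕ) + 1 < m ∨ (m : ℕ) + 1 < l}) (fun l hl => by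
      simp only [Set.mem_inter_iff, Set.mem_ofPred_eq] at hl
      by_cases hlm : l = m
      · exact Or.inl hlm
      · right
        rw [Fin.ext_iff] at hlm
        simp only [Set.mem_ofPred_eq]
        omega) (fun a ha b hb => by
      obtain rfl := ha
      exact hb.symm) h4
  have hv' : v ∈ faceSubgroup s m.succ.castSucc := closure_image_mono s (fun l hl => by
    simp only [Set.mem_ofPred_eq, Fin.val_castSucc, Fin.val_succ] at hl ⊢; omega) hv
  have hk' : k = g * u * v := by rw [mul_assoc, ← e]; simp
  rw [e2, h3, hk']
  have h5 : u = 1 ∨ u = s m := by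
    rw [Set.image_singleton, ← Subgroup.zpowers_eq_closure] at hu
    obtain ⟨z, rfl⟩ := hu
    have h6 : s m ^ (2 : ℤ) = 1 := by
      have := pow_orderOf_eq_one (s m)
      rw [h.involution] at this
      exact_mod_cast this
    obtain ⟨w, rfl | rfl⟩ := Int.even_or_odd' z
    · left; simp [zpow_mul, h6]
    · right; simp [zpow_add, zpow_mul, h6]
  rcases h5 with rfl | rfl
  · left
    rw [eq_comm, cosetFace_eq_iff]
    simpa using hv'
  · right
    rw [eq_comm, cosetFace_eq_iff]
    simpa [mul_assoc] using hv'

theorem cosetFace_mul_ne (m : Fin n) (g : G) :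
    cosetFace h m.succ.castSucc g ≠ cosetFace h m.succ.castSucc (g * s m) := fun e => by
  rw [cosetFace_eq_iff, inv_mul_cancel_left] at e
  exact h.notMem_faceSubgroup m e

theorem cosetFace_mul_eq {m : Fin n} {i : Fin (n + 2)} (hi : (m : ℕ) + 1 ≠ i) (g : G) :
    cosetFace h i (g * s m) = cosetFace h i g := by
  rw [eq_comm, cosetFace_eq_iff, inv_mul_cancel_left]
  exact mem_faceSubgroup hi

theorem cosetFace_lt_cosetFace {i j : Fin (n + 2)} (hij : i < j) (g : G) :
    cosetFace h i g < cosetFace h j g :=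
  lt_of_le_of_ne (cosetFace_le_cosetFace hij.le g) fun e =>
    hij.ne (index_eq_of_cosetFace_eq e)

theorem sdiff_cosetFlag (g : G) (m : Fin n) (k : G) (hk : k = g * s m ∨ g = k * s m) :
    (cosetFlag h g : Set (CosetPoset h)) \ cosetFlag h k =
      {cosetFace h m.succ.castSucc g} := by
  have hne : cosetFace h m.succ.castSucc g ≠ cosetFace h m.succ.castSucc k := by
    rcases hk with rfl | rfl
    · exact cosetFace_mul_ne m g
    · exact (cosetFace_mul_ne m k).symm
  have heq : ∀ i : Fin (n + 2), (m : ℕ) + 1 ≠ i → cosetFace h i g = cosetFace h i k := by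
    intro i hi
    rcases hk with rfl | rfl
    · exact (cosetFace_mul_eq hi g).symm
    · exact cosetFace_mul_eq hi k
  ext x
  simp only [Set.mem_sdiff, SetLike.mem_coe, mem_cosetFlag, Set.mem_singleton_iff]
  constructor
  · rintro ⟨h1, h2⟩
    have : (m : ℕ) + 1 = x.index := by
      by_contra h3
      exact h2 (h1.trans (heq _ h3))
    rw [h1]
    congr 1
    exact Fin.ext this.symm
  · rintro rfl
    exact ⟨rfl, hne⟩

theorem flagAdjacent_cosetFlag (g : G) (m : Fin n) :
    FlagAdjacent (cosetFlag h g) (cosetFlag h (g * s m)) := by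
  constructor
  · rw [sdiff_cosetFlag g m _ (Or.inl rfl), Set.encard_singleton]
  · rw [sdiff_cosetFlag _ m _ (Or.inr rfl), Set.encard_singleton]

theorem inv_eq_self (h : IsStringCGroup s) (m : Fin n) : (s m)⁻¹ = s m := by
  rw [inv_eq_iff_mul_eq_one, ← sq, ← h.involution m, pow_orderOf_eq_one]

theorem isPolytope_cosetPoset (h : IsStringCGroup s) : IsPolytope n (CosetPoset h) where
  flag_card Φ := by
    obtain ⟨g, rfl⟩ := exists_eq_cosetFlag Φ
    change (Set.range fun i => cosetFace h i g).encard = _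
    rw [← Set.image_univ, Function.Injective.encard_image, Set.encard_univ]
    · simp
    · exact fun i j e => index_eq_of_cosetFace_eq e
  diamond F K hFK hht := by
    obtain ⟨-, g, hF, hK⟩ := le_iff_exists.1 hFK.le
    rw [height_eq_index, height_eq_index] at hht
    have hht : (K.index : ℕ) = F.index + 2 := by exact_mod_cast hht
    have hm : (F.index : ℕ) < n := by omega
    set m : Fin n := ⟨F.index, hm⟩ with hm'
    rw [Set.encard_eq_two]
    refine ⟨_, _, cosetFace_mul_ne (h := h) m g, ?_⟩
    rw [hF, hK]
    ext x
    simp only [Set.mem_Ioo, Set.mem_insert_iff, Set.mem_singleton_iff]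
    have h1 : F.index < m.succ.castSucc := by simp [Fin.lt_def, hm']
    have h2 : m.succ.castSucc < K.index := by simp [Fin.lt_def, hm', hht]
    constructor
    · exact fun hx => eq_or_eq_of_lt_of_lt (by simp [hm']) (by simp [hm', hht]) hx.1 hx.2
    · rintro (rfl | rfl)
      · exact ⟨cosetFace_lt_cosetFace h1 g, cosetFace_lt_cosetFace h2 g⟩
      · rw [← cosetFace_mul_eq (m := m) (i := F.index) (by simp [hm']) g,
          ← cosetFace_mul_eq (m := m) (i := K.index) (by simp [hm', hht]) g]
        exact ⟨cosetFace_lt_cosetFace h1 _, cosetFace_lt_cosetFace h2 _⟩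
  strongly_flag_connected Φ Ψ := by
    obtain ⟨a, rfl⟩ := exists_eq_cosetFlag Φ
    obtain ⟨b, rfl⟩ := exists_eq_cosetFlag Ψ
    -- `I` records the faces common to the two flags. Then `a⁻¹ * b` is a word in the generators
    -- that fix the base faces with index in `I`; reading the word letter by letter gives a path of
    -- adjacent flags that keeps all common faces.
    set I : Set (Fin (n + 2)) := {i | cosetFace h i a = cosetFace h i b} with hI
    have h1 := h.mem_closure_of_forall I (g := a⁻¹ * b) fun i hi => cosetFace_eq_iff.1 hi
    have key : ∀ g ∈ Subgroup.closure (s '' {m | ∀ i ∈ I, (m : ℕ) + 1 ≠ i}),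
        Relation.ReflTransGen (fun Φ₁ Φ₂ : Flag (CosetPoset h) => FlagAdjacent Φ₁ Φ₂ ∧
          (cosetFlag h a : Set (CosetPoset h)) ∩ (cosetFlag h b : Set (CosetPoset h)) ⊆
            (Φ₂ : Set (CosetPoset h))) (cosetFlag h a) (cosetFlag h (a * g)) := by
      have step : ∀ x ∈ Subgroup.closure (s '' {m | ∀ i ∈ I, (m : ℕ) + 1 ≠ i}),
          ∀ y ∈ s '' {m | ∀ i ∈ I, (m : ℕ) + 1 ≠ i},
          FlagAdjacent (cosetFlag h (a * x)) (cosetFlag h (a * (x * y))) ∧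
          (cosetFlag h a : Set (CosetPoset h)) ∩ (cosetFlag h b : Set (CosetPoset h)) ⊆
            (cosetFlag h (a * (x * y)) : Set (CosetPoset h)) := by
        rintro x hx _ ⟨m, hm, rfl⟩
        refine ⟨?_, ?_⟩
        · rw [← mul_assoc]
          exact flagAdjacent_cosetFlag _ m
        · rintro f ⟨hf, hf'⟩
          rw [SetLike.mem_coe, mem_cosetFlag] at hf hf' ⊢
          have hfI : f.index ∈ I := by
            change cosetFace h f.index a = cosetFace h f.index b
            rw [← hf, ← hf']
          rw [hf, index_cosetFace, cosetFace_eq_iff, inv_mul_cancel_left]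
          exact closure_image_mono (I := {m | ∀ i ∈ I, (m : ℕ) + 1 ≠ i}) s (fun m hm => hm _ hfI)
            (mul_mem hx (Subgroup.subset_closure ⟨m, hm, rfl⟩))
      intro g hg
      induction hg using Subgroup.closure_induction_right with
      | one => rw [mul_one]
      | mul_right x hx y hy ih => exact ih.tail (step x hx y hy)
      | mul_inv_cancel x hx y hy ih =>
        have : y⁻¹ = y := by
          obtain ⟨m, -, rfl⟩ := hy
          exact inv_eq_self h m
        rw [this]
        exact ih.tail (step x hx y hy)
    simpa using key _ h1

theorem image_smul_cosetFlag (h : IsStringCGroup s) (g k : G) :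
    smulOrderIso h g '' (cosetFlag h k : Set (CosetPoset h)) = cosetFlag h (g * k) := by
  change _ '' (Set.range fun i => cosetFace h i k) = Set.range fun i => cosetFace h i (g * k)
  rw [← Set.range_comp]
  rfl

theorem isRegular_cosetPoset (h : IsStringCGroup s) : IsRegular (CosetPoset h) := by
  intro Φ Ψ
  obtain ⟨a, rfl⟩ := exists_eq_cosetFlag Φ
  obtain ⟨b, rfl⟩ := exists_eq_cosetFlag Ψ
  exact ⟨smulOrderIso h (b * a⁻¹), by rw [image_smul_cosetFlag]; simp⟩

/-- Rigidity from the diamond condition: if all faces through `g` are fixed, the single new face of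
the adjacent flag `g * s m` has no other possible image. Since the generators generate, fixedness
spreads from the base flag to all faces. -/
theorem orderIso_eq_refl (e : CosetPoset h ≃o CosetPoset h)
    (he : ∀ i, e (cosetFace h i 1) = cosetFace h i 1) (x : CosetPoset h) : e x = x := by
  have step : ∀ (g : G) (m : Fin n), (∀ i, e (cosetFace h i g) = cosetFace h i g) →
      ∀ i, e (cosetFace h i (g * s m)) = cosetFace h i (g * s m) := by
    intro g m hg i
    by_cases hi : (m : ℕ) + 1 = i
    · have hi' : i = m.succ.castSucc := Fin.ext hi.symm
      subst hi'
      have hlo : (m : ℕ) < n + 2 := by omega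
      have hhi : (m : ℕ) + 2 < n + 2 := by omega
      have e1 := cosetFace_mul_eq (h := h) (m := m) (i := ⟨m, hlo⟩) (by simp) g
      have e2 := cosetFace_mul_eq (h := h) (m := m) (i := ⟨m + 2, hhi⟩) (by simp) g
      have h1 : cosetFace h ⟨m, hlo⟩ g < e (cosetFace h m.succ.castSucc (g * s m)) := by
        rw [← hg, e.lt_iff_lt, ← e1]
        exact cosetFace_lt_cosetFace (by simp [Fin.lt_def]) _
      have h2 : e (cosetFace h m.succ.castSucc (g * s m)) < cosetFace h ⟨m + 2, hhi⟩ g := by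
        rw [← hg ⟨m + 2, hhi⟩, e.lt_iff_lt, ← e2]
        exact cosetFace_lt_cosetFace (by simp [Fin.lt_def]) _
      rcases eq_or_eq_of_lt_of_lt rfl rfl h1 h2 with h3 | h3
      · rw [← hg m.succ.castSucc, e.apply_eq_iff_eq] at h3
        exact absurd h3.symm (cosetFace_mul_ne m g)
      · exact h3
    · rw [cosetFace_mul_eq hi, hg]
  have key : ∀ g : G, ∀ i, e (cosetFace h i g) = cosetFace h i g := by
    intro g
    have hg : g ∈ Subgroup.closure (Set.range s) := by rw [h.generates]; trivial
    induction hg using Subgroup.closure_induction_right with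
    | one => exact he
    | mul_right x _ y hy ih =>
      obtain ⟨m, rfl⟩ := hy
      exact step x m ih
    | mul_inv_cancel x _ y hy ih =>
      obtain ⟨m, rfl⟩ := hy
      rw [inv_eq_self h]
      exact step x m ih
  obtain ⟨g, hx⟩ := exists_eq_cosetFace x
  rw [hx]
  exact key g _

/-- The stabiliser of the base flag is the intersection of all the face subgroups, hence is
generated by the empty set. -/
theorem eq_one_of_forall_smul_eq (h : IsStringCGroup s) {g : G}
    (hg : ∀ i, g • cosetFace h i 1 = cosetFace h i 1) : g = 1 := by
  have h1 := h.mem_closure_of_forall Set.univ (g := g) fun i _ => by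
    rw [← cosetFace_eq_one_iff (h := h), cosetFace_eq_smul, hg]
  have h2 : {m : Fin n | ∀ i ∈ (Set.univ : Set (Fin (n + 2))), (m : ℕ) + 1 ≠ i} = ∅ := by
    ext m
    simp only [Set.mem_ofPred_eq, Set.mem_empty_iff_false, iff_false]
    exact fun hm => hm m.succ.castSucc trivial rfl
  rwa [h2, Set.image_empty, Subgroup.closure_empty, Subgroup.mem_bot] at h1

/-- A string C-group is the automorphism group of its poset of cosets. -/
theorem exists_mulEquiv_orderIso (h : IsStringCGroup s) :
    ∃ e : G ≃* (CosetPoset h ≃o CosetPoset h), ∀ g x, e g x = g • x := by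
  let φ : G →* (CosetPoset h ≃o CosetPoset h) :=
    { toFun := smulOrderIso h
      map_one' := by ext x; simp
      map_mul' := fun a b => by ext x; simp [mul_smul, RelIso.mul_apply] }
  refine ⟨MulEquiv.ofBijective φ ⟨?_, ?_⟩, fun g x => rfl⟩
  · rw [injective_iff_map_eq_one]
    intro g hg
    exact eq_one_of_forall_smul_eq h fun i =>
      congrArg (fun e : CosetPoset h ≃o CosetPoset h => e (cosetFace h i 1)) hg
  · intro e
    -- The image of the base flag under `e` is the flag of some `g`; following `e` by `g⁻¹` fixes
    -- the base flag, so rigidity gives `e = g`.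
    obtain ⟨g, hg⟩ := exists_eq_cosetFlag (Flag.map e (cosetFlag h 1))
    have h1 : ∀ i, e (cosetFace h i 1) = cosetFace h i g := by
      intro i
      have : e (cosetFace h i 1) ∈ cosetFlag h g := by
        rw [← hg]
        exact ⟨_, ⟨i, rfl⟩, rfl⟩
      rw [mem_cosetFlag, index_orderIso] at this
      exact this
    refine ⟨g, ?_⟩
    ext x
    have h2 := orderIso_eq_refl (e.trans (smulOrderIso h g⁻¹))
      (fun i => by simp [h1]) x
    simp only [OrderIso.trans_apply, smulOrderIso_apply] at h2
    rw [inv_smul_eq_iff] at h2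
    exact h2.symm

end Flags

end AbstractPolytope

namespace AbstractPolytope

/-! ### Sections and duals of coset posets. -/

section Sections

/-- An order isomorphism restricts to intervals. -/
def iccOrderIso {α β : Type*} [PartialOrder α] [PartialOrder β] (e : α ≃o β) (a b : α) :
    Set.Icc a b ≃o Set.Icc (e a) (e b) where
  toEquiv := e.toEquiv.subtypeEquiv fun x => by simp
  map_rel_iff' {x y} := e.le_iff_le

variable {G : Type*} [Group G] {n : ℕ} {s : Fin n → G}

/-- Some of the generators, as elements of the subgroup that they generate. -/
def restrictGenerators (s : Fin n → G) {m : ℕ} (ι : Fin m → Fin n) (j : Fin m) :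
    Subgroup.closure (s '' Set.range ι) :=
  ⟨s (ι j), Subgroup.subset_closure ⟨ι j, ⟨j, rfl⟩, rfl⟩⟩

theorem mem_closure_restrictGenerators {m : ℕ} {ι : Fin m → Fin n} {J : Set (Fin m)}
    {k : Subgroup.closure (s '' Set.range ι)} :
    k ∈ Subgroup.closure (restrictGenerators s ι '' J) ↔
      (k : G) ∈ Subgroup.closure (s '' (ι '' J)) := by
  have h1 : s '' (ι '' J) =
      (Subgroup.closure (s '' Set.range ι)).subtype '' (restrictGenerators s ι '' J) := by
    rw [← Set.image_comp, ← Set.image_comp]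
    rfl
  rw [h1, ← MonoidHom.map_closure]
  exact (Subgroup.mem_map_iff_mem (Subgroup.subtype_injective _)).symm

theorem IsStringCGroup.restrict (h : IsStringCGroup s) {m : ℕ} {ι : Fin m → Fin n}
    (hι : Function.Injective ι) (hstring : IsString (s ∘ ι)) :
    IsStringCGroup (restrictGenerators s ι) where
  involution i := by
    rw [← h.involution (ι i), ← Subgroup.orderOf_coe]
    rfl
  generates := by
    rw [eq_top_iff]
    intro k _
    have h1 := (mem_closure_restrictGenerators (J := Set.univ) (k := k)).2
      (by rw [Set.image_univ]; exact k.2)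
    rwa [Set.image_univ] at h1
  string i j hij := Subtype.ext (hstring i j hij)
  intersection I J := by
    ext k
    rw [Subgroup.mem_inf, mem_closure_restrictGenerators, mem_closure_restrictGenerators,
      mem_closure_restrictGenerators, Set.image_inter hι, ← h.intersection]
    rfl

/-- The map `j ↦ i + j` of indices. -/
def shiftIndex {m i : ℕ} (hi : i + m ≤ n) (j : Fin m) : Fin n := ⟨i + j, by omega⟩

theorem IsStringCGroup.shift (h : IsStringCGroup s) {m i : ℕ} (hi : i + m ≤ n) :
    IsStringCGroup (restrictGenerators s (shiftIndex hi)) :=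
  h.restrict (fun a b hab => Fin.ext (by simpa [shiftIndex] using hab))
    fun a b hab => h.string _ _ (by simp only [shiftIndex]; omega)

/-- The sections of the poset of cosets are the posets of cosets of the subgroups generated by
consecutive generators. -/
theorem exists_icc_orderIso (h : IsStringCGroup s) {m i : ℕ} (hi : i + m ≤ n) (g : G)
    {a b : Fin (n + 2)} (ha : (a : ℕ) = i) (hb : (b : ℕ) = i + m + 1) :
    Nonempty (Set.Icc (cosetFace h a g) (cosetFace h b g) ≃o CosetPoset (h.shift hi)) := by
  have e := iccOrderIso (smulOrderIso h g) (cosetFace h a 1) (cosetFace h b 1)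
  have hg : ∀ c : Fin (n + 2), smulOrderIso h g (cosetFace h c 1) = cosetFace h c g := by simp
  rw [hg, hg] at e
  refine ⟨e.symm.trans ?_⟩
  set K := Subgroup.closure (s '' Set.range (shiftIndex hi)) with hK
  let c : Fin (m + 2) → Fin (n + 2) := fun j => ⟨i + j, by omega⟩
  have hab : a ≤ b := by rw [Fin.le_def]; omega
  -- The intersection property makes the face stabilisers of `K` the intersections of `K` with those
  -- of the whole group, so incidence in the small poset can be tested in the large one.
  have hface : ∀ (j : Fin (m + 2)) (k : K), k ∈ faceSubgroup (restrictGenerators s (shiftIndex hi)) j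
      ↔ (k : G) ∈ faceSubgroup s (c j) := by
    intro j k
    rw [faceSubgroup, mem_closure_restrictGenerators]
    refine ⟨fun hk => closure_image_mono s ?_ hk, fun hk => ?_⟩
    · rintro _ ⟨l, hl, rfl⟩
      simp only [Set.mem_ofPred_eq, shiftIndex, c] at hl ⊢
      omega
    · refine closure_image_mono s ?_ (h.mem_closure_inter k.2 hk)
      rintro _ ⟨⟨l, rfl⟩, hl⟩
      refine ⟨l, ?_, rfl⟩
      simp only [Set.mem_ofPred_eq, shiftIndex, c] at hl ⊢
      omega
  -- a common element of a chain of the section can be chosen in the subgroup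
  have hrep : ∀ k : G, cosetFace h a k = cosetFace h a 1 → cosetFace h b k = cosetFace h b 1 →
      ∃ u : K, ∀ j : Fin (m + 2), cosetFace h (c j) k = cosetFace h (c j) (u : G) := by
    intro k h1 h2
    -- An element fixing both end faces avoids the generators `i - 1` and `i + m`, the neighbours of
    -- the window. It is an element of `K` times a `v` from generators beyond those neighbours, and
    -- `v` fixes every base face of index from `i` to `i + m + 1`.
    obtain ⟨u, hu, v, hv, e, -⟩ := h.string.exists_mul_of_mem_closure
      (A := Set.range (shiftIndex hi)) (B := {l | (l : ℕ) + 1 < i ∨ i + m + 1 ≤ l})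
      (fun l hl => by
        simp only [Set.mem_inter_iff, Set.mem_ofPred_eq] at hl
        by_cases hl' : i ≤ l ∧ (l : ℕ) < i + m
        · exact Or.inl ⟨⟨l - i, by omega⟩, Fin.ext (by simp [shiftIndex]; omega)⟩
        · right
          simp only [Set.mem_ofPred_eq]
          omega)
      (by
        rintro _ ⟨l, rfl⟩ l' hl'
        simp only [Set.mem_ofPred_eq, shiftIndex] at hl' ⊢
        omega)
      (h.mem_closure_inter (cosetFace_eq_one_iff.1 h1) (cosetFace_eq_one_iff.1 h2))
    refine ⟨⟨u, hu⟩, fun j => ?_⟩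
    rw [eq_comm, cosetFace_eq_iff, e, inv_mul_cancel_left]
    refine closure_image_mono s (fun l hl => ?_) hv
    simp only [Set.mem_ofPred_eq, c] at hl ⊢
    omega
  have hmem : ∀ (u : K) (j : Fin (m + 2)),
      cosetFace h (c j) (u : G) ∈ Set.Icc (cosetFace h a 1) (cosetFace h b 1) := by
    intro u j
    have h1 : cosetFace h a (u : G) = cosetFace h a 1 := by
      rw [cosetFace_eq_one_iff]
      refine closure_image_mono s ?_ u.2
      rintro _ ⟨l, rfl⟩
      simp only [Set.mem_ofPred_eq, shiftIndex]
      omega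
    have h2 : cosetFace h b (u : G) = cosetFace h b 1 := by
      rw [cosetFace_eq_one_iff]
      refine closure_image_mono s ?_ u.2
      rintro _ ⟨l, rfl⟩
      simp only [Set.mem_ofPred_eq, shiftIndex]
      omega
    rw [← h1, ← h2]
    exact ⟨cosetFace_le_cosetFace (by rw [Fin.le_def]; simp [c, ha]) _,
      cosetFace_le_cosetFace (by rw [Fin.le_def]; simp [c, hb]; omega) _⟩
  choose r hr using fun x : CosetPoset (h.shift hi) => exists_eq_cosetFace x
  let f : CosetPoset (h.shift hi) → Set.Icc (cosetFace h a 1) (cosetFace h b 1) :=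
    fun x => ⟨cosetFace h (c x.index) (r x : G), hmem _ _⟩
  have hf : ∀ (x : CosetPoset (h.shift hi)) (k : K), x = cosetFace _ x.index k →
      (f x : CosetPoset h) = cosetFace h (c x.index) (k : G) := by
    intro x k hk
    have h1 := cosetFace_eq_iff.1 ((hr x).symm.trans hk)
    rw [hface] at h1
    exact cosetFace_eq_iff.2 h1
  have hle : ∀ x y, f x ≤ f y ↔ x ≤ y := by
    intro x y
    constructor
    · intro hxy
      have hxy' : cosetFace h (c x.index) (r x : G) ≤ cosetFace h (c y.index) (r y : G) := hxy
      have hc : IsChain (· ≤ ·) ({cosetFace h a 1, (f x : CosetPoset h), (f y : CosetPoset h),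
          cosetFace h b 1} : Set (CosetPoset h)) := by
        refine ((IsChain.singleton.insert ?_).insert ?_).insert ?_
        · rintro _ rfl -
          exact Or.inl (f y).2.2
        · rintro _ (rfl | rfl) -
          exacts [Or.inl hxy, Or.inl (f x).2.2]
        · rintro _ (rfl | rfl | rfl) -
          exacts [Or.inl (f x).2.1, Or.inl (f y).2.1, Or.inl (cosetFace_le_cosetFace hab 1)]
      obtain ⟨k, hk⟩ := exists_forall_eq_cosetFace hc
      obtain ⟨u, hu⟩ := hrep k (hk (cosetFace h a 1) (by simp)).symm
        (hk (cosetFace h b 1) (by simp)).symm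
      have hx : cosetFace h (c x.index) (r x : G) = cosetFace h (c x.index) (u : G) :=
        (hk (f x) (by simp)).trans (hu x.index)
      have hy : cosetFace h (c y.index) (r y : G) = cosetFace h (c y.index) (u : G) :=
        (hk (f y) (by simp)).trans (hu y.index)
      rw [cosetFace_eq_iff] at hx hy
      refine le_iff_exists.2 ⟨?_, u, ?_, ?_⟩
      · have h1 : i + (x.index : ℕ) ≤ i + y.index := index_mono hxy'
        exact Fin.le_def.2 (by omega)
      · refine (hr x).trans ((cosetFace_eq_iff (h := h.shift hi)).2 ?_)
        rwa [hface]
      · refine (hr y).trans ((cosetFace_eq_iff (h := h.shift hi)).2 ?_)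
        rwa [hface]
    · intro hxy
      obtain ⟨hij, k, hx, hy⟩ := le_iff_exists.1 hxy
      change (f x : CosetPoset h) ≤ f y
      rw [hf x k hx, hf y k hy]
      exact cosetFace_le_cosetFace (Fin.le_def.2 (Nat.add_le_add_left hij i)) _
  refine (RelIso.ofSurjective (OrderEmbedding.ofMapLEIff f hle) ?_).symm
  rintro ⟨x, hx⟩
  have hc : IsChain (· ≤ ·) ({cosetFace h a 1, x, cosetFace h b 1} : Set (CosetPoset h)) := by
    refine (IsChain.singleton.insert ?_).insert ?_
    · rintro _ rfl -
      exact Or.inl hx.2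
    · rintro _ (rfl | rfl) -
      exacts [Or.inl hx.1, Or.inl (cosetFace_le_cosetFace hab 1)]
  obtain ⟨k, hk⟩ := exists_forall_eq_cosetFace hc
  obtain ⟨u, hu⟩ := hrep k (hk (cosetFace h a 1) (by simp)).symm
        (hk (cosetFace h b 1) (by simp)).symm
  have h1 := index_mono hx.1
  have h2 := index_mono hx.2
  simp only [index_cosetFace, Fin.le_def] at h1 h2
  have h3 : c ⟨x.index - i, by omega⟩ = x.index := Fin.ext (by simp [c]; omega)
  refine ⟨cosetFace _ ⟨x.index - i, by omega⟩ u, Subtype.ext ?_⟩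
  refine (hf _ u rfl).trans ?_
  rw [index_cosetFace, ← hu, h3]
  exact (hk x (by simp)).symm

/-- Used for the facets: their group has type `{5,3}`, while the rank-three analysis is carried out
for type `{3,5}`. -/
theorem IsStringCGroup.rev (h : IsStringCGroup s) : IsStringCGroup (s ∘ Fin.rev) where
  involution i := h.involution _
  generates := by
    rw [Fin.rev_surjective.range_comp, h.generates]
  string i j hij := (h.string _ _ (by simp only [Fin.val_rev]; omega)).symm
  intersection I J := by
    rw [Set.image_comp, Set.image_comp, Set.image_comp, h.intersection,
      Set.image_inter Fin.rev_injective]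

theorem faceSubgroup_rev (s : Fin n → G) (i : Fin (n + 2)) :
    faceSubgroup (s ∘ Fin.rev) i = faceSubgroup s i.rev := by
  rw [faceSubgroup, faceSubgroup, Set.image_comp]
  congr 2
  ext j
  simp only [Set.mem_image, Set.mem_ofPred_eq, Fin.val_rev]
  constructor
  · rintro ⟨l, hl, rfl⟩
    simp only [Fin.val_rev]
    omega
  · intro hj
    exact ⟨j.rev, by simp only [Fin.val_rev]; omega, Fin.rev_rev j⟩

/-- Reversing the order of the generators gives the dual poset. -/
theorem exists_rev_orderIso (h : IsStringCGroup s) :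
    Nonempty (CosetPoset h ≃o (CosetPoset h.rev)ᵒᵈ) := by
  choose r hr using fun x : CosetPoset h => exists_eq_cosetFace x
  let f : CosetPoset h → (CosetPoset h.rev)ᵒᵈ :=
    fun x => OrderDual.toDual (cosetFace h.rev x.index.rev (r x))
  have hiff : ∀ (i : Fin (n + 2)) (g k : G), cosetFace h.rev i.rev g = cosetFace h.rev i.rev k ↔
      cosetFace h i g = cosetFace h i k := by
    intro i g k
    rw [cosetFace_eq_iff, cosetFace_eq_iff, faceSubgroup_rev, Fin.rev_rev]
  have hle : ∀ x y, f x ≤ f y ↔ x ≤ y := by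
    intro x y
    change cosetFace h.rev y.index.rev (r y) ≤ cosetFace h.rev x.index.rev (r x) ↔ _
    rw [le_iff_exists, le_iff_exists]
    simp only [index_cosetFace, hiff, ← hr, Fin.rev_le_rev, and_comm]
  refine ⟨RelIso.ofSurjective (OrderEmbedding.ofMapLEIff f hle) fun y => ?_⟩
  obtain ⟨g, hg⟩ := exists_eq_cosetFace (OrderDual.ofDual y)
  set i := (OrderDual.ofDual y).index with hi
  refine ⟨cosetFace h i.rev g, ?_⟩
  change OrderDual.toDual (cosetFace h.rev i.rev.rev (r (cosetFace h i.rev g))) = _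
  rw [(hiff i.rev _ g).2 (hr (cosetFace h i.rev g)).symm, Fin.rev_rev, ← hg]
  rfl

theorem index_of_isAtom {h : IsStringCGroup s} {x : CosetPoset h} (hn : 0 < n) (hx : IsAtom x) :
    (x.index : ℕ) = 1 := by
  obtain ⟨g, hg⟩ := exists_eq_cosetFace x
  have h1 := index_strictMono hx.bot_lt
  rw [bot_eq_cosetFace 1, index_cosetFace, Fin.lt_def] at h1
  by_contra h2
  have h3 : cosetFace h ⟨1, by omega⟩ g < x := by
    rw [hg]
    exact cosetFace_lt_cosetFace (by rw [Fin.lt_def]; simp at h1 ⊢; omega) g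
  have h4 := hx.2 _ h3
  rw [bot_eq_cosetFace 1] at h4
  have := index_eq_of_cosetFace_eq h4
  simp at this

theorem index_of_isCoatom {h : IsStringCGroup s} {x : CosetPoset h} (hx : IsCoatom x) :
    (x.index : ℕ) = n := by
  obtain ⟨g, hg⟩ := exists_eq_cosetFace x
  have h1 := index_strictMono hx.lt_top
  rw [top_eq_cosetFace 1, index_cosetFace, Fin.lt_def, Fin.val_last] at h1
  by_contra h2
  have h3 : x < cosetFace h ⟨n, by omega⟩ g := by
    rw [hg]
    exact cosetFace_lt_cosetFace (by rw [Fin.lt_def]; simp; omega) g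
  have h4 := hx.2 _ h3
  rw [top_eq_cosetFace 1] at h4
  have := index_eq_of_cosetFace_eq h4
  simp [Fin.ext_iff] at this

end Sections

end AbstractPolytope

namespace AbstractPolytope

/-! ### Dihedral groups. -/

section Dihedral

variable {G : Type*} [Group G] {p : ℕ}

/-- The power of `r` with an exponent modulo `p`. -/
def zmodPow (r : G) (i : ZMod p) : G := r ^ i.val

@[simp] theorem zmodPow_zero (r : G) : zmodPow r (0 : ZMod p) = 1 := by simp [zmodPow]

theorem zmodPow_natCast {r : G} (hr : r ^ p = 1) (k : ℕ) : zmodPow r (k : ZMod p) = r ^ k := by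
  rw [zmodPow, ZMod.val_natCast, ← pow_eq_pow_mod k hr]

theorem zmodPow_one {r : G} (hr : r ^ p = 1) : zmodPow r (1 : ZMod p) = r := by
  simpa using zmodPow_natCast hr 1

variable [NeZero p]

theorem zmodPow_add {r : G} (hr : r ^ p = 1) (i j : ZMod p) :
    zmodPow r (i + j) = zmodPow r i * zmodPow r j := by
  rw [zmodPow, zmodPow, zmodPow, ← pow_add, ZMod.val_add, ← pow_eq_pow_mod _ hr]

theorem zmodPow_neg {r : G} (hr : r ^ p = 1) (i : ZMod p) :
    zmodPow r (-i) = (zmodPow r i)⁻¹ := by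
  rw [eq_inv_iff_mul_eq_one, ← zmodPow_add hr, neg_add_cancel, zmodPow_zero]

theorem zmodPow_eq_one {r : G} (hr : orderOf r = p) {i : ZMod p} (hi : zmodPow r i = 1) :
    i = 0 := by
  rw [zmodPow, ← orderOf_dvd_iff_pow_eq_one, hr] at hi
  rw [← ZMod.val_eq_zero]
  exact Nat.eq_zero_of_dvd_of_lt hi (ZMod.val_lt i)

variable {x y : G}

/-- Conjugation by `y` inverts the rotation `x * y`. -/
theorem mul_zmodPow_of_involution (hx : x * x = 1) (hy : y * y = 1)
    (hr : (x * y) ^ p = 1) (i : ZMod p) :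
    y * zmodPow (x * y) i = zmodPow (x * y) (-i) * y := by
  rw [zmodPow_neg hr, zmodPow, ← inv_pow]
  induction i.val with
  | zero => simp
  | succ k ih =>
    rw [pow_succ, ← mul_assoc, ih, pow_succ, mul_inv_rev, inv_eq_of_mul_eq_one_left hx,
      inv_eq_of_mul_eq_one_left hy]
    simp only [mul_assoc]

theorem mul_zmodPow_of_involution' (hx : x * x = 1) (hy : y * y = 1)
    (hr : (x * y) ^ p = 1) (i : ZMod p) :
    x * zmodPow (x * y) i = zmodPow (x * y) (1 - i) * y := by
  rw [sub_eq_add_neg, zmodPow_add hr, zmodPow_one hr, mul_assoc,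
    ← mul_zmodPow_of_involution hx hy hr, mul_assoc, ← mul_assoc y, hy, one_mul]

theorem exists_eq_zmodPow_of_mem_closure (hx : x * x = 1) (hy : y * y = 1)
    (hr : (x * y) ^ p = 1) {g : G} (hg : g ∈ Subgroup.closure {x, y}) :
    ∃ i : ZMod p, g = zmodPow (x * y) i ∨ g = zmodPow (x * y) i * y := by
  have step : ∀ z ∈ ({x, y} : Set G), ∀ g : G,
      (∃ i : ZMod p, g = zmodPow (x * y) i ∨ g = zmodPow (x * y) i * y) →
      ∃ i : ZMod p, z * g = zmodPow (x * y) i ∨ z * g = zmodPow (x * y) i * y := by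
    rintro z (rfl | rfl) g ⟨i, rfl | rfl⟩
    · exact ⟨_, Or.inr (mul_zmodPow_of_involution' hx hy hr i)⟩
    · refine ⟨1 - i, Or.inl ?_⟩
      rw [← mul_assoc, mul_zmodPow_of_involution' hx hy hr, mul_assoc, hy, mul_one]
    · exact ⟨_, Or.inr (mul_zmodPow_of_involution hx hy hr i)⟩
    · refine ⟨-i, Or.inl ?_⟩
      rw [← mul_assoc, mul_zmodPow_of_involution hx hy hr, mul_assoc, hy, mul_one]
  induction hg using Subgroup.closure_induction_left with
  | one => exact ⟨0, Or.inl (by simp)⟩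
  | mul_left z hz g _ ih => exact step z hz g ih
  | inv_mul_cancel z hz g _ ih =>
    have : z⁻¹ = z := by
      rcases hz with rfl | rfl
      exacts [inv_eq_of_mul_eq_one_left hx, inv_eq_of_mul_eq_one_left hy]
    rw [this]
    exact step z hz g ih

theorem mem_closure_singleton_involution (hx : x * x = 1) {g : G}
    (hg : g ∈ Subgroup.closure {x}) : g = 1 ∨ g = x := by
  rw [← Subgroup.zpowers_eq_closure] at hg
  obtain ⟨z, rfl⟩ := hg
  obtain ⟨w, rfl | rfl⟩ := Int.even_or_odd' z
  · left; simp [zpow_mul, sq, hx]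
  · right; simp [zpow_add, zpow_mul, sq, hx]

theorem mem_closure_pair_commuting (hx : x * x = 1) (hy : y * y = 1) (hxy : x * y = y * x) {g : G}
    (hg : g ∈ Subgroup.closure {x, y}) : g = 1 ∨ g = x ∨ g = y ∨ g = x * y := by
  obtain ⟨u, hu, v, hv, rfl⟩ := exists_mul_of_mem_closure_union (A := {x}) (B := {y})
    (by rintro _ rfl _ rfl; exact hxy) hg
  rcases mem_closure_singleton_involution hx hu with rfl | rfl <;>
    rcases mem_closure_singleton_involution hy hv with rfl | rfl <;> simp

end Dihedral

/-- Meant for a map `f` that sends a face to its set of vertices, with `P` describing the vertex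
sets that occur. -/
theorem exists_orderIso_subtype {α β : Type*} [PartialOrder α] [PartialOrder β] (f : α → β)
    (hf : ∀ x y, f x ≤ f y ↔ x ≤ y) {P : β → Prop} (hP : ∀ b, P b ↔ ∃ x, f x = b) :
    Nonempty (α ≃o {b // P b}) := by
  refine ⟨RelIso.ofSurjective (OrderEmbedding.ofMapLEIff
    (fun x => (⟨f x, (hP _).2 ⟨x, rfl⟩⟩ : {b // P b})) hf) ?_⟩
  rintro ⟨b, hb⟩
  obtain ⟨x, rfl⟩ := (hP b).1 hb
  exact ⟨x, rfl⟩

/-! ### Rank two: polygons. -/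

section Polygon

variable {G : Type*} [Group G] {n : ℕ}

theorem IsStringCGroup.mul_self {s : Fin n → G} (h : IsStringCGroup s) (i : Fin n) :
    s i * s i = 1 := by
  rw [← sq, ← h.involution i, pow_orderOf_eq_one]

theorem exists_polygon_orderIso {t : Fin 2 → G} (h : IsStringCGroup t) {p : ℕ} (hp : 3 ≤ p)
    (ho : orderOf (t 0 * t 1) = p) : Nonempty (CosetPoset h ≃o Polygon p) := by
  have : NeZero p := ⟨by omega⟩
  have hsmall : ∀ k : ℕ, k < p → k ≠ 0 → (k : ZMod p) ≠ 0 := fun k hk hk0 e => by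
    rw [ZMod.natCast_eq_zero_iff] at e
    exact hk0 (Nat.eq_zero_of_dvd_of_lt e hk)
  have h10 : (1 : ZMod p) ≠ 0 := by simpa using hsmall 1 (by omega) (by omega)
  have h20 : (2 : ZMod p) ≠ 0 := by simpa using hsmall 2 (by omega) (by omega)
  have hx := h.mul_self 0
  have hy := h.mul_self 1
  have hr : (t 0 * t 1) ^ p = 1 := ho ▸ pow_orderOf_eq_one _
  set r := t 0 * t 1 with hrdef
  have hset1 : t '' {j | (j : ℕ) + 1 ≠ ((1 : Fin 4) : ℕ)} = {t 1} := by
    have : {j : Fin 2 | (j : ℕ) + 1 ≠ ((1 : Fin 4) : ℕ)} = {1} := by ext j; fin_cases j <;> simp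
    rw [this, Set.image_singleton]
  have hset2 : t '' {j | (j : ℕ) + 1 ≠ ((2 : Fin 4) : ℕ)} = {t 0} := by
    have : {j : Fin 2 | (j : ℕ) + 1 ≠ ((2 : Fin 4) : ℕ)} = {0} := by ext j; fin_cases j <;> simp
    rw [this, Set.image_singleton]
  have hf1 : ∀ g, g ∈ faceSubgroup t 1 ↔ g = 1 ∨ g = t 1 := by
    intro g
    rw [faceSubgroup, hset1]
    refine ⟨mem_closure_singleton_involution hy, ?_⟩
    rintro (rfl | rfl)
    exacts [one_mem _, Subgroup.subset_closure rfl]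
  have hf2 : ∀ g, g ∈ faceSubgroup t 2 ↔ g = 1 ∨ g = t 0 := by
    intro g
    rw [faceSubgroup, hset2]
    refine ⟨mem_closure_singleton_involution hx, ?_⟩
    rintro (rfl | rfl)
    exacts [one_mem _, Subgroup.subset_closure rfl]
  have hall : ∀ g : G, ∃ i : ZMod p, g = zmodPow r i ∨ g = zmodPow r i * t 1 := by
    intro g
    apply exists_eq_zmodPow_of_mem_closure hx hy hr
    have h1 : ({t 0, t 1} : Set G) = Set.range t := by
      ext z; simp [Fin.exists_fin_two, eq_comm]
    rw [h1, h.generates]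
    trivial
  let V : ZMod p → CosetPoset h := fun i => cosetFace h 1 (zmodPow r i)
  let E : ZMod p → CosetPoset h := fun i => cosetFace h 2 (zmodPow r i)
  have hV : ∀ i, cosetFace h 1 (zmodPow r i * t 1) = V i := by
    intro i
    rw [eq_comm, cosetFace_eq_iff, inv_mul_cancel_left, hf1]
    exact Or.inr rfl
  have hE : ∀ i, cosetFace h 2 (zmodPow r i * t 1) = E (i - 1) := by
    intro i
    rw [eq_comm, cosetFace_eq_iff, sub_eq_add_neg, zmodPow_add hr, mul_inv_rev, mul_assoc,
      inv_mul_cancel_left, zmodPow_neg hr, inv_inv, zmodPow_one hr, hf2, hrdef, mul_assoc, hy,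
      mul_one]
    exact Or.inr rfl
  have hVE : ∀ i, cosetFace h 1 (zmodPow r i * t 0) = V (i + 1) := by
    intro i
    rw [← hV, zmodPow_add hr, zmodPow_one hr, hrdef]
    simp only [mul_assoc, hy, mul_one]
  have hVinj : ∀ i j, V i = V j → i = j := by
    intro i j hij
    rw [cosetFace_eq_iff, ← zmodPow_neg hr, ← zmodPow_add hr, hf1] at hij
    rcases hij with hij | hij
    · have := zmodPow_eq_one ho hij
      rwa [neg_add_eq_zero] at this
    -- Here `t 1` would be a power of `r`, so it would commute with `r` as well as invert it; this
    -- forces `r ^ 2 = 1`, against `3 ≤ p`.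
    · exfalso
      have h1 := mul_zmodPow_of_involution hx hy hr (1 : ZMod p)
      rw [← hrdef, ← hij, ← zmodPow_add hr, ← zmodPow_add hr] at h1
      have h2 : zmodPow r (2 : ZMod p) = 1 := by
        have h3 : (2 : ZMod p) = (-i + j + 1) - (-1 + (-i + j)) := by ring
        rw [h3, sub_eq_add_neg, zmodPow_add hr, h1, ← zmodPow_add hr, add_neg_cancel,
          zmodPow_zero]
      exact h20 (zmodPow_eq_one ho h2)
  have hcases : ∀ y : CosetPoset h, y = ⊥ ∨ (∃ i, y = V i) ∨ (∃ i, y = E i) ∨ y = ⊤ := by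
    intro y
    obtain ⟨g, hg⟩ := exists_eq_cosetFace y
    obtain ⟨i, hi⟩ := hall g
    generalize y.index = j at hg
    fin_cases j
    · exact Or.inl (hg.trans (bot_eq_cosetFace g).symm)
    · right; left
      rcases hi with rfl | rfl
      exacts [⟨i, hg⟩, ⟨i, hg.trans (hV i)⟩]
    · right; right; left
      rcases hi with rfl | rfl
      exacts [⟨i, hg⟩, ⟨_, hg.trans (hE i)⟩]
    · exact Or.inr (Or.inr (Or.inr (hg.trans (top_eq_cosetFace g).symm)))
  have hle : ∀ i j, V i ≤ E j ↔ i = j ∨ i = j + 1 := by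
    intro i j
    constructor
    · intro hij
      obtain ⟨-, g, h1, h2⟩ := le_iff_exists.1 hij
      have h3 := (hf2 _).1 (cosetFace_eq_iff.1 h2)
      rw [inv_mul_eq_iff_eq_mul, inv_mul_eq_iff_eq_mul, mul_one] at h3
      rcases h3 with rfl | rfl
      · exact Or.inl (hVinj _ _ h1)
      · exact Or.inr (hVinj _ _ (h1.trans (hVE j)))
    · rintro (rfl | rfl)
      · exact cosetFace_le_cosetFace (by decide) _
      · rw [← hVE]
        refine (cosetFace_le_cosetFace (j := 2) (by decide) _).trans (le_of_eq ?_)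
        rw [eq_comm, cosetFace_eq_iff, inv_mul_cancel_left, hf2]
        exact Or.inr rfl
  have hbot : ∀ i, ¬ V i ≤ ⊥ := by
    intro i hi
    have := index_mono hi
    rw [bot_eq_cosetFace 1] at this
    exact absurd (show (1 : Fin 4) ≤ 0 from this) (by decide)
  have hVV : ∀ i j, V i ≤ V j ↔ i = j :=
    fun i j => ⟨fun hij => hVinj _ _ (eq_of_le_of_index_eq hij rfl), fun e => e ▸ le_rfl⟩
  refine exists_orderIso_subtype (fun y : CosetPoset h => {i : ZMod p | V i ≤ y}) ?_ ?_
  · intro y z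
    refine ⟨fun hyz => ?_, fun hyz i hi => le_trans hi hyz⟩
    have hyz : ∀ i, V i ≤ y → V i ≤ z := fun i hi => hyz hi
    rcases hcases y with rfl | ⟨i, rfl⟩ | ⟨i, rfl⟩ | rfl
    · exact bot_le
    · exact hyz i le_rfl
    · have h1 := hyz i ((hle _ _).2 (Or.inl rfl))
      have h2 := hyz (i + 1) ((hle _ _).2 (Or.inr rfl))
      rcases hcases z with rfl | ⟨j, rfl⟩ | ⟨j, rfl⟩ | rfl
      · exact absurd h1 (hbot _)
      · rw [hVV] at h1 h2
        exact absurd (by linear_combination h2 - h1) h10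
      · rw [hle] at h1 h2
        rcases h1 with h1 | h1
        · rw [h1]
        · rcases h2 with h2 | h2
          · exact absurd (by linear_combination h2 - h1) h20
          · exact absurd (by linear_combination h2 - h1) h10
      · exact le_top
    · rcases hcases z with rfl | ⟨j, rfl⟩ | ⟨j, rfl⟩ | rfl
      · exact absurd (hyz 0 le_top) (hbot _)
      · have h1 := hyz (j + 1) le_top
        rw [hVV] at h1
        exact absurd (by linear_combination h1) h10
      · have h1 := hyz (j + 2) le_top
        rw [hle] at h1
        rcases h1 with h1 | h1
        · exact absurd (by linear_combination h1) h20
        · exact absurd (by linear_combination h1) h10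
      · exact le_rfl
  · intro F
    constructor
    · rintro (rfl | ⟨i, hF⟩)
      · exact ⟨⊤, by ext; simp⟩
      · rw [Set.subset_pair_iff_eq] at hF
        rcases hF with rfl | rfl | rfl | rfl
        · exact ⟨⊥, by ext j; simpa using hbot j⟩
        · exact ⟨V i, by ext j; simp [hVV]⟩
        · exact ⟨V (i + 1), by ext j; simp [hVV]⟩
        · exact ⟨E i, by ext j; simp [hle]⟩
    · rintro ⟨y, rfl⟩
      rcases hcases y with rfl | ⟨i, rfl⟩ | ⟨i, rfl⟩ | rfl
      · exact Or.inr ⟨0, fun j hj => absurd hj (hbot j)⟩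
      · exact Or.inr ⟨i, fun j hj => Or.inl ((hVV _ _).1 hj)⟩
      · exact Or.inr ⟨i, fun j hj => (hle _ _).1 hj⟩
      · exact Or.inl (by ext; simp)

end Polygon

end AbstractPolytope

namespace AbstractPolytope

/-! ### Computations in the icosahedral Coxeter group. -/

section IcosahedralGroup

variable {G : Type*} [Group G]

/-- The relations of the Coxeter group of the icosahedron. -/
structure IcosahedralRelations (a b c : G) : Prop where
  aa : a * a = 1
  bb : b * b = 1
  cc : c * c = 1
  ba : (b * a) ^ 5 = 1
  cbc : c * b * c = b * c * b
  ca : c * a = a * c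

/-- The image of the central inversion of the icosahedron. -/
def centralElement (a b c : G) : G := (a * b * c) ^ 5

namespace IcosahedralRelations

variable {a b c : G} (h : IcosahedralRelations a b c)

include h

/-- The relations carry a trailing factor `x` so that they rewrite anywhere inside a
right-associated product. The involutions cancel letters; every other rule replaces a word by one of
the same length that is lexicographically smaller for `a < b < c`. -/
theorem aa' (x : G) : a * (a * x) = x := by rw [← mul_assoc, h.aa, one_mul]
theorem bb' (x : G) : b * (b * x) = x := by rw [← mul_assoc, h.bb, one_mul]
theorem cc' (x : G) : c * (c * x) = x := by rw [← mul_assoc, h.cc, one_mul]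

theorem ca' (x : G) : c * (a * x) = a * (c * x) := by rw [← mul_assoc, h.ca, mul_assoc]

theorem cbc' (x : G) : c * (b * (c * x)) = b * (c * (b * x)) := by
  have := congrArg (· * x) h.cbc
  simpa only [mul_assoc] using this

theorem babab' (x : G) :
    b * (a * (b * (a * (b * x)))) = a * (b * (a * (b * (a * x)))) := by
  have h1 : b * (a * (b * (a * (b * (a * (b * (a * (b * (a * (a * (b * (a * (b * (a * x)))))))))))))) =
      a * (b * (a * (b * (a * x)))) := by
    have := congrArg (· * (a * (b * (a * (b * (a * x)))))) h.ba
    simpa only [pow_succ, pow_zero, one_mul, mul_assoc] using this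
  simpa only [h.aa', h.bb'] using h1

/-- This rule and the next two come from overlaps of the defining relations; they let `simp`
complete the word computations below. -/
theorem cbac' (x : G) : c * (b * (a * (c * x))) = b * (c * (b * (a * x))) := by
  rw [← h.ca', h.cbc']

theorem cbabcb' (x : G) :
    c * (b * (a * (b * (c * (b * x))))) = b * (c * (b * (a * (b * (c * x))))) := by
  rw [← h.cbc' x, h.cbac']

theorem cbabacbaba' (x : G) :
    c * (b * (a * (b * (a * (c * (b * (a * (b * (a * x))))))))) =
      b * (c * (b * (a * (b * (a * (c * (b * (a * (b * x))))))))) := by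
  rw [← h.ca', ← h.babab', h.cbabcb', h.ca']

/-- A rewritten word for `(abc)⁵`. It has 15 letters, the length of the longest element of the
Coxeter group. -/
theorem centralElement_mul (x : G) : centralElement a b c * x =
    a * (b * (a * (b * (a * (c * (b * (a * (b * (a * (c * (b * (a * (b * (c * x)))))))))))))) := by
  simp only [centralElement, pow_succ, pow_zero, one_mul, mul_assoc]
  simp only [h.ca', h.cbc', h.babab', h.cbabcb', h.cbabacbaba']

theorem centralElement_comm' {s : G} (hs : s ∈ ({a, b, c} : Set G)) (x : G) :
    s * (centralElement a b c * x) = centralElement a b c * (s * x) := by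
  rw [h.centralElement_mul, h.centralElement_mul]
  rcases hs with rfl | rfl | rfl <;>
  simp only [h.aa', h.cc', h.ca', h.cbc', h.babab', h.cbac', h.cbabcb', h.cbabacbaba']

theorem centralElement_comm {s : G} (hs : s ∈ ({a, b, c} : Set G)) :
    s * centralElement a b c = centralElement a b c * s := by
  simpa using h.centralElement_comm' hs 1

theorem centralElement_mul_self : centralElement a b c * centralElement a b c = 1 := by
  have h1 : ∀ x, centralElement a b c * (centralElement a b c * x) = x := by
    intro x
    rw [h.centralElement_mul, h.centralElement_mul]
    simp only [h.aa', h.bb', h.cc', h.ca', h.cbc', h.babab', h.cbac', h.cbabcb', h.cbabacbaba']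
  simpa using h1 1

/-- Vertex `i` of the pentagon is the image of the north pole under `(b * a) ^ i * c`. The
reflection `c` exchanges the pole and vertex `0`, fixes their common neighbours `1` and `4`, and
sends vertex `2` to the antipode of vertex `3`. The formulas for `1`, `2` and `4` express this, with
a last factor in the stabiliser `⟨a, b⟩` of the pole. -/
theorem mul_rotation_one : c * (b * a * c) = b * a * c * (a * b * a) := by
  have h1 : ∀ x, c * (b * (a * (c * x))) = b * (a * (c * (a * (b * (a * x))))) := by
    intro x
    simp only [h.ca', h.cbac', h.aa']
  simpa only [mul_assoc, mul_one] using h1 1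

theorem mul_rotation_two : c * ((b * a) ^ 2 * c) =
    centralElement a b c * ((b * a) ^ 3 * c) * ((b * a) ^ 2)⁻¹ := by
  rw [eq_mul_inv_iff_mul_eq]
  have h1 : ∀ x, c * (b * (a * (b * (a * (c * (b * (a * (b * (a * x))))))))) =
      centralElement a b c * (b * (a * (b * (a * (b * (a * (c * x))))))) := by
    intro x
    rw [h.centralElement_mul]
    simp only [h.aa', h.bb', h.ca', h.cbc', h.babab', h.cbac', h.cbabcb', h.cbabacbaba']
  simpa only [pow_succ, pow_zero, one_mul, mul_assoc, mul_one] using h1 1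

theorem mul_rotation_four : c * ((b * a) ^ 4 * c) = (b * a) ^ 4 * c * b := by
  have h1 : ∀ x, c * (b * (a * (b * (a * (b * (a * (b * (a * (c * x))))))))) =
      b * (a * (b * (a * (b * (a * (b * (a * (c * (b * x))))))))) := by
    intro x
    simp only [h.aa', h.bb', h.ca', h.cbc', h.babab']
  simpa only [pow_succ, pow_zero, one_mul, mul_assoc, mul_one] using h1 1

end IcosahedralRelations

/-- An element that moves the base vertex to the given vertex of the icosahedron. -/
def vertexElement (a b c : G) (v : IcosahedronVertex) : G :=
  (if v.2 then centralElement a b c else 1) *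
    (match v.1 with
      | none => 1
      | some i => zmodPow (b * a) i * c)

/-- The reflection of the icosahedron that fixes the north pole and the vertex `0`. -/
def vertexReflectionA (v : IcosahedronVertex) : IcosahedronVertex := (v.1.map fun i => -i, v.2)

/-- The reflection of the icosahedron that fixes the north pole and interchanges the vertices
`0` and `1`. -/
def vertexReflectionB (v : IcosahedronVertex) : IcosahedronVertex := (v.1.map fun i => 1 - i, v.2)

/-- The reflection of the icosahedron that interchanges the north pole and the vertex `0`. -/
def vertexReflectionC (v : IcosahedronVertex) : IcosahedronVertex :=
  match v.1 with
  | none => (some 0, v.2)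
  | some i => if i = 0 then (none, v.2) else if i = 2 then (some 3, !v.2) else
    if i = 3 then (some 2, !v.2) else v

/-- The central inversion of the icosahedron. -/
def vertexInversion (v : IcosahedronVertex) : IcosahedronVertex := (v.1, !v.2)

namespace IcosahedralRelations

variable {a b c : G} (h : IcosahedralRelations a b c)

include h

theorem comm_ite {s : G} (hs : s ∈ ({a, b, c} : Set G)) (β : Bool) (x : G) :
    s * ((if β then centralElement a b c else 1) * x) =
      (if β then centralElement a b c else 1) * (s * x) := by
  cases β
  · simp
  · simpa using h.centralElement_comm' hs x

theorem a_mul_vertexElement (v : IcosahedronVertex) :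
    a * vertexElement a b c v = vertexElement a b c (vertexReflectionA v) * a := by
  obtain ⟨v, β⟩ := v
  unfold vertexElement
  rw [h.comm_ite (by simp)]
  cases v with
  | none => cases β <;> simp [vertexReflectionA]
  | some i =>
    simp only [vertexReflectionA, Option.map_some]
    rw [← mul_assoc a, mul_zmodPow_of_involution h.bb h.aa h.ba]
    simp only [mul_assoc, h.ca]
    rfl

theorem b_mul_vertexElement (v : IcosahedronVertex) :
    ∃ d ∈ Subgroup.closure {b, a},
      b * vertexElement a b c v = vertexElement a b c (vertexReflectionB v) * d := by
  obtain ⟨v, β⟩ := v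
  unfold vertexElement
  rw [h.comm_ite (by simp)]
  cases v with
  | none => exact ⟨b, Subgroup.subset_closure (by simp), by cases β <;> simp [vertexReflectionB]⟩
  | some i =>
    refine ⟨a, Subgroup.subset_closure (by simp), ?_⟩
    simp only [vertexReflectionB, Option.map_some]
    rw [← mul_assoc b, mul_zmodPow_of_involution' h.bb h.aa h.ba]
    simp only [mul_assoc, h.ca]
    rfl

theorem centralElement_mul_vertexElement (v : IcosahedronVertex) :
    centralElement a b c * vertexElement a b c v = vertexElement a b c (vertexInversion v) := by
  obtain ⟨v, β⟩ := v
  cases β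
  · simp [vertexElement, vertexInversion]
  · simp [vertexElement, vertexInversion, ← mul_assoc, h.centralElement_mul_self]

theorem c_mul_vertexElement (v : IcosahedronVertex) :
    ∃ d ∈ Subgroup.closure {b, a},
      c * vertexElement a b c v = vertexElement a b c (vertexReflectionC v) * d := by
  have ha : a ∈ Subgroup.closure {b, a} := Subgroup.subset_closure (by simp)
  have hb : b ∈ Subgroup.closure {b, a} := Subgroup.subset_closure (by simp)
  have hpow : ∀ k : ℕ, zmodPow (b * a) (k : ZMod 5) = (b * a) ^ k := zmodPow_natCast h.ba
  have hz : ∀ (β : Bool) (x : G), (if β then centralElement a b c else 1) *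
      (centralElement a b c * x) = (if !β then centralElement a b c else 1) * x := by
    intro β x
    cases β
    · simp
    · simp [← mul_assoc, h.centralElement_mul_self]
  obtain ⟨v, β⟩ := v
  unfold vertexElement
  rw [h.comm_ite (by simp)]
  cases v with
  | none => exact ⟨1, one_mem _, by cases β <;> simp [vertexReflectionC]⟩
  | some i =>
    have h2 := h.mul_rotation_two
    have hi : i = ((0 : ℕ) : ZMod 5) ∨ i = ((1 : ℕ) : ZMod 5) ∨ i = ((2 : ℕ) : ZMod 5) ∨
      i = ((3 : ℕ) : ZMod 5) ∨ i = ((4 : ℕ) : ZMod 5) := by revert i; decide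
    rcases hi with rfl | rfl | rfl | rfl | rfl
    · refine ⟨1, one_mem _, ?_⟩
      simp [vertexReflectionC, h.cc]
    · refine ⟨a * b * a, mul_mem (mul_mem ha hb) ha, ?_⟩
      have e : vertexReflectionC (some ((1 : ℕ) : ZMod 5), β) = (some ((1 : ℕ) : ZMod 5), β) := by
        cases β <;> decide
      have h1 := h.mul_rotation_one
      simp only [mul_assoc] at h1
      simp only [e, hpow, pow_one, h1, mul_assoc]
    · refine ⟨((b * a) ^ 2)⁻¹, inv_mem (pow_mem (mul_mem hb ha) 2), ?_⟩
      have e : vertexReflectionC (some ((2 : ℕ) : ZMod 5), β) = (some ((3 : ℕ) : ZMod 5), !β) := by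
        cases β <;> decide
      simp only [e, hpow, h2, mul_assoc, hz]
    · refine ⟨(b * a) ^ 2, pow_mem (mul_mem hb ha) 2, ?_⟩
      have e : vertexReflectionC (some ((3 : ℕ) : ZMod 5), β) = (some ((2 : ℕ) : ZMod 5), !β) := by
        cases β <;> decide
      -- Vertex `3` needs no new word computation: multiply the formula for vertex `2` by the
      -- involutions `c` and `z`.
      have h3 : c * ((b * a) ^ 3 * c) = centralElement a b c * ((b * a) ^ 2 * c * (b * a) ^ 2) := by
        rw [eq_mul_inv_iff_mul_eq] at h2
        have h4 := congrArg (fun x => c * (centralElement a b c * x)) h2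
        simp only [← mul_assoc (centralElement a b c) (centralElement a b c),
          h.centralElement_mul_self, one_mul, mul_assoc, h.centralElement_comm' (s := c) (by simp),
          h.cc'] at h4
        simp only [mul_assoc]
        exact h4.symm
      simp only [e, hpow, h3, hz, mul_assoc]
    · refine ⟨b, hb, ?_⟩
      have e : vertexReflectionC (some ((4 : ℕ) : ZMod 5), β) = (some ((4 : ℕ) : ZMod 5), β) := by
        cases β <;> decide
      simp only [e, hpow, h.mul_rotation_four, mul_assoc]

end IcosahedralRelations

end IcosahedralGroup

end AbstractPolytope

namespace AbstractPolytope

/-! ### Rank three: faces are determined by their vertices. -/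

section IcosahedralPoset

variable {G : Type*} [Group G] {t : Fin 3 → G}

theorem faceSubgroup_one (t : Fin 3 → G) : faceSubgroup t 1 = Subgroup.closure {t 1, t 2} := by
  have : {j : Fin 3 | (j : ℕ) + 1 ≠ ((1 : Fin 5) : ℕ)} = {1, 2} := by ext j; fin_cases j <;> simp
  rw [faceSubgroup, this, Set.image_pair]

theorem faceSubgroup_two (t : Fin 3 → G) : faceSubgroup t 2 = Subgroup.closure {t 0, t 2} := by
  have : {j : Fin 3 | (j : ℕ) + 1 ≠ ((2 : Fin 5) : ℕ)} = {0, 2} := by ext j; fin_cases j <;> simp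
  rw [faceSubgroup, this, Set.image_pair]

theorem faceSubgroup_three (t : Fin 3 → G) : faceSubgroup t 3 = Subgroup.closure {t 0, t 1} := by
  have : {j : Fin 3 | (j : ℕ) + 1 ≠ ((3 : Fin 5) : ℕ)} = {0, 1} := by ext j; fin_cases j <;> simp
  rw [faceSubgroup, this, Set.image_pair]

/-- The face of rank zero that corresponds to a vertex of the icosahedron. -/
def vertexFace (h : IsStringCGroup t) (v : IcosahedronVertex) : CosetPoset h :=
  cosetFace h 1 (vertexElement (t 2) (t 1) (t 0) v)

variable {h : IsStringCGroup t}

theorem vertexFace_north : vertexFace h (none, false) = cosetFace h 1 1 := by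
  simp [vertexFace, vertexElement]

/-- An involution of the group acts on the vertices of the icosahedron by an involution. -/
structure ActsOnVertices (h : IsStringCGroup t) (s : G)
    (α : IcosahedronVertex → IcosahedronVertex) : Prop where
  mul_self : s * s = 1
  smul : ∀ v, s • vertexFace h v = vertexFace h (α v)

theorem ActsOnVertices.smul_smul {s : G} {α : IcosahedronVertex → IcosahedronVertex}
    (hs : ActsOnVertices h s α) (y : CosetPoset h) : s • s • y = y := by
  rw [← mul_smul, hs.mul_self, one_smul]

theorem ActsOnVertices.le_smul_iff {s : G} {α : IcosahedronVertex → IcosahedronVertex}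
    (hs : ActsOnVertices h s α) (v : IcosahedronVertex) (y : CosetPoset h) :
    vertexFace h v ≤ s • y ↔ vertexFace h (α v) ≤ y := by
  rw [← hs.smul]
  refine ⟨fun hv => ?_, fun hv => ?_⟩
  · rw [← hs.smul_smul y]
    exact smul_le_smul_cosetPoset s hv
  · rw [← hs.smul_smul (vertexFace h v)]
    exact smul_le_smul_cosetPoset s hv

/-- The orbit of the base vertex under some of the generators. -/
theorem exists_smul_north_of_mem_closure {S : Set G} {T : Finset IcosahedronVertex}
    (hT : (none, false) ∈ T)
    (hS : ∀ s ∈ S, ∃ α, ActsOnVertices h s α ∧ ∀ v ∈ T, α v ∈ T) {g : G}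
    (hg : g ∈ Subgroup.closure S) : ∃ v ∈ T, g • cosetFace h 1 1 = vertexFace h v := by
  have step : ∀ s ∈ S, ∀ g : G, (∃ v ∈ T, g • cosetFace h 1 1 = vertexFace h v) →
      ∃ v ∈ T, (s * g) • cosetFace h 1 1 = vertexFace h v := by
    rintro s hs g ⟨v, hv, e⟩
    obtain ⟨α, hα, hαT⟩ := hS s hs
    exact ⟨α v, hαT v hv, by rw [mul_smul, e, hα.smul]⟩
  induction hg using Subgroup.closure_induction_left with
  | one => exact ⟨_, hT, by rw [one_smul, vertexFace_north]⟩
  | mul_left s hs g _ ih => exact step s hs g ih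
  | inv_mul_cancel s hs g _ ih =>
    obtain ⟨α, hα, -⟩ := hS s hs
    rw [inv_eq_of_mul_eq_one_left hα.mul_self]
    exact step s hs g ih

/-- The vertices of a base face are the orbit of the base vertex under its stabiliser, and a set of
labels that contains the north pole and is closed under the generators `S` contains labels for the
whole orbit. -/
theorem le_cosetFace_iff {S : Set G} {j : Fin 5} (hj : faceSubgroup t j = Subgroup.closure S)
    {T : Finset IcosahedronVertex} (hT : (none, false) ∈ T)
    (hS : ∀ s ∈ S, ∃ α, ActsOnVertices h s α ∧ ∀ v ∈ T, α v ∈ T)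
    (hle : ∀ v ∈ T, vertexFace h v ≤ cosetFace h j 1) (w : IcosahedronVertex) :
    vertexFace h w ≤ cosetFace h j 1 ↔ ∃ v ∈ T, vertexFace h w = vertexFace h v := by
  constructor
  · intro hw
    obtain ⟨-, g, h1, h2⟩ := le_iff_exists.1 hw
    have h3 := cosetFace_eq_one_iff.1 h2.symm
    rw [index_cosetFace, hj] at h3
    obtain ⟨v, hv, e⟩ := exists_smul_north_of_mem_closure hT hS h3
    refine ⟨v, hv, ?_⟩
    rw [h1, ← e]
    simp [vertexFace]
  · rintro ⟨v, hv, e⟩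
    rw [e]
    exact hle v hv

theorem exists_vertexReflectionC_eq : ∀ k : ZMod 5, k ≠ 0 → ∀ γ : Bool,
    ∃ k' γ', vertexReflectionC (some k, γ) = (some k', γ') := by
  decide

theorem smul_base {m : Fin 3} {i : Fin 5} (hm : (m : ℕ) + 1 ≠ i) :
    t m • cosetFace h i 1 = cosetFace h i 1 := by
  rw [smul_cosetFace, mul_one, cosetFace_eq_one_iff]
  exact mem_faceSubgroup hm

/-- Every vertex of the first face is a vertex of the second face. -/
def VertexLE (y w : CosetPoset h) : Prop := ∀ v, vertexFace h v ≤ y → vertexFace h v ≤ w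

section

variable (ht : IcosahedralRelations (t 2) (t 1) (t 0))

include ht

theorem actsOnVertices_a : ActsOnVertices h (t 2) vertexReflectionA where
  mul_self := ht.aa
  smul v := by
    rw [vertexFace, smul_cosetFace, ht.a_mul_vertexElement, eq_comm, vertexFace, cosetFace_eq_iff,
      inv_mul_cancel_left, faceSubgroup_one]
    exact Subgroup.subset_closure (by simp)

theorem actsOnVertices_b : ActsOnVertices h (t 1) vertexReflectionB where
  mul_self := ht.bb
  smul v := by
    obtain ⟨d, hd, e⟩ := ht.b_mul_vertexElement v
    rw [vertexFace, smul_cosetFace, e, eq_comm, vertexFace, cosetFace_eq_iff,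
      inv_mul_cancel_left, faceSubgroup_one]
    exact hd

theorem actsOnVertices_c : ActsOnVertices h (t 0) vertexReflectionC where
  mul_self := ht.cc
  smul v := by
    obtain ⟨d, hd, e⟩ := ht.c_mul_vertexElement v
    rw [vertexFace, smul_cosetFace, e, eq_comm, vertexFace, cosetFace_eq_iff,
      inv_mul_cancel_left, faceSubgroup_one]
    exact hd

theorem actsOnVertices_centralElement :
    ActsOnVertices h (centralElement (t 2) (t 1) (t 0)) vertexInversion where
  mul_self := ht.centralElement_mul_self
  smul v := by
    rw [vertexFace, smul_cosetFace, ht.centralElement_mul_vertexElement, vertexFace]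

theorem zmodPow_smul_north (i : ZMod 5) (β : Bool) :
    zmodPow (t 1 * t 2) i • vertexFace h (none, β) = vertexFace h (none, β) := by
  rw [zmodPow]
  induction i.val with
  | zero => simp
  | succ k ih =>
    rw [pow_succ', mul_smul, ih, mul_smul, (actsOnVertices_a ht).smul, (actsOnVertices_b ht).smul]
    rfl

theorem zmodPow_smul_vertexFace (i j : ZMod 5) (β : Bool) :
    zmodPow (t 1 * t 2) i • vertexFace h (some j, β) = vertexFace h (some (i + j), β) := by
  obtain ⟨k, rfl⟩ : ∃ k : ℕ, (k : ZMod 5) = i := ⟨i.val, ZMod.natCast_zmod_val i⟩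
  rw [zmodPow_natCast ht.ba]
  induction k with
  | zero => simp
  | succ k ih =>
    rw [pow_succ', mul_smul, ih, mul_smul, (actsOnVertices_a ht).smul, (actsOnVertices_b ht).smul]
    simp only [vertexReflectionA, vertexReflectionB, Option.map_some]
    congr 3
    push_cast
    ring

/-- If a pole coincided with a pentagon vertex, rotation would identify it with all five vertices of
that pentagon. Either vertex `0` of its own pentagon is among them, or applying the reflection `t 0`
to the equation for vertex `1`, which it fixes, identifies the pole with that vertex `0`. After the
central inversion if necessary, `t 0` fixes the base vertex, which the intersection property
excludes. -/
theorem vertexFace_north_ne (β γ : Bool) (i : ZMod 5) :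
    vertexFace h (none, β) ≠ vertexFace h (some i, γ) := by
  intro e
  have hrot : ∀ j, vertexFace h (none, β) = vertexFace h (some j, γ) := by
    intro j
    have := congrArg (zmodPow (t 1 * t 2) (j - i) • ·) e
    simpa only [zmodPow_smul_north ht, zmodPow_smul_vertexFace ht, sub_add_cancel] using this
  have hc : vertexFace h (none, β) = vertexFace h (some 0, β) := by
    by_cases hβ : β = γ
    · rw [hβ]
      exact hβ ▸ hrot 0
    · have h1 := congrArg (t 0 • ·) (hrot 1)
      simp only [(actsOnVertices_c ht).smul] at h1
      have h2 : vertexFace h (some 0, β) = vertexFace h (some 1, γ) := h1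
      rw [h2, ← hrot]
  have hc' : vertexFace h (none, false) = vertexFace h (some 0, false) := by
    cases β
    · exact hc
    · have := congrArg (centralElement (t 2) (t 1) (t 0) • ·) hc
      simp only [(actsOnVertices_centralElement ht).smul] at this
      exact this
  have h3 : t 0 • vertexFace h (none, false) = vertexFace h (none, false) := by
    rw [(actsOnVertices_c ht).smul]
    exact hc'.symm
  rw [vertexFace_north, smul_cosetFace, mul_one, cosetFace_eq_one_iff] at h3
  exact h.notMem_faceSubgroup 0 h3

/-- Labels can coincide only within an antipodal pair. A rotation followed by `t 0` carries the
first of two pentagon vertices to a pole and, if the positions differ, leaves the second on a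
pentagon, which reduces to the preceding lemma. -/
theorem fst_eq_of_vertexFace_eq {v w : IcosahedronVertex}
    (e : vertexFace h v = vertexFace h w) : v.1 = w.1 := by
  obtain ⟨_ | i, β⟩ := v <;> obtain ⟨_ | j, γ⟩ := w
  · rfl
  · exact absurd e (vertexFace_north_ne ht _ _ _)
  · exact absurd e.symm (vertexFace_north_ne ht _ _ _)
  · have h1 := congrArg (t 0 • zmodPow (t 1 * t 2) (-i) • ·) e
    simp only [zmodPow_smul_vertexFace ht, (actsOnVertices_c ht).smul, neg_add_cancel] at h1
    by_contra hij
    have hk : -i + j ≠ 0 := fun hk => hij (congrArg some (by linear_combination -hk))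
    revert h1
    generalize -i + j = k at hk
    obtain ⟨k', γ', h2⟩ := exists_vertexReflectionC_eq k hk γ
    rw [h2]
    exact vertexFace_north_ne ht _ _ _

theorem exists_vertexFace_eq {y : CosetPoset h} (hy : y.index = 1) :
    ∃ v, y = vertexFace h v := by
  obtain ⟨g, hg⟩ := exists_eq_cosetFace y
  have hgt : g ∈ Subgroup.closure (Set.range t) := by rw [h.generates]; trivial
  obtain ⟨v, -, e⟩ := exists_smul_north_of_mem_closure (h := h) (Finset.mem_univ _)
    (by
      rintro _ ⟨j, rfl⟩
      fin_cases j
      exacts [⟨_, actsOnVertices_c ht, by simp⟩, ⟨_, actsOnVertices_b ht, by simp⟩,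
        ⟨_, actsOnVertices_a ht, by simp⟩]) hgt
  refine ⟨v, ?_⟩
  rw [hg, hy, cosetFace_eq_smul, e]

theorem vertexFace_le_base {j : Fin 5} (hj : 2 ≤ j) :
    vertexFace h (none, false) ≤ cosetFace h j 1 ∧ vertexFace h (some 0, false) ≤ cosetFace h j 1 := by
  have h1 : ∀ j : Fin 5, 1 ≤ j → vertexFace h (none, false) ≤ cosetFace h j 1 := by
    intro j hj
    rw [vertexFace_north]
    exact cosetFace_le_cosetFace hj 1
  have h2 : vertexFace h (some 0, false) ≤ cosetFace h 2 1 := by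
    have := smul_le_smul_cosetPoset (t 0) (h1 2 (by decide))
    rwa [smul_base (by decide), (actsOnVertices_c ht).smul] at this
  exact ⟨h1 j (le_trans (by decide) hj), h2.trans (cosetFace_le_cosetFace hj 1)⟩

theorem vertexFace_le_edge_iff (w : IcosahedronVertex) :
    vertexFace h w ≤ cosetFace h 2 1 ↔
      ∃ v ∈ ({(none, false), (some 0, false)} : Finset IcosahedronVertex),
        vertexFace h w = vertexFace h v := by
  refine le_cosetFace_iff (faceSubgroup_two t) (by decide) ?_ ?_ w
  · rintro s (rfl | rfl)
    · exact ⟨_, actsOnVertices_c ht, by decide⟩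
    · exact ⟨_, actsOnVertices_a ht, by decide⟩
  · have h1 := vertexFace_le_base (h := h) ht (j := 2) le_rfl
    simpa using h1

theorem vertexFace_le_triangle_iff (w : IcosahedronVertex) :
    vertexFace h w ≤ cosetFace h 3 1 ↔
      ∃ v ∈ ({(none, false), (some 0, false), (some 1, false)} : Finset IcosahedronVertex),
        vertexFace h w = vertexFace h v := by
  refine le_cosetFace_iff (faceSubgroup_three t) (by decide) ?_ ?_ w
  · rintro s (rfl | rfl)
    · exact ⟨_, actsOnVertices_c ht, by decide⟩
    · exact ⟨_, actsOnVertices_b ht, by decide⟩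
  · have h1 := vertexFace_le_base (h := h) ht (j := 3) (by decide)
    have h2 := smul_le_smul_cosetPoset (t 1) h1.2
    rw [smul_base (by decide), (actsOnVertices_b ht).smul] at h2
    have h3 : vertexFace h (some 1, false) ≤ cosetFace h 3 1 := h2
    simpa using ⟨h1.1, h1.2, h3⟩

theorem VertexLE.smul (g : G) {y w : CosetPoset h} (hyw : VertexLE y w) :
    VertexLE (g • y) (g • w) := by
  intro v hv
  obtain ⟨v', e⟩ := exists_vertexFace_eq ht (y := g⁻¹ • vertexFace h v) rfl
  have h1 := smul_le_smul_cosetPoset g⁻¹ hv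
  rw [inv_smul_smul, e] at h1
  have h2 := smul_le_smul_cosetPoset g (hyw v' h1)
  rwa [← e, smul_inv_smul] at h2

/-- The stabiliser of the larger base face can be used to move one end of the edge to the north
pole. The edge is then a rotation of the base edge by some `i`, and its other end, vertex `i`, must
belong to the base face: `i = 0`, or `i = 1` for the triangle. -/
theorem VertexLE.edge_le {j : Fin 5} (hj : j = 2 ∨ j = 3) {g : G}
    (hg : VertexLE (g • cosetFace h 2 1) (cosetFace h j 1)) :
    g • cosetFace h 2 1 ≤ cosetFace h j 1 := by
  have hj2 : 2 ≤ j := by rcases hj with rfl | rfl <;> decide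
  have h1 : g • cosetFace h 1 1 ≤ cosetFace h j 1 := by
    obtain ⟨v, e⟩ := exists_vertexFace_eq ht (y := g • cosetFace h 1 1) rfl
    rw [e]
    apply hg
    rw [← e]
    exact smul_le_smul_cosetPoset g (cosetFace_le_cosetFace (by decide) 1)
  obtain ⟨k, hk1, hk2⟩ := exists_smul_of_le h1
  simp only [index_smul, index_cosetFace] at hk1 hk2
  have hfix : (k⁻¹ * g) • cosetFace h 1 1 = cosetFace h 1 1 := by
    rw [mul_smul, hk1, inv_smul_smul]
  have hkj : k⁻¹ • cosetFace h j 1 = cosetFace h j 1 := by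
    rw [inv_smul_eq_iff]
    exact hk2
  suffices h2 : (k⁻¹ * g) • cosetFace h 2 1 ≤ cosetFace h j 1 by
    have h3 := smul_le_smul_cosetPoset k h2
    rwa [smul_smul, mul_inv_cancel_left, ← hk2] at h3
  have hle := hg.smul ht k⁻¹
  rw [hkj, smul_smul] at hle
  rw [smul_cosetFace, mul_one, cosetFace_eq_one_iff, faceSubgroup_one] at hfix
  obtain ⟨i, hi⟩ := exists_eq_zmodPow_of_mem_closure ht.bb ht.aa ht.ba hfix
  have h3 : (k⁻¹ * g) • cosetFace h 2 1 = zmodPow (t 1 * t 2) i • cosetFace h 2 1 := by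
    rcases hi with hi | hi
    · rw [hi]
    · rw [hi, mul_smul, smul_base (by decide)]
  rw [h3] at hle ⊢
  have h4 : vertexFace h (some i, false) ≤ cosetFace h j 1 := by
    apply hle
    have := smul_le_smul_cosetPoset (zmodPow (t 1 * t 2) i)
      (vertexFace_le_base (h := h) ht (j := 2) le_rfl).2
    rwa [zmodPow_smul_vertexFace ht, add_zero] at this
  have h5 : j = 3 ∧ i = 1 ∨ i = 0 := by
    rcases hj with rfl | rfl
    · obtain ⟨v, hv, e⟩ := (vertexFace_le_edge_iff ht _).1 h4
      have e' := fst_eq_of_vertexFace_eq ht e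
      simp only [Finset.mem_insert, Finset.mem_singleton] at hv
      rcases hv with rfl | rfl
      · exact absurd e' (by simp)
      · exact Or.inr (Option.some.inj e')
    · obtain ⟨v, hv, e⟩ := (vertexFace_le_triangle_iff ht _).1 h4
      have e' := fst_eq_of_vertexFace_eq ht e
      simp only [Finset.mem_insert, Finset.mem_singleton] at hv
      rcases hv with rfl | rfl | rfl
      · exact absurd e' (by simp)
      · exact Or.inr (Option.some.inj e')
      · exact Or.inl ⟨rfl, Option.some.inj e'⟩
  rcases h5 with ⟨rfl, rfl⟩ | rfl
  · rw [zmodPow_one ht.ba, mul_smul, smul_base (m := 2) (by decide)]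
    have := smul_le_smul_cosetPoset (t 1) (cosetFace_le_cosetFace (h := h) hj2 1)
    rwa [smul_base (i := 3) (by decide)] at this
  · rw [zmodPow_zero, one_smul]
    exact cosetFace_le_cosetFace hj2 1

/-- Moving an edge of the triangle to the base edge leaves two candidates, the base triangle and its
mirror image under `t 2`. The latter contains vertex `4`, which the base triangle does not. -/
theorem VertexLE.triangle_eq {g : G} (hg : VertexLE (g • cosetFace h 3 1) (cosetFace h 3 1)) :
    g • cosetFace h 3 1 = cosetFace h 3 1 := by
  have h1 : g • cosetFace h 2 1 ≤ cosetFace h 3 1 := by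
    refine VertexLE.edge_le ht (Or.inr rfl) fun v hv => hg v (hv.trans ?_)
    exact smul_le_smul_cosetPoset g (cosetFace_le_cosetFace (by decide) 1)
  obtain ⟨k, hk1, hk2⟩ := exists_smul_of_le h1
  simp only [index_smul, index_cosetFace] at hk1 hk2
  have hfix : (k⁻¹ * g) • cosetFace h 2 1 = cosetFace h 2 1 := by
    rw [mul_smul, hk1, inv_smul_smul]
  have hkj : k⁻¹ • cosetFace h 3 1 = cosetFace h 3 1 := by
    rw [inv_smul_eq_iff]
    exact hk2
  suffices h2 : (k⁻¹ * g) • cosetFace h 3 1 = cosetFace h 3 1 by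
    rwa [mul_smul, inv_smul_eq_iff, ← hk2] at h2
  have hle := hg.smul ht k⁻¹
  rw [hkj, smul_smul] at hle
  rw [smul_cosetFace, mul_one, cosetFace_eq_one_iff, faceSubgroup_two] at hfix
  have h3 : (k⁻¹ * g) • cosetFace h 3 1 = cosetFace h 3 1 ∨
      (k⁻¹ * g) • cosetFace h 3 1 = t 2 • cosetFace h 3 1 := by
    rcases mem_closure_pair_commuting ht.cc ht.aa ht.ca hfix with e | e | e | e
    · exact Or.inl (by rw [e, one_smul])
    · exact Or.inl (by rw [e, smul_base (by decide)])
    · exact Or.inr (by rw [e])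
    · exact Or.inr (by rw [e, ht.ca, mul_smul, smul_base (m := 0) (by decide)])
  refine h3.resolve_right fun h3 => ?_
  rw [h3] at hle
  have h4 : vertexFace h (some 4, false) ≤ cosetFace h 3 1 := by
    apply hle
    rw [(actsOnVertices_a ht).le_smul_iff]
    exact (vertexFace_le_triangle_iff ht _).2 ⟨(some 1, false), by decide, rfl⟩
  obtain ⟨v, hv, e⟩ := (vertexFace_le_triangle_iff ht _).1 h4
  have e' := fst_eq_of_vertexFace_eq ht e
  clear e
  revert v
  decide

theorem not_vertexLE_of_index_le_one {i j : Fin 5} (hi : 2 ≤ i) (hj : j ≤ 1) {g : G} :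
    ¬ VertexLE (g • cosetFace h i 1) (cosetFace h j 1) := by
  intro hg
  have h1 := hg.smul ht g⁻¹
  rw [inv_smul_smul] at h1
  have h2 : g⁻¹ • cosetFace h j 1 ≤ g⁻¹ • cosetFace h 1 1 :=
    smul_le_smul_cosetPoset _ (cosetFace_le_cosetFace hj 1)
  obtain ⟨h3, h4⟩ := vertexFace_le_base (h := h) ht hi
  have h5 := eq_of_le_of_index_eq ((h1 _ h3).trans h2) rfl
  have h6 := eq_of_le_of_index_eq ((h1 _ h4).trans h2) rfl
  exact vertexFace_north_ne ht _ _ _ (h5.trans h6.symm)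

theorem not_vertexLE_triangle_edge {g : G} :
    ¬ VertexLE (g • cosetFace h 3 1) (cosetFace h 2 1) := by
  intro hg
  have h1 : g • cosetFace h 2 1 ≤ cosetFace h 2 1 := by
    refine VertexLE.edge_le ht (Or.inl rfl) fun v hv => hg v (hv.trans ?_)
    exact smul_le_smul_cosetPoset g (cosetFace_le_cosetFace (by decide) 1)
  have h2 := eq_of_le_of_index_eq h1 rfl
  have h3 := hg.smul ht g⁻¹
  rw [inv_smul_smul, (inv_smul_eq_iff).2 h2.symm] at h3
  obtain ⟨v, hv, e⟩ := (vertexFace_le_edge_iff ht _).1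
    (h3 _ ((vertexFace_le_triangle_iff ht _).2 ⟨(some 1, false), by decide, rfl⟩))
  have e' := fst_eq_of_vertexFace_eq ht e
  clear e
  revert v
  decide

theorem not_vertexLE_top_triangle : ¬ VertexLE ⊤ (cosetFace h 3 1) := by
  intro hg
  obtain ⟨v, hv, e⟩ := (vertexFace_le_triangle_iff ht _).1 (hg (some 2, false) le_top)
  have e' := fst_eq_of_vertexFace_eq ht e
  clear e
  revert v
  decide

theorem VertexLE.le_base {i j : Fin 5} {g : G}
    (hg : VertexLE (g • cosetFace h i 1) (cosetFace h j 1)) :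
    g • cosetFace h i 1 ≤ cosetFace h j 1 := by
  by_cases hj4 : j = 4
  · have : cosetFace h j 1 = ⊤ := by rw [hj4]; exact (top_eq_cosetFace 1).symm
    rw [this]
    exact le_top
  have hj3 : j ≤ 3 := by clear hg; revert j; decide
  by_cases hi0 : i = 0
  · have : g • cosetFace h i 1 = ⊥ := by rw [hi0, smul_cosetFace]; exact (bot_eq_cosetFace _).symm
    rw [this]
    exact bot_le
  by_cases hi1 : i = 1
  · obtain ⟨v, e⟩ := exists_vertexFace_eq ht (y := g • cosetFace h i 1) hi1
    rw [e] at hg ⊢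
    exact hg v le_rfl
  by_cases hi4 : i = 4
  · have : g • cosetFace h i 1 = ⊤ := by rw [hi4, smul_cosetFace]; exact (top_eq_cosetFace _).symm
    rw [this] at hg
    exact absurd (fun v hv => (hg v hv).trans (cosetFace_le_cosetFace hj3 1))
      (not_vertexLE_top_triangle ht)
  have hi2 : 2 ≤ i := by clear hg; revert i; decide
  have hj2 : j = 2 ∨ j = 3 := by
    have := mt (fun hj1 : j ≤ 1 => not_vertexLE_of_index_le_one ht hi2 hj1 hg) not_false
    clear hg
    revert j; decide
  have hi23 : i = 2 ∨ i = 3 := by clear hg; revert i; decide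
  rcases hi23 with rfl | rfl
  · exact hg.edge_le ht hj2
  · rcases hj2 with rfl | rfl
    · exact absurd hg (not_vertexLE_triangle_edge ht)
    · exact (hg.triangle_eq ht).le

theorem VertexLE.le {y w : CosetPoset h} (hyw : VertexLE y w) : y ≤ w := by
  obtain ⟨g, hy⟩ := exists_eq_cosetFace y
  obtain ⟨k, hw⟩ := exists_eq_cosetFace w
  rw [cosetFace_eq_smul] at hy hw
  have h1 := hyw.smul ht k⁻¹
  rw [hy, hw, inv_smul_smul, smul_smul] at h1
  have h2 := smul_le_smul_cosetPoset k (h1.le_base ht)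
  rwa [mul_smul, smul_inv_smul, ← hw, ← hy] at h2

end

end IcosahedralPoset

end AbstractPolytope

namespace AbstractPolytope

/-! ### Rank three: the icosahedron and the hemi-icosahedron. -/

section IcosahedralPoset

theorem IsIcosahedronTriangle.image_a {F : Finset IcosahedronVertex}
    (hF : IsIcosahedronTriangle F) : IsIcosahedronTriangle (F.image vertexReflectionA) := by
  obtain ⟨i, b, rfl | rfl⟩ := hF <;> revert i b <;> unfold IsIcosahedronTriangle <;> decide

theorem IsIcosahedronTriangle.image_b {F : Finset IcosahedronVertex}
    (hF : IsIcosahedronTriangle F) : IsIcosahedronTriangle (F.image vertexReflectionB) := by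
  obtain ⟨i, b, rfl | rfl⟩ := hF <;> revert i b <;> unfold IsIcosahedronTriangle <;> decide

theorem IsIcosahedronTriangle.image_c {F : Finset IcosahedronVertex}
    (hF : IsIcosahedronTriangle F) : IsIcosahedronTriangle (F.image vertexReflectionC) := by
  obtain ⟨i, b, rfl | rfl⟩ := hF <;> revert i b <;> unfold IsIcosahedronTriangle <;> decide

/-- A property of the sets of vertices that is preserved by the symmetries of the icosahedron
and holds for one triangle holds for all triangles. -/
theorem IsIcosahedronTriangle.induction {p : Finset IcosahedronVertex → Prop}
    (ha : ∀ F, p F → p (F.image vertexReflectionA)) (hb : ∀ F, p F → p (F.image vertexReflectionB))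
    (hc : ∀ F, p F → p (F.image vertexReflectionC)) (hz : ∀ F, p F → p (F.image vertexInversion))
    (h0 : p {(none, false), (some 0, false), (some 1, false)}) {F : Finset IcosahedronVertex}
    (hF : IsIcosahedronTriangle F) : p F := by
  -- Reflection A followed by reflection B is the rotation `i ↦ i + 1` about the poles.
  have h1 : ∀ k : ℕ, p {(none, false), (some (k : ZMod 5), false), (some (k + 1 : ZMod 5), false)} := by
    intro k
    induction k with
    | zero => simpa using h0
    | succ k ih =>
      convert hb _ (ha _ ih) using 1
      push_cast
      generalize (k : ZMod 5) = i
      revert i; decide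
  have h2 : ∀ k : ℕ, p {(some (k : ZMod 5), false), (some (k + 1 : ZMod 5), false),
      (some (k + 3 : ZMod 5), true)} := by
    intro k
    induction k with
    | zero =>
      -- Reflection C carries the triangle of the north pole, `1` and `2` to that of `0`, `1` and
      -- the antipode of `3`, the first triangle of the second family.
      convert hc _ (h1 1) using 1
      decide
    | succ k ih =>
      convert hb _ (ha _ ih) using 1
      push_cast
      generalize (k : ZMod 5) = i
      revert i; decide
  obtain ⟨i, b, hF⟩ := hF
  have h3 := h1 i.val
  have h4 := h2 i.val
  rw [ZMod.natCast_zmod_val] at h3 h4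
  cases b
  · rcases hF with rfl | rfl
    exacts [h3, h4]
  · rcases hF with rfl | rfl
    · convert hz _ h3 using 1
      clear h3 h4
      revert i; decide
    · convert hz _ h4 using 1
      clear h3 h4
      revert i; decide

variable {G : Type*} [Group G] {t : Fin 3 → G} {h : IsStringCGroup t}

/-- The vertices of a face. -/
def HasVertices (y : CosetPoset h) (F : Finset IcosahedronVertex) : Prop :=
  ∀ v, vertexFace h v ≤ y ↔ ∃ w ∈ F, vertexFace h v = vertexFace h w

theorem HasVertices.smul {s : G} {α : IcosahedronVertex → IcosahedronVertex}
    (hs : ActsOnVertices h s α) {y : CosetPoset h} {F : Finset IcosahedronVertex}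
    (hy : HasVertices y F) : HasVertices (s • y) (F.image α) := by
  intro v
  rw [hs.le_smul_iff, hy]
  simp only [Finset.mem_image, exists_exists_and_eq_and, ← hs.smul]
  refine exists_congr fun w => and_congr_right fun _ => ?_
  constructor
  · intro e
    rw [← e, hs.smul_smul]
  · intro e
    rw [e, hs.smul_smul]

section

variable (ht : IcosahedralRelations (t 2) (t 1) (t 0))

include ht

theorem hasVertices_edge : HasVertices (cosetFace h 2 1) {(none, false), (some 0, false)} :=
  vertexFace_le_edge_iff ht

theorem hasVertices_triangle : HasVertices (cosetFace h 3 1)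
    {(none, false), (some 0, false), (some 1, false)} :=
  vertexFace_le_triangle_iff ht

/-- The property is preserved by the symmetries, so one triangle suffices. Its eight subsets come
from the empty set, a vertex, an edge and the triangle itself by applying the reflections B and C.
-/
theorem exists_hasVertices_of_subset {F T : Finset IcosahedronVertex}
    (hT : IsIcosahedronTriangle T) (hF : F ⊆ T) : ∃ y : CosetPoset h, HasVertices y F := by
  have step : ∀ {s α}, ActsOnVertices h s α → ∀ F : Finset IcosahedronVertex,
      (∃ y : CosetPoset h, HasVertices y F) → ∃ y : CosetPoset h, HasVertices y (F.image α) :=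
    fun hs F ⟨y, hy⟩ => ⟨_, hy.smul hs⟩
  have step' : ∀ {s α}, ActsOnVertices h s α → ∀ T : Finset IcosahedronVertex,
      (∀ F ⊆ T, ∃ y : CosetPoset h, HasVertices y F) →
      ∀ F ⊆ T.image α, ∃ y : CosetPoset h, HasVertices y F := by
    intro s α hs T hT F hF
    obtain ⟨F, hFT, rfl⟩ := Finset.subset_image_iff.1 hF
    exact step hs F (hT F hFT)
  refine hT.induction (p := fun T => ∀ F ⊆ T, ∃ y : CosetPoset h, HasVertices y F)
    (step' (actsOnVertices_a ht)) (step' (actsOnVertices_b ht)) (step' (actsOnVertices_c ht))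
    (step' (actsOnVertices_centralElement ht)) ?_ F hF
  have h0 : ∃ y : CosetPoset h, HasVertices y ∅ := by
    refine ⟨⊥, fun v => iff_of_false (fun hv => ?_) (by simp)⟩
    have := index_mono hv
    rw [bot_eq_cosetFace 1] at this
    exact absurd (show (1 : Fin 5) ≤ 0 from this) (by decide)
  have h1 : ∃ y : CosetPoset h, HasVertices y {(none, false)} :=
    ⟨vertexFace h (none, false), fun v => by
      simpa using ⟨fun hv => eq_of_le_of_index_eq hv rfl, fun e => e.le⟩⟩
  have h2 := step (actsOnVertices_c ht) _ h1
  have h3 := step (actsOnVertices_b ht) _ h2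
  have h12 : ∃ y : CosetPoset h, HasVertices y _ := ⟨_, hasVertices_edge ht⟩
  have h13 := step (actsOnVertices_b ht) _ h12
  have h23 := step (actsOnVertices_c ht) _ h13
  have h123 : ∃ y : CosetPoset h, HasVertices y _ := ⟨_, hasVertices_triangle ht⟩
  intro F hF
  rw [← Finset.mem_powerset] at hF
  have hF' : F = ∅ ∨ F = {(none, false)} ∨
      F = Finset.image vertexReflectionC {(none, false)} ∨
      F = Finset.image vertexReflectionB (Finset.image vertexReflectionC {(none, false)}) ∨
      F = {(none, false), (some 0, false)} ∨
      F = Finset.image vertexReflectionB {(none, false), (some 0, false)} ∨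
      F = Finset.image vertexReflectionC
        (Finset.image vertexReflectionB {(none, false), (some 0, false)}) ∨
      F = {(none, false), (some 0, false), (some 1, false)} := by
    revert F
    decide
  rcases hF' with rfl | rfl | rfl | rfl | rfl | rfl | rfl | rfl <;> assumption

theorem exists_hasVertices_smul_triangle (g : G) :
    ∃ T, IsIcosahedronTriangle T ∧ HasVertices (g • cosetFace h 3 1) T := by
  have step : ∀ s ∈ Set.range t, ∀ g : G,
      (∃ T, IsIcosahedronTriangle T ∧ HasVertices (g • cosetFace h 3 1) T) →
      s * s = 1 ∧ ∃ T, IsIcosahedronTriangle T ∧ HasVertices ((s * g) • cosetFace h 3 1) T := by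
    rintro _ ⟨j, rfl⟩ g ⟨T, hT, hg⟩
    refine ⟨h.mul_self j, ?_⟩
    rw [mul_smul]
    fin_cases j
    · exact ⟨_, hT.image_c, hg.smul (actsOnVertices_c ht)⟩
    · exact ⟨_, hT.image_b, hg.smul (actsOnVertices_b ht)⟩
    · exact ⟨_, hT.image_a, hg.smul (actsOnVertices_a ht)⟩
  have hg : g ∈ Subgroup.closure (Set.range t) := by rw [h.generates]; trivial
  induction hg using Subgroup.closure_induction_left with
  | one =>
    rw [one_smul]
    exact ⟨_, ⟨0, false, Or.inl rfl⟩, hasVertices_triangle ht⟩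
  | mul_left s hs g _ ih => exact (step s hs g ih).2
  | inv_mul_cancel s hs g _ ih =>
    obtain ⟨h1, h2⟩ := step s hs g ih
    rwa [inv_eq_of_mul_eq_one_left h1]

open Classical in
/-- The poset of cosets of a string C-group with the relations of the icosahedral group, in terms
of the sets of vertices of the faces. -/
theorem exists_icosahedral_orderIso {X : Type*} [Fintype X] [DecidableEq X]
    {q : IcosahedronVertex → X} (hq : Function.Surjective q)
    (hqv : ∀ v w, q v = q w ↔ vertexFace h v = vertexFace h w) :
    Nonempty (CosetPoset h ≃o {F : Finset X //
      F = Finset.univ ∨ ∃ T, IsIcosahedronTriangle T ∧ F ⊆ T.image q}) := by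
  -- The map `q` merges exactly the labels of equal rank-zero faces, so both cases are treated at
  -- once: `q` is the identity for the icosahedron and `Prod.fst` for the hemi-icosahedron.
  let S : CosetPoset h → Finset X := fun y =>
    (Finset.univ.filter fun v => vertexFace h v ≤ y).image q
  have hS : ∀ y v, q v ∈ S y ↔ vertexFace h v ≤ y := by
    intro y v
    simp only [S, Finset.mem_image, Finset.mem_filter, Finset.mem_univ, true_and, hqv]
    exact ⟨fun ⟨w, hw, e⟩ => e ▸ hw, fun hv => ⟨v, hv, rfl⟩⟩
  have hSF : ∀ {y F}, HasVertices y F → S y = F.image q := by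
    intro y F hy
    ext x
    obtain ⟨v, rfl⟩ := hq x
    simp only [hS, hy v, Finset.mem_image, hqv, eq_comm]
  refine exists_orderIso_subtype S ?_ ?_
  · intro y w
    refine ⟨fun hyw => VertexLE.le ht fun v hv => ?_, fun hyw => Finset.image_mono q ?_⟩
    · rw [← hS] at hv ⊢
      exact hyw hv
    · intro v hv
      simp only [Finset.mem_filter, Finset.mem_univ, true_and] at hv ⊢
      exact hv.trans hyw
  · intro F
    constructor
    · rintro (rfl | ⟨T, hT, hF⟩)
      · refine ⟨⊤, Finset.eq_univ_iff_forall.2 fun x => ?_⟩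
        obtain ⟨v, rfl⟩ := hq x
        rw [hS]
        exact le_top
      · obtain ⟨F, hFT, rfl⟩ := Finset.subset_image_iff.1 hF
        obtain ⟨y, hy⟩ := exists_hasVertices_of_subset (h := h) ht hT hFT
        exact ⟨y, hSF hy⟩
    · rintro ⟨y, rfl⟩
      obtain ⟨g, hy⟩ := exists_eq_cosetFace y
      by_cases h4 : y.index = 4
      · left
        refine Finset.eq_univ_iff_forall.2 fun x => ?_
        obtain ⟨v, rfl⟩ := hq x
        rw [hS, hy, h4, show cosetFace h 4 g = ⊤ from (top_eq_cosetFace g).symm]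
        exact le_top
      · right
        obtain ⟨T, hT, hg⟩ := exists_hasVertices_smul_triangle (h := h) ht g
        refine ⟨T, hT, ?_⟩
        rw [← hSF hg]
        have h3 : y.index ≤ 3 := by
          revert h4
          generalize y.index = i
          revert i; decide
        have hle : y ≤ g • cosetFace h 3 1 := by
          rw [hy, ← cosetFace_eq_smul]
          exact cosetFace_le_cosetFace h3 g
        intro x hx
        obtain ⟨v, rfl⟩ := hq x
        rw [hS] at hx ⊢
        exact hx.trans hle

theorem exists_hemiIcosahedron_orderIso (hz : centralElement (t 2) (t 1) (t 0) = 1) :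
    Nonempty (CosetPoset h ≃o HemiIcosahedron) := by
  refine exists_icosahedral_orderIso ht (fun x => ⟨(x, false), rfl⟩) fun v w => ?_
  refine ⟨fun e => ?_, fst_eq_of_vertexFace_eq ht⟩
  simp only [vertexFace, vertexElement, hz, ite_self, e]

/-- All vertices are equivalent under the group, and the north pole differs from its antipode
because the central element is not in its stabiliser. -/
theorem vertexFace_ne_antipode
    (hz : centralElement (t 2) (t 1) (t 0) ∉ Subgroup.closure {t 1, t 2})
    (v : Option (ZMod 5)) : vertexFace h (v, false) ≠ vertexFace h (v, true) := by
  intro e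
  have h1 : vertexFace h (none, false) = vertexFace h (none, true) := by
    cases v with
    | none => exact e
    | some i =>
      have h1 := congrArg (t 0 • zmodPow (t 1 * t 2) (-i) • ·) e
      simp only [zmodPow_smul_vertexFace ht, (actsOnVertices_c ht).smul, neg_add_cancel] at h1
      exact h1
  have h2 := (actsOnVertices_centralElement ht).smul (h := h) (none, false)
  have h3 : vertexInversion (none, false) = (none, true) := rfl
  rw [h3, ← h1, vertexFace_north, smul_cosetFace, mul_one, cosetFace_eq_one_iff,
    faceSubgroup_one] at h2
  exact hz h2

theorem exists_icosahedron_orderIso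
    (hz : centralElement (t 2) (t 1) (t 0) ∉ Subgroup.closure {t 1, t 2}) :
    Nonempty (CosetPoset h ≃o Icosahedron) := by
  obtain ⟨e⟩ := exists_icosahedral_orderIso (h := h) ht (q := id) Function.surjective_id
    fun v w => by
      refine ⟨fun e => congrArg _ e, fun e => ?_⟩
      have h1 := fst_eq_of_vertexFace_eq ht e
      obtain ⟨v, β⟩ := v
      obtain ⟨w, γ⟩ := w
      obtain rfl : v = w := h1
      cases β <;> cases γ
      · rfl
      · exact absurd e (vertexFace_ne_antipode ht hz v)
      · exact absurd e.symm (vertexFace_ne_antipode ht hz v)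
      · rfl
  have h1 : (fun F : Finset IcosahedronVertex => F = Finset.univ ∨
      ∃ T, IsIcosahedronTriangle T ∧ F ⊆ T.image id) =
      fun F => F = Finset.univ ∨ ∃ T, IsIcosahedronTriangle T ∧ F ⊆ T := by
    funext F
    simp only [Finset.image_id]
  rw [h1] at e
  exact ⟨e⟩

end

end IcosahedralPoset

end AbstractPolytope

namespace AbstractPolytope

/-! ### An inductive criterion for the intersection property. -/

section IntersectionProperty

variable {G : Type*} [Group G] {n : ℕ}

/-- The indices from `a` to `b - 1`. -/
def indexIco (n a b : ℕ) : Set (Fin n) := {m | a ≤ (m : ℕ) ∧ (m : ℕ) < b}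

@[simp] theorem mem_indexIco {a b : ℕ} {m : Fin n} :
    m ∈ indexIco n a b ↔ a ≤ (m : ℕ) ∧ (m : ℕ) < b := Iff.rfl

/-- The intersection property for the generators with indices from `a` to `b - 1`. -/
def IntersectionOn (s : Fin n → G) (a b : ℕ) : Prop :=
  ∀ I J : Set (Fin n), I ⊆ indexIco n a b → J ⊆ indexIco n a b → ∀ g : G,
    g ∈ Subgroup.closure (s '' I) → g ∈ Subgroup.closure (s '' J) →
      g ∈ Subgroup.closure (s '' (I ∩ J))

theorem intersectionOn_succ (s : Fin n → G) (a : ℕ) : IntersectionOn s a (a + 1) := by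
  intro I J hI hJ g hgI hgJ
  by_cases hJ0 : I ⊆ J
  · rwa [Set.inter_eq_self_of_subset_left hJ0]
  · have : J ⊆ I := by
      intro m hm
      by_contra hmI
      refine hJ0 fun l hl => ?_
      have h1 := hI hl
      have h2 := hJ hm
      rw [mem_indexIco] at h1 h2
      have : l = m := Fin.ext (by omega)
      rwa [this]
    rwa [Set.inter_eq_self_of_subset_right this]

/-- The intersection property can be proved by induction on the number of generators. -/
theorem IsString.intersectionOn_step {s : Fin n → G} (hs : IsString s) {a b : ℕ}
    (h1 : IntersectionOn s a b) (h2 : IntersectionOn s (a + 1) (b + 1))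
    (h3 : ∀ g, g ∈ Subgroup.closure (s '' indexIco n a b) →
      g ∈ Subgroup.closure (s '' indexIco n (a + 1) (b + 1)) →
      g ∈ Subgroup.closure (s '' indexIco n (a + 1) b)) :
    IntersectionOn s a (b + 1) := by
  have mono : ∀ {I J : Set (Fin n)}, I ⊆ J → ∀ {g}, g ∈ Subgroup.closure (s '' I) →
      g ∈ Subgroup.closure (s '' J) := fun hIJ _ hg => closure_image_mono s hIJ hg
  -- one set does not contain the last index, the other one does not contain the first
  have mixed : ∀ I J : Set (Fin n), I ⊆ indexIco n a b → J ⊆ indexIco n (a + 1) (b + 1) →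
      ∀ g, g ∈ Subgroup.closure (s '' I) → g ∈ Subgroup.closure (s '' J) →
      g ∈ Subgroup.closure (s '' (I ∩ J)) := by
    intro I J hI hJ g hgI hgJ
    have h4 := h3 g (mono hI hgI) (mono hJ hgJ)
    have h5 := h1 I (indexIco n (a + 1) b) hI (fun m hm => by
      rw [mem_indexIco] at hm ⊢; omega) g hgI h4
    have h6 := h2 J (indexIco n (a + 1) b) hJ (fun m hm => by
      rw [mem_indexIco] at hm ⊢; omega) g hgJ h4
    refine mono ?_ (h1 _ (J ∩ indexIco n (a + 1) b) (Set.inter_subset_left.trans hI)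
      (fun m hm => ?_) g h5 h6)
    · exact fun m hm => ⟨hm.1.1, hm.2.1⟩
    · have := hm.2
      rw [mem_indexIco] at this ⊢
      omega
  have split : ∀ (J : Set (Fin n)) (j : Fin n), j ∉ J → ∀ g ∈ Subgroup.closure (s '' J),
      ∃ u ∈ Subgroup.closure (s '' (J ∩ {m | m < j})),
      ∃ v ∈ Subgroup.closure (s '' (J ∩ {m | j < m})), g = u * v ∧ u * v = v * u := by
    intro J j hj g hg
    refine hs.exists_mul_of_mem_closure (fun m hm => ?_) (fun x hx y hy => ?_) hg
    · rcases lt_trichotomy m j with h4 | h4 | h4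
      · exact Or.inl ⟨hm, h4⟩
      · exact absurd (h4 ▸ hm) hj
      · exact Or.inr ⟨hm, h4⟩
    · have h4 := hx.2
      have h5 := hy.2
      simp only [Set.mem_ofPred_eq, Fin.lt_def] at h4 h5
      omega
  -- one of the sets does not contain both end points
  have half : ∀ I J : Set (Fin n), (I ⊆ indexIco n a b ∨ I ⊆ indexIco n (a + 1) (b + 1)) →
      I ⊆ indexIco n a (b + 1) → J ⊆ indexIco n a (b + 1) →
      ∀ g, g ∈ Subgroup.closure (s '' I) → g ∈ Subgroup.closure (s '' J) →
      g ∈ Subgroup.closure (s '' (I ∩ J)) := by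
    intro I J hI hIab hJ g hgI hgJ
    by_cases hIJ : I ⊆ J
    · rwa [Set.inter_eq_self_of_subset_left hIJ]
    obtain ⟨j, hjI, hjJ⟩ := Set.not_subset.1 hIJ
    have hj := hIab hjI
    rw [mem_indexIco] at hj
    by_cases hJb : J ⊆ indexIco n a b
    · rcases hI with hI | hI
      · exact h1 I J hI hJb g hgI hgJ
      · rw [Set.inter_comm]
        exact mixed J I hJb hI g hgJ hgI
    by_cases hJa : J ⊆ indexIco n (a + 1) (b + 1)
    · rcases hI with hI | hI
      · exact mixed I J hI hJa g hgI hgJ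
      · exact h2 I J hI hJa g hgI hgJ
    have hja : a < j := by
      by_contra h4
      refine hJa fun m hm => ?_
      have h5 := hJ hm
      have h6 : (m : ℕ) ≠ j := fun e => hjJ (Fin.ext e ▸ hm)
      rw [mem_indexIco] at h5 ⊢
      omega
    have hjb : (j : ℕ) < b := by
      by_contra h4
      refine hJb fun m hm => ?_
      have h5 := hJ hm
      have h6 : (m : ℕ) ≠ j := fun e => hjJ (Fin.ext e ▸ hm)
      rw [mem_indexIco] at h5 ⊢
      omega
    -- Here `J` omits an interior index `j`. Of the commuting factors `u` and `v`, the one at the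
    -- end that `I` may miss lies in the shorter interval along with `g` and the other factor;
    -- `mixed` removes its last or first index, and `h1` or `h2` finishes.
    obtain ⟨u, hu, v, hv, rfl, -⟩ := split J j hjJ g hgJ
    have hlt : J ∩ {m | m < j} ⊆ indexIco n a b := fun m hm => by
      have h5 := hJ hm.1
      have h6 := hm.2
      simp only [Set.mem_ofPred_eq, Fin.lt_def] at h6
      rw [mem_indexIco] at h5 ⊢
      omega
    have hgt : J ∩ {m | j < m} ⊆ indexIco n (a + 1) (b + 1) := fun m hm => by
      have h5 := hJ hm.1
      have h6 := hm.2
      simp only [Set.mem_ofPred_eq, Fin.lt_def] at h6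
      rw [mem_indexIco] at h5 ⊢
      omega
    rcases hI with hI | hI
    · have h4 : v ∈ Subgroup.closure (s '' indexIco n a b) := by
        have := mul_mem (inv_mem (mono hlt hu)) (mono hI hgI)
        rwa [inv_mul_cancel_left] at this
      have h5 := mixed _ _ subset_rfl hgt v h4 hv
      refine mono ?_ (h1 I (J ∩ indexIco n a b) hI Set.inter_subset_right _ hgI
        (mul_mem (mono ?_ hu) (mono ?_ h5)))
      · exact fun m hm => ⟨hm.1, hm.2.1⟩
      · exact fun m hm => ⟨hm.1, hlt hm⟩
      · exact fun m hm => ⟨hm.2.1, hm.1⟩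
    · have h4 : u ∈ Subgroup.closure (s '' indexIco n (a + 1) (b + 1)) := by
        have := mul_mem (mono hI hgI) (inv_mem (mono hgt hv))
        rwa [mul_inv_cancel_right] at this
      have h5 := mixed _ _ hlt subset_rfl u hu h4
      refine mono ?_ (h2 I (J ∩ indexIco n (a + 1) (b + 1)) hI Set.inter_subset_right _ hgI
        (mul_mem (mono ?_ h5) (mono ?_ hv)))
      · exact fun m hm => ⟨hm.1, hm.2.1⟩
      · exact fun m hm => ⟨hm.1.1, hm.2⟩
      · exact fun m hm => ⟨hm.1, hgt hm⟩
  -- both sets contain both end points, and each of them omits an index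
  have both : ∀ (I J : Set (Fin n)) (i j : Fin n), I ⊆ indexIco n a (b + 1) →
      J ⊆ indexIco n a (b + 1) → i ∉ I → j ∉ J → i ≤ j → a ≤ (i : ℕ) → (j : ℕ) < b + 1 →
      ∀ g, g ∈ Subgroup.closure (s '' I) → g ∈ Subgroup.closure (s '' J) →
      g ∈ Subgroup.closure (s '' (I ∩ J)) := by
    intro I J i j hI hJ hi hj hij hia hjb g hgI hgJ
    obtain ⟨x, hx, y, hy, rfl, -⟩ := split I i hi g hgI
    obtain ⟨u, hu, v, hv, e, -⟩ := split J j hj _ hgJ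
    rw [Fin.le_def] at hij
    have hIlt : I ∩ {m | m < i} ⊆ indexIco n a j := fun m hm => by
      have h5 := hI hm.1
      have h6 := hm.2
      simp only [Set.mem_ofPred_eq, Fin.lt_def] at h6
      rw [mem_indexIco] at h5 ⊢
      omega
    have hJlt : J ∩ {m | m < j} ⊆ indexIco n a j := fun m hm => by
      have h5 := hJ hm.1
      have h6 := hm.2
      simp only [Set.mem_ofPred_eq, Fin.lt_def] at h6
      rw [mem_indexIco] at h5 ⊢
      omega
    have hIgt : I ∩ {m | i < m} ⊆ indexIco n (i + 1) (b + 1) := fun m hm => by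
      have h5 := hI hm.1
      have h6 := hm.2
      simp only [Set.mem_ofPred_eq, Fin.lt_def] at h6
      rw [mem_indexIco] at h5 ⊢
      omega
    have hJgt : J ∩ {m | j < m} ⊆ indexIco n (i + 1) (b + 1) := fun m hm => by
      have h5 := hJ hm.1
      have h6 := hm.2
      simp only [Set.mem_ofPred_eq, Fin.lt_def] at h6
      rw [mem_indexIco] at h5 ⊢
      omega
    have hab : indexIco n a j ⊆ indexIco n a b := fun m hm => by
      rw [mem_indexIco] at hm ⊢; omega
    have hab' : indexIco n (i + 1) (b + 1) ⊆ indexIco n (a + 1) (b + 1) := fun m hm => by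
      rw [mem_indexIco] at hm ⊢; omega
    -- From `x * y = u * v`: the left side uses only indices below `j`, the right side only indices
    -- above `i`, so the common value lies over the open interval between `i` and `j`.
    have e1 : u⁻¹ * x = v * y⁻¹ := by
      rw [inv_mul_eq_iff_eq_mul, ← mul_assoc, eq_mul_inv_iff_mul_eq]
      exact e
    have h4 : u⁻¹ * x ∈ Subgroup.closure (s '' indexIco n (i + 1) j) := by
      refine mono ?_ (mixed _ _ hab hab' _ (mul_mem (inv_mem (mono hJlt hu)) (mono hIlt hx))
        (e1 ▸ mul_mem (mono hJgt hv) (inv_mem (mono hIgt hy))))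
      intro m hm
      have h5 := hm.1
      have h6 := hm.2
      rw [mem_indexIco] at h5 h6 ⊢
      omega
    have h5 : u ∈ Subgroup.closure (s '' ((I ∩ {m | m < i}) ∪ indexIco n (i + 1) j)) := by
      have := mul_mem (mono (Set.subset_union_left (t := indexIco n (i + 1) j)) hx)
        (inv_mem (mono (Set.subset_union_right (s := I ∩ {m | m < i})) h4))
      simpa using this
    have hun : (I ∩ {m | m < i}) ∪ indexIco n (i + 1) j ⊆ indexIco n a b := by
      refine Set.union_subset (hIlt.trans hab) fun m hm => ?_
      rw [mem_indexIco] at hm ⊢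
      omega
    have h6 := h1 _ _ hun (hJlt.trans hab) u h5 hu
    obtain ⟨x', hx', w, hw, e2, -⟩ := split _ i (by
      rintro ⟨h7 | h7, -⟩
      · exact hi h7.1
      · rw [mem_indexIco] at h7
        omega) u h6
    have hx'' : x' ∈ Subgroup.closure (s '' (I ∩ J)) := by
      refine mono ?_ hx'
      rintro m ⟨⟨h7 | h7, h8⟩, h9⟩
      · exact ⟨h7.1, h8.1⟩
      · rw [mem_indexIco] at h7
        simp only [Set.mem_ofPred_eq, Fin.lt_def] at h9
        omega
    have hw' : w ∈ Subgroup.closure (s '' indexIco n (i + 1) j) := by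
      refine mono ?_ hw
      rintro m ⟨⟨h7 | h7, h8⟩, h9⟩
      · exact absurd (show i < m from h9) (not_lt_of_gt (show m < i from h7.2))
      · exact h7
    have hx3 : x' ∈ Subgroup.closure (s '' (I ∩ {m | m < i})) := by
      refine mono ?_ hx'
      rintro m ⟨⟨h7 | h7, h8⟩, h9⟩
      · exact h7
      · rw [mem_indexIco] at h7
        simp only [Set.mem_ofPred_eq, Fin.lt_def] at h9
        omega
    -- This element lies over indices below `i` and also over indices strictly between `i` and `j`.
    -- Hence it is trivial and `x = x'` lies over `I ∩ J`; the remaining factor `y` omits the first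
    -- index and is handled by `half`.
    have e3 : x'⁻¹ * x = 1 := by
      have h7 : x'⁻¹ * x = w * (u⁻¹ * x) := by
        rw [e2]
        group
      have h8 := h1 _ (indexIco n (i + 1) j) (hIlt.trans hab) (fun m hm => by
        rw [mem_indexIco] at hm ⊢; omega) _ (mul_mem (inv_mem hx3) hx)
        (h7 ▸ mul_mem hw' h4)
      have h9 : I ∩ {m | m < i} ∩ indexIco n (i + 1) j = ∅ := by
        ext m
        simp only [Set.mem_inter_iff, Set.mem_ofPred_eq, Fin.lt_def, mem_indexIco,
          Set.mem_empty_iff_false, iff_false]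
        omega
      rwa [h9, Set.image_empty, Subgroup.closure_empty, Subgroup.mem_bot] at h8
    obtain rfl : x' = x := inv_mul_eq_one.1 e3
    refine mul_mem hx'' (mono (J := I ∩ J) ?_ (half (I ∩ {m | i < m}) J (Or.inr ?_) ?_ hJ y hy ?_))
    · exact fun m hm => ⟨hm.1.1, hm.2⟩
    · exact hIgt.trans hab'
    · exact Set.inter_subset_left.trans hI
    · have := mul_mem (inv_mem (mono Set.inter_subset_right hx'')) hgJ
      rwa [inv_mul_cancel_left] at this
  intro I J hI hJ g hgI hgJ
  by_cases hIJ : I ⊆ J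
  · rwa [Set.inter_eq_self_of_subset_left hIJ]
  by_cases hJI : J ⊆ I
  · rwa [Set.inter_eq_self_of_subset_right hJI]
  obtain ⟨j, hjI, hjJ⟩ := Set.not_subset.1 hIJ
  obtain ⟨i, hiJ, hiI⟩ := Set.not_subset.1 hJI
  have hi := hJ hiJ
  have hj := hI hjI
  rw [mem_indexIco] at hi hj
  rcases le_total i j with hij | hij
  · exact both I J i j hI hJ hiI hjJ hij hi.1 hj.2 g hgI hgJ
  · rw [Set.inter_comm]
    exact both J I j i hJ hI hjJ hiI hij hj.1 hi.2 g hgJ hgI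

end IntersectionProperty

end AbstractPolytope

/-! ### The matrix representation of `W`. -/

namespace AbstractPolytope

/-! A representation of `W` of degree 7 over the field with 11 elements. Its image is the first
Janko group. -/

namespace Janko

def gen0 : Matrix (Fin 7) (Fin 7) (ZMod 11) :=
  !![10, 0, 0, 8, 0, 8, 0;
    0, 10, 0, 3, 0, 0, 4;
    0, 0, 10, 0, 0, 3, 0;
    0, 0, 0, 1, 0, 0, 0;
    0, 0, 0, 0, 10, 0, 7;
    0, 0, 0, 0, 0, 1, 0;
    0, 0, 0, 0, 0, 0, 1]

def gen1 : Matrix (Fin 7) (Fin 7) (ZMod 11) :=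
  !![10, 0, 0, 0, 0, 0, 0;
    0, 0, 0, 1, 0, 0, 0;
    0, 0, 0, 0, 0, 1, 0;
    0, 1, 0, 0, 0, 0, 0;
    0, 0, 0, 0, 0, 0, 1;
    0, 0, 1, 0, 0, 0, 0;
    0, 0, 0, 0, 1, 0, 0]

def gen2 : Matrix (Fin 7) (Fin 7) (ZMod 11) :=
  !![0, 1, 0, 0, 0, 6, 5;
    1, 0, 0, 0, 0, 8, 2;
    0, 0, 0, 0, 1, 2, 5;
    0, 0, 0, 10, 0, 2, 8;
    0, 0, 1, 0, 0, 6, 10;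
    0, 0, 0, 0, 0, 5, 2;
    0, 0, 0, 0, 0, 10, 6]

def gen3 : Matrix (Fin 7) (Fin 7) (ZMod 11) :=
  !![1, 0, 0, 0, 10, 0, 1;
    0, 0, 1, 0, 10, 0, 0;
    0, 1, 0, 0, 10, 0, 0;
    0, 0, 0, 0, 0, 1, 10;
    0, 0, 0, 0, 10, 0, 0;
    0, 0, 0, 1, 0, 0, 10;
    0, 0, 0, 0, 0, 0, 10]

/-- Intermediate products are recorded as explicit matrices, so that each relator is checked by a
few multiplications of literals. -/
def prod01 : Matrix (Fin 7) (Fin 7) (ZMod 11) :=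
  !![1, 8, 8, 0, 0, 0, 0;
    0, 3, 0, 10, 4, 0, 0;
    0, 0, 3, 0, 0, 10, 0;
    0, 1, 0, 0, 0, 0, 0;
    0, 0, 0, 0, 7, 0, 10;
    0, 0, 1, 0, 0, 0, 0;
    0, 0, 0, 0, 1, 0, 0]

def prod01Sq : Matrix (Fin 7) (Fin 7) (ZMod 11) :=
  !![1, 10, 10, 3, 10, 3, 0;
    0, 8, 0, 8, 7, 0, 7;
    0, 0, 8, 0, 0, 8, 0;
    0, 3, 0, 10, 4, 0, 0;
    0, 0, 0, 0, 4, 0, 4;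
    0, 0, 3, 0, 0, 10, 0;
    0, 0, 0, 0, 7, 0, 10]

def prod12 : Matrix (Fin 7) (Fin 7) (ZMod 11) :=
  !![0, 10, 0, 0, 0, 5, 6;
    0, 0, 0, 10, 0, 2, 8;
    0, 0, 0, 0, 0, 5, 2;
    1, 0, 0, 0, 0, 8, 2;
    0, 0, 0, 0, 0, 10, 6;
    0, 0, 0, 0, 1, 2, 5;
    0, 0, 1, 0, 0, 6, 10]

def prod23 : Matrix (Fin 7) (Fin 7) (ZMod 11) :=
  !![0, 0, 1, 6, 10, 0, 0;
    1, 0, 0, 8, 10, 0, 2;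
    0, 0, 0, 2, 10, 0, 4;
    0, 0, 0, 2, 0, 10, 2;
    0, 1, 0, 6, 10, 0, 6;
    0, 0, 0, 5, 0, 0, 4;
    0, 0, 0, 10, 0, 0, 6]

def prod23Sq : Matrix (Fin 7) (Fin 7) (ZMod 11) :=
  !![0, 10, 0, 8, 0, 5, 10;
    0, 10, 1, 3, 0, 3, 0;
    0, 10, 0, 5, 1, 9, 0;
    0, 0, 0, 8, 0, 9, 1;
    1, 10, 0, 8, 0, 5, 0;
    0, 0, 0, 6, 0, 6, 1;
    0, 0, 0, 3, 0, 1, 1]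

def prod123 : Matrix (Fin 7) (Fin 7) (ZMod 11) :=
  !![0, 0, 10, 5, 1, 0, 0;
    0, 0, 0, 2, 0, 10, 2;
    0, 0, 0, 5, 0, 0, 4;
    1, 0, 0, 8, 10, 0, 2;
    0, 0, 0, 10, 0, 0, 6;
    0, 0, 0, 2, 10, 0, 4;
    0, 1, 0, 6, 10, 0, 6]

def prod123Sq : Matrix (Fin 7) (Fin 7) (ZMod 11) :=
  !![5, 0, 0, 1, 6, 0, 1;
    2, 2, 0, 4, 8, 0, 1;
    5, 4, 0, 9, 2, 0, 1;
    8, 2, 10, 5, 2, 0, 0;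
    10, 6, 0, 6, 6, 0, 1;
    2, 4, 0, 8, 5, 0, 0;
    6, 6, 0, 10, 10, 10, 0]

def prod012 : Matrix (Fin 7) (Fin 7) (ZMod 11) :=
  !![8, 1, 0, 0, 8, 9, 6;
    3, 0, 4, 1, 0, 2, 5;
    0, 0, 0, 0, 3, 1, 2;
    1, 0, 0, 0, 0, 8, 2;
    0, 0, 7, 0, 0, 10, 9;
    0, 0, 0, 0, 1, 2, 5;
    0, 0, 1, 0, 0, 6, 10]

def prod012Sq : Matrix (Fin 7) (Fin 7) (ZMod 11) :=
  !![1, 8, 0, 1, 7, 10, 10;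
    3, 3, 5, 0, 5, 7, 0;
    0, 0, 1, 0, 1, 0, 8;
    8, 1, 2, 0, 5, 4, 0;
    0, 0, 9, 0, 9, 4, 0;
    0, 0, 1, 0, 2, 0, 3;
    0, 0, 10, 0, 9, 7, 0]

/-- The image of `(s₀ s₁ s₂)⁵`, the central element of the facet group. -/
def center012 : Matrix (Fin 7) (Fin 7) (ZMod 11) :=
  !![1, 0, 9, 0, 10, 2, 1;
    0, 1, 10, 0, 9, 0, 0;
    0, 0, 10, 0, 0, 0, 0;
    0, 0, 0, 1, 0, 10, 9;
    0, 0, 0, 0, 10, 0, 0;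
    0, 0, 0, 0, 0, 10, 0;
    0, 0, 0, 0, 0, 0, 10]

theorem gen0_mul_self : gen0 * gen0 = 1 := by decide +kernel

theorem gen1_mul_self : gen1 * gen1 = 1 := by decide +kernel

theorem gen2_mul_self : gen2 * gen2 = 1 := by decide +kernel

theorem gen3_mul_self : gen3 * gen3 = 1 := by decide +kernel

theorem gen0_mul_gen2 : gen0 * gen2 = gen2 * gen0 := by decide +kernel

theorem gen1_mul_gen3 : gen1 * gen3 = gen3 * gen1 := by decide +kernel

theorem gen0_mul_gen3 : gen0 * gen3 = gen3 * gen0 := by decide +kernel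

theorem gen0_mul_gen1 : gen0 * gen1 = prod01 := by decide +kernel

theorem prod01_mul_self : prod01 * prod01 = prod01Sq := by decide +kernel

theorem prod01Sq_mul : prod01Sq * prod01Sq * prod01 = 1 := by decide +kernel

theorem gen1_mul_gen2 : gen1 * gen2 = prod12 := by decide +kernel

theorem prod12_mul : prod12 * prod12 * prod12 = 1 := by decide +kernel

theorem gen2_mul_gen3 : gen2 * gen3 = prod23 := by decide +kernel

theorem prod23_mul_self : prod23 * prod23 = prod23Sq := by decide +kernel

theorem prod23Sq_mul : prod23Sq * prod23Sq * prod23 = 1 := by decide +kernel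

theorem prod12_mul_gen3 : prod12 * gen3 = prod123 := by decide +kernel

theorem prod123_mul_self : prod123 * prod123 = prod123Sq := by decide +kernel

theorem prod123Sq_mul : prod123Sq * prod123Sq * prod123 = 1 := by decide +kernel

theorem prod01_mul_gen2 : prod01 * gen2 = prod012 := by decide +kernel

theorem prod012_mul_self : prod012 * prod012 = prod012Sq := by decide +kernel

theorem prod012Sq_mul : prod012Sq * prod012Sq * prod012 = center012 := by decide +kernel

theorem gen3_mul_center012_ne : gen3 * center012 ≠ center012 * gen3 := by decide +kernel

theorem gen_ne_one : gen0 ≠ 1 ∧ gen1 ≠ 1 ∧ gen2 ≠ 1 ∧ gen3 ≠ 1 := by decide +kernel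

theorem gen_ne_gen : gen0 ≠ gen1 ∧ gen1 ≠ gen2 ∧ gen2 ≠ gen3 := by decide +kernel

theorem pow_five {M : Type*} [Monoid M] (x : M) : x ^ 5 = x * x * (x * x) * x := by
  simp only [pow_succ, pow_zero, one_mul, mul_assoc]

/-- The images of the generators. -/
def gen : Fin 4 → (Matrix (Fin 7) (Fin 7) (ZMod 11))ˣ :=
  ![⟨gen0, gen0, gen0_mul_self, gen0_mul_self⟩, ⟨gen1, gen1, gen1_mul_self, gen1_mul_self⟩,
    ⟨gen2, gen2, gen2_mul_self, gen2_mul_self⟩, ⟨gen3, gen3, gen3_mul_self, gen3_mul_self⟩]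

theorem val_gen :
    (gen 0 : Matrix (Fin 7) (Fin 7) (ZMod 11)) = gen0 ∧
    (gen 1 : Matrix (Fin 7) (Fin 7) (ZMod 11)) = gen1 ∧
    (gen 2 : Matrix (Fin 7) (Fin 7) (ZMod 11)) = gen2 ∧
    (gen 3 : Matrix (Fin 7) (Fin 7) (ZMod 11)) = gen3 :=
  ⟨rfl, rfl, rfl, rfl⟩

theorem lift_gen_eq_one : ∀ r ∈ relatorsW, FreeGroup.lift gen r = 1 := by
  obtain ⟨e0, e1, e2, e3⟩ := val_gen
  intro r hr
  simp only [relatorsW, Set.mem_insert_iff, Set.mem_singleton_iff] at hr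
  rcases hr with rfl | rfl | rfl | rfl | rfl | rfl | rfl | rfl | rfl | rfl | rfl <;>
    simp only [map_pow, map_mul, map_inv, FreeGroup.lift_apply_of, mul_inv_eq_one] <;>
    apply Units.ext <;>
    simp only [Units.val_pow_eq_pow_val, Units.val_mul, Units.val_one, e0, e1, e2, e3, sq,
      gen0_mul_self, gen1_mul_self, gen2_mul_self, gen3_mul_self, gen0_mul_gen2, gen1_mul_gen3,
      gen0_mul_gen3, gen0_mul_gen1, gen1_mul_gen2, gen2_mul_gen3, prod12_mul_gen3]
  · rw [pow_five, prod01_mul_self, prod01Sq_mul]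
  · rw [pow_succ, sq, prod12_mul]
  · rw [pow_five, prod23_mul_self, prod23Sq_mul]
  · rw [pow_five, prod123_mul_self, prod123Sq_mul]

/-- The representation. -/
def rep : W →* (Matrix (Fin 7) (Fin 7) (ZMod 11))ˣ := PresentedGroup.toGroup lift_gen_eq_one

@[simp] theorem rep_sW (i : Fin 4) : rep (sW i) = gen i :=
  PresentedGroup.toGroup.of lift_gen_eq_one

end Janko

/-! ### Relations and inequalities in `W`. -/

section Relations

theorem sW_mul_self (i : Fin 4) : sW i * sW i = 1 := by
  have h1 : (FreeGroup.of i) ^ 2 ∈ relatorsW := by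
    fin_cases i <;> simp [relatorsW]
  have h2 := PresentedGroup.one_of_mem h1
  rwa [map_pow, sq] at h2

theorem sW_pow_five : (sW 0 * sW 1) ^ 5 = 1 :=
  PresentedGroup.one_of_mem (rels := relatorsW)
    (x := (FreeGroup.of 0 * FreeGroup.of 1) ^ 5) (by simp [relatorsW])

theorem sW_pow_three : (sW 1 * sW 2) ^ 3 = 1 :=
  PresentedGroup.one_of_mem (rels := relatorsW)
    (x := (FreeGroup.of 1 * FreeGroup.of 2) ^ 3) (by simp [relatorsW])

theorem sW_pow_five' : (sW 2 * sW 3) ^ 5 = 1 :=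
  PresentedGroup.one_of_mem (rels := relatorsW)
    (x := (FreeGroup.of 2 * FreeGroup.of 3) ^ 5) (by simp [relatorsW])

theorem sW_extra : (sW 1 * sW 2 * sW 3) ^ 5 = 1 :=
  PresentedGroup.one_of_mem (rels := relatorsW)
    (x := (FreeGroup.of 1 * FreeGroup.of 2 * FreeGroup.of 3) ^ 5) (by simp [relatorsW])

theorem sW_ne_one (i : Fin 4) : sW i ≠ 1 := by
  intro e
  have h1 := congrArg (fun x => (Janko.rep x : Matrix (Fin 7) (Fin 7) (ZMod 11))) e
  simp only [Janko.rep_sW, map_one, Units.val_one] at h1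
  obtain ⟨h2, h3, h4, h5⟩ := Janko.gen_ne_one
  fin_cases i
  exacts [h2 h1, h3 h1, h4 h1, h5 h1]

theorem sW_ne_sW : sW 0 ≠ sW 1 ∧ sW 1 ≠ sW 2 ∧ sW 2 ≠ sW 3 := by
  have h1 : ∀ {i j}, (Janko.gen i : Matrix (Fin 7) (Fin 7) (ZMod 11)) ≠ Janko.gen j →
      sW i ≠ sW j := by
    intro i j hij e
    have h1 := congrArg (fun x => (Janko.rep x : Matrix (Fin 7) (Fin 7) (ZMod 11))) e
    simp only [Janko.rep_sW] at h1
    exact hij h1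
  obtain ⟨h2, h3, h4⟩ := Janko.gen_ne_gen
  exact ⟨h1 h2, h1 h3, h1 h4⟩

/-- The main information taken from the matrices. It shows both that the facets do not collapse to
hemi-dodecahedra and that `s₃` is not in the facet group. -/
theorem sW_mul_centralElement_ne : sW 3 * centralElement (sW 0) (sW 1) (sW 2) ≠
    centralElement (sW 0) (sW 1) (sW 2) * sW 3 := by
  intro e
  have h1 := congrArg (fun x => (Janko.rep x : Matrix (Fin 7) (Fin 7) (ZMod 11))) e
  obtain ⟨e0, e1, e2, e3⟩ := Janko.val_gen
  simp only [centralElement, map_mul, Janko.rep_sW, Units.val_mul,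
    e0, e1, e2, e3, Janko.gen0_mul_gen1, Janko.prod01_mul_gen2,
    Janko.pow_five, Janko.prod012_mul_self, Janko.prod012Sq_mul] at h1
  exact Janko.gen3_mul_center012_ne h1

theorem mul_mul_eq_of_pow_three {G : Type*} [Group G] {x y : G} (hx : x * x = 1) (hy : y * y = 1)
    (hxy : (x * y) ^ 3 = 1) : x * y * x = y * x * y := by
  have h1 : x * y * x * (y * x * y) = 1 := by
    rw [← hxy]
    simp only [pow_succ, pow_zero, one_mul, mul_assoc]
  rw [mul_eq_one_iff_eq_inv] at h1
  rw [h1, mul_inv_rev, mul_inv_rev, inv_eq_of_mul_eq_one_left hx, inv_eq_of_mul_eq_one_left hy,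
    mul_assoc]

theorem mul_pow_eq_one_comm {G : Type*} [Group G] {x y : G} (hx : x * x = 1) (hy : y * y = 1)
    {k : ℕ} (hxy : (x * y) ^ k = 1) : (y * x) ^ k = 1 := by
  have h1 : y * x = (x * y)⁻¹ := by
    rw [mul_inv_rev, inv_eq_of_mul_eq_one_left hx, inv_eq_of_mul_eq_one_left hy]
  rw [h1, inv_pow, hxy, inv_one]

/-- In the relations, `b * a` has fifth power one and `c * b` has order three in the Coxeter group,
so `a` is the outer generator next to the mark 5: `s₀` for facets and `s₃` for vertex figures. -/
theorem icosahedralRelations_facet : IcosahedralRelations (sW 0) (sW 1) (sW 2) where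
  aa := sW_mul_self 0
  bb := sW_mul_self 1
  cc := sW_mul_self 2
  ba := mul_pow_eq_one_comm (sW_mul_self 0) (sW_mul_self 1) sW_pow_five
  cbc := (mul_mul_eq_of_pow_three (sW_mul_self 1) (sW_mul_self 2) sW_pow_three).symm
  ca := (sW_isString 0 2 (by decide)).symm

theorem icosahedralRelations_vertexFigure : IcosahedralRelations (sW 3) (sW 2) (sW 1) where
  aa := sW_mul_self 3
  bb := sW_mul_self 2
  cc := sW_mul_self 1
  ba := sW_pow_five'
  cbc := mul_mul_eq_of_pow_three (sW_mul_self 1) (sW_mul_self 2) sW_pow_three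
  ca := sW_isString 1 3 (by decide)

/-- The extra relation read backwards, since `s₃ s₂ s₁` is the inverse of `s₁ s₂ s₃`. -/
theorem centralElement_vertexFigure : centralElement (sW 3) (sW 2) (sW 1) = 1 := by
  have h1 : sW 3 * sW 2 * sW 1 = (sW 1 * sW 2 * sW 3)⁻¹ := by
    simp only [mul_inv_rev, inv_eq_of_mul_eq_one_left (sW_mul_self _), mul_assoc]
  rw [centralElement, h1, inv_pow, sW_extra, inv_one]

end Relations

end AbstractPolytope

namespace AbstractPolytope

/-! ### Intersections of subgroups generated by some of the generators. -/

section ParabolicSubgroups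

variable {G : Type*} [Group G]

/-- Every element of the dihedral group `⟨x, y⟩` has tenth power one, which together with `(y * c) ^
3 = 1` would force `y * c = 1`. -/
theorem notMem_closure_pair {x y c : G} (hx : x * x = 1) (hy : y * y = 1)
    (hxy : (x * y) ^ 5 = 1) (hyc : (y * c) ^ 3 = 1) (hne : c ≠ y) :
    c ∉ Subgroup.closure {x, y} := by
  intro hmem
  have h1 : y * c ∈ Subgroup.closure {x, y} :=
    mul_mem (Subgroup.subset_closure (by simp)) hmem
  have h2 : (y * c) ^ 10 = 1 := by
    obtain ⟨i, e | e⟩ := exists_eq_zmodPow_of_mem_closure (p := 5) hx hy hxy h1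
    · rw [e, zmodPow, ← pow_mul, show i.val * 10 = 5 * (i.val * 2) by ring, pow_mul, hxy, one_pow]
    · have h3 : (y * c) ^ 2 = 1 := by
        rw [e, sq, mul_assoc, ← mul_assoc y, mul_zmodPow_of_involution hx hy hxy, mul_assoc, hy,
          mul_one, ← zmodPow_add hxy, add_neg_cancel, zmodPow_zero]
      rw [show 10 = 2 * 5 from rfl, pow_mul, h3, one_pow]
  have h3 : y * c = 1 := by
    rw [show 10 = 3 * 3 + 1 from rfl, pow_succ, pow_mul, hyc, one_pow, one_mul] at h2
    exact h2
  exact hne ((eq_inv_of_mul_eq_one_right h3).trans (inv_eq_of_mul_eq_one_left hy))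

/-- A reflection generates a maximal subgroup of the dihedral group of order 6: any nontrivial
rotation in `K` would generate `c * y` and hence put `c` in `K`. -/
theorem mem_closure_singleton_of_mem {K : Subgroup G} {c y : G} (hcc : c * c = 1)
    (hyy : y * y = 1) (hcy : (c * y) ^ 3 = 1) (hy : y ∈ K) (hc : c ∉ K) {g : G}
    (hg : g ∈ Subgroup.closure {c, y}) (hgK : g ∈ K) : g ∈ Subgroup.closure {y} := by
  obtain ⟨i, hi⟩ := exists_eq_zmodPow_of_mem_closure (p := 3) hcc hyy hcy hg
  have h1 : zmodPow (c * y) i ∈ K := by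
    rcases hi with rfl | rfl
    · exact hgK
    · exact (K.mul_mem_cancel_right hy).1 hgK
  have h2 : i = 0 := by
    by_contra hi0
    have h2 : c * y ∈ K := by
      -- A nonzero residue modulo 3 is its own inverse, so raising the rotation to the power `i`
      -- recovers `c * y`.
      have h3 : i.val * i.val = 3 * (i.val * i.val / 3) + 1 := by
        clear hi h1
        decide +revert
      have h4 := pow_mem h1 i.val
      rwa [zmodPow, ← pow_mul, h3, pow_succ, pow_mul, hcy, one_pow, one_mul] at h4
    exact hc ((K.mul_mem_cancel_right hy).1 h2)
  rcases hi with rfl | rfl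
  · rw [h2, zmodPow_zero]; exact one_mem _
  · rw [h2, zmodPow_zero, one_mul]; exact Subgroup.subset_closure rfl

namespace IcosahedralRelations

variable {a b c : G} (h : IcosahedralRelations a b c)

include h

/-- When the 15-letter central word is trivial, a word of 6 letters equals one of 9 letters. -/
theorem mul_edge_eq (hz : centralElement a b c = 1) (x : G) :
    a * (b * (c * (a * (b * (a * x))))) = b * (c * (b * (a * (b * (a * (b * (c * (b * x)))))))) := by
  have h1 := h.centralElement_mul (b * (c * (b * (a * (b * (a * (b * (c * (b * x)))))))))
  rw [hz, one_mul] at h1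
  rw [h1]
  simp only [h.aa', h.bb', h.cc', h.ca', h.babab', h.cbac', h.cbabcb']

/-- Representatives of the left cosets of the subgroup generated by `b` and `c`. -/
theorem exists_eq_representative_mul (hz : centralElement a b c = 1) {g : G}
    (hg : g ∈ Subgroup.closure {a, b, c}) :
    ∃ w ∈ [1, a, b * a, c * b * a, a * b * a, c * a * b * a, b * a * b * a, c * b * a * b * a,
      b * c * a * b * a, b * c * b * a * b * a], ∃ m ∈ Subgroup.closure {b, c}, g = w * m := by
  set M := Subgroup.closure {b, c} with hM
  have hb : b ∈ M := Subgroup.subset_closure (by simp)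
  have hc : c ∈ M := Subgroup.subset_closure (by simp)
  set L : List G := [1, a, b * a, c * b * a, a * b * a, c * a * b * a, b * a * b * a,
    c * b * a * b * a, b * c * a * b * a, b * c * b * a * b * a] with hL
  have step : ∀ z ∈ ({a, b, c} : Set G), ∀ g : G, (∃ w ∈ L, ∃ m ∈ M, g = w * m) →
      ∃ w ∈ L, ∃ m ∈ M, z * g = w * m := by
    -- One entry of the multiplication table: `z * w = w' * d` with `w'` a representative and `d` in
    -- `⟨b, c⟩`. The ten representatives correspond to the ten triangles of the hemi-icosahedron.
    have rule : ∀ w' d : G, w' ∈ L → d ∈ M → ∀ {z w}, (∀ x, z * (w * x) = w' * (d * x)) →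
        ∀ m ∈ M, ∃ v ∈ L, ∃ k ∈ M, z * (w * m) = v * k :=
      fun w' d hw' hd z w e m hm => ⟨w', hw', d * m, mul_mem hd hm, e m⟩
    have one := one_mem M
    have hbcb : b * c * b ∈ M := mul_mem (mul_mem hb hc) hb
    -- The only two entries of the table that use `hz`: `a` exchanges the cosets of the last two
    -- representatives. The word has `a * c` in place of `c * a` because `simp` moves `a` to the
    -- left.
    have edge : ∀ x, a * (b * (a * (c * (b * (a * x))))) =
        b * (c * (b * (a * (b * (a * (b * (c * (b * x)))))))) := fun x => by
      rw [← h.ca', h.mul_edge_eq hz]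
    have edge' : ∀ x, a * (b * (c * (b * (a * (b * (a * x)))))) =
        b * (c * (a * (b * (a * (b * (c * (b * x))))))) := by
      intro x
      have h1 := congrArg (a * ·) (h.mul_edge_eq hz (b * (c * (b * x))))
      simpa only [h.aa', h.bb', h.cc'] using h1.symm
    rintro z hz' g ⟨w, hw, m, hm, rfl⟩
    simp only [hL, List.mem_cons, List.not_mem_nil, or_false] at hw
    refine (?_ : ∀ m ∈ M, ∃ v ∈ L, ∃ k ∈ M, z * (w * m) = v * k) m hm
    rcases hz' with e | e | e <;> rw [show z = _ from e]
    · rcases hw with hw | hw | hw | hw | hw | hw | hw | hw | hw | hw <;> rw [hw]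
      map_tacs [refine rule a 1 (by simp [hL]) one ?_;
        refine rule 1 1 (by simp [hL]) one ?_;
        refine rule (a * b * a) 1 (by simp [hL]) one ?_;
        refine rule (c * a * b * a) 1 (by simp [hL]) one ?_;
        refine rule (b * a) 1 (by simp [hL]) one ?_;
        refine rule (c * b * a) 1 (by simp [hL]) one ?_;
        refine rule (b * a * b * a) b (by simp [hL]) hb ?_;
        refine rule (c * b * a * b * a) b (by simp [hL]) hb ?_;
        refine rule (b * c * b * a * b * a) (b * c * b) (by simp [hL]) hbcb ?_;
        refine rule (b * c * a * b * a) (b * c * b) (by simp [hL]) hbcb ?_]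
      all_goals simp only [mul_assoc, one_mul, h.aa', h.ca', h.babab', edge, edge', implies_true]
    · rcases hw with hw | hw | hw | hw | hw | hw | hw | hw | hw | hw <;> rw [hw]
      map_tacs [refine rule 1 b (by simp [hL]) hb ?_;
        refine rule (b * a) 1 (by simp [hL]) one ?_;
        refine rule a 1 (by simp [hL]) one ?_;
        refine rule (c * b * a) c (by simp [hL]) hc ?_;
        refine rule (b * a * b * a) 1 (by simp [hL]) one ?_;
        refine rule (b * c * a * b * a) 1 (by simp [hL]) one ?_;
        refine rule (a * b * a) 1 (by simp [hL]) one ?_;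
        refine rule (b * c * b * a * b * a) 1 (by simp [hL]) one ?_;
        refine rule (c * a * b * a) 1 (by simp [hL]) one ?_;
        refine rule (c * b * a * b * a) 1 (by simp [hL]) one ?_]
      all_goals simp only [mul_assoc, one_mul, h.bb', h.cbac', implies_true]
    · rcases hw with hw | hw | hw | hw | hw | hw | hw | hw | hw | hw <;> rw [hw]
      map_tacs [refine rule 1 c (by simp [hL]) hc ?_;
        refine rule a c (by simp [hL]) hc ?_;
        refine rule (c * b * a) 1 (by simp [hL]) one ?_;
        refine rule (b * a) 1 (by simp [hL]) one ?_;
        refine rule (c * a * b * a) 1 (by simp [hL]) one ?_;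
        refine rule (a * b * a) 1 (by simp [hL]) one ?_;
        refine rule (c * b * a * b * a) 1 (by simp [hL]) one ?_;
        refine rule (b * a * b * a) 1 (by simp [hL]) one ?_;
        refine rule (b * c * b * a * b * a) 1 (by simp [hL]) one ?_;
        refine rule (b * c * a * b * a) 1 (by simp [hL]) one ?_]
      all_goals simp only [mul_assoc, one_mul, h.bb', h.cc', h.ca', h.cbc', h.cbac',
        implies_true]
  induction hg using Subgroup.closure_induction_left with
  | one => exact ⟨1, by simp [hL], 1, one_mem _, by simp⟩
  | mul_left z hz g _ ih => exact step z hz g ih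
  | inv_mul_cancel z hz g _ ih =>
    have : z⁻¹ = z := by
      rcases hz with rfl | rfl | rfl
      exacts [inv_eq_of_mul_eq_one_left h.aa, inv_eq_of_mul_eq_one_left h.bb,
        inv_eq_of_mul_eq_one_left h.cc]
    rw [this]
    exact step z hz g ih

/-- In the automorphism group of the hemi-icosahedron, the stabiliser of a triangle is a maximal
subgroup. -/
theorem mem_closure_pair_of_mem (hz : centralElement a b c = 1) {K : Subgroup G} (hbK : b ∈ K)
    (hcK : c ∈ K) (haK : a ∉ K) {g : G} (hg : g ∈ Subgroup.closure {a, b, c}) (hgK : g ∈ K) :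
    g ∈ Subgroup.closure {b, c} := by
  have hMK : Subgroup.closure {b, c} ≤ K := by
    rw [Subgroup.closure_le]
    rintro x (rfl | rfl)
    exacts [hbK, hcK]
  -- The product of `b` and `a * b * a` is `(b * a) ^ 2`, whose cube is `(b * a) ^ 6 = b * a`; so `a
  -- * b * a ∈ K` would give `a ∈ K`.
  have haba : a * b * a ∉ K := by
    intro h1
    have h2 := pow_mem (mul_mem hbK h1) 3
    have h3 : (b * (a * b * a)) ^ 3 = b * a := by
      rw [show b * (a * b * a) = (b * a) ^ 2 by simp only [sq, mul_assoc], ← pow_mul,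
        show 2 * 3 = 5 + 1 from rfl, pow_succ, h.ba, one_mul]
    rw [h3] at h2
    exact haK ((K.mul_mem_cancel_left hbK).1 h2)
  obtain ⟨w, hw, m, hm, rfl⟩ := h.exists_eq_representative_mul hz hg
  have hwK : w ∈ K := (K.mul_mem_cancel_right (hMK hm)).1 hgK
  simp only [List.mem_cons, List.not_mem_nil, or_false] at hw
  -- Removing letters `b` and `c` on the left reduces every representative except `1` to `a` or `a *
  -- b * a`, neither of which is in `K`.
  rcases hw with rfl | rfl | rfl | rfl | rfl | rfl | rfl | rfl | rfl | rfl
  · rwa [one_mul]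
  all_goals
    simp only [mul_assoc, K.mul_mem_cancel_left hbK, K.mul_mem_cancel_left hcK] at hwK haba
    first
    | exact absurd hwK haK
    | exact absurd hwK haba

/-- The dihedral group of order 10 has trivial centre. Commuting with `a` leaves only `1` and `a` as
candidates, and if `a` commuted with `b`, then `(b * a) ^ 2 = 1 = (b * a) ^ 5` would give `a = b`.
-/
theorem centralElement_notMem (hz : centralElement a b c ≠ 1) (hab : a ≠ b) :
    centralElement a b c ∉ Subgroup.closure {b, a} := by
  intro hmem
  obtain ⟨i, e⟩ := exists_eq_zmodPow_of_mem_closure (p := 5) h.bb h.aa h.ba hmem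
  have h1 : zmodPow (b * a) (-i) = zmodPow (b * a) i := by
    have h1 := h.centralElement_comm (s := a) (by simp)
    rcases e with e | e <;> rw [e] at h1
    · rw [mul_zmodPow_of_involution h.bb h.aa h.ba] at h1
      exact mul_right_cancel h1
    · rw [← mul_assoc, mul_zmodPow_of_involution h.bb h.aa h.ba] at h1
      exact mul_right_cancel (mul_right_cancel h1)
  have h2 : zmodPow (b * a) (i + i) = 1 := by
    rw [zmodPow_add h.ba]
    nth_rw 1 [← h1]
    rw [← zmodPow_add h.ba, neg_add_cancel, zmodPow_zero]
  have h3 : zmodPow (b * a) i = 1 := by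
    -- Six is one modulo 5, so a rotation whose square is trivial is itself trivial.
    have h3 : (i + i) + (i + i) + (i + i) = i := by
      clear e h1 h2
      decide +revert
    rw [← h3, zmodPow_add h.ba, zmodPow_add h.ba, h2, one_mul, one_mul]
  rcases e with e | e <;> rw [h3] at e
  · exact hz e
  · have h4 := h.centralElement_comm (s := b) (by simp)
    rw [e, one_mul] at h4
    have h5 : (b * a) ^ 2 = 1 := by
      rw [sq]
      nth_rw 2 [h4]
      rw [mul_assoc, ← mul_assoc a, h.aa, one_mul, h.bb]
    have h6 : b * a = 1 := by
      have h6 := h.ba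
      rwa [show 5 = 2 * 2 + 1 from rfl, pow_succ, pow_mul, h5, one_pow, one_mul] at h6
    exact hab ((eq_inv_of_mul_eq_one_right h6).trans (inv_eq_of_mul_eq_one_left h.bb))

end IcosahedralRelations

end ParabolicSubgroups

/-! ### `W` is a string C-group. -/

section StringCGroup

theorem orderOf_sW_zero_mul : orderOf (sW 0 * sW 1) = 5 :=
  haveI : Fact (Nat.Prime 5) := ⟨Nat.prime_five⟩
  orderOf_eq_prime sW_pow_five fun e => sW_ne_sW.1
    ((eq_inv_of_mul_eq_one_left e).trans (inv_eq_of_mul_eq_one_left (sW_mul_self 1)))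

theorem orderOf_sW_one_mul : orderOf (sW 1 * sW 2) = 3 :=
  orderOf_eq_prime sW_pow_three fun e => sW_ne_sW.2.1
    ((eq_inv_of_mul_eq_one_left e).trans (inv_eq_of_mul_eq_one_left (sW_mul_self 2)))

theorem orderOf_sW_two_mul : orderOf (sW 2 * sW 3) = 5 :=
  haveI : Fact (Nat.Prime 5) := ⟨Nat.prime_five⟩
  orderOf_eq_prime sW_pow_five' fun e => sW_ne_sW.2.2
    ((eq_inv_of_mul_eq_one_left e).trans (inv_eq_of_mul_eq_one_left (sW_mul_self 3)))

/-- The whole facet group centralises its central element, but `s₃` does not. -/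
theorem sW_three_notMem : sW 3 ∉ Subgroup.closure {sW 0, sW 1, sW 2} := by
  intro hmem
  refine sW_mul_centralElement_ne ?_
  have h1 : Subgroup.closure {sW 0, sW 1, sW 2} ≤
      Subgroup.centralizer {centralElement (sW 0) (sW 1) (sW 2)} := by
    rw [Subgroup.closure_le]
    intro s hs
    rw [SetLike.mem_coe, Subgroup.mem_centralizer_singleton_iff]
    exact icosahedralRelations_facet.centralElement_comm hs
  exact Subgroup.mem_centralizer_singleton_iff.1 (h1 hmem)

theorem centralElement_facet_notMem :
    centralElement (sW 0) (sW 1) (sW 2) ∉ Subgroup.closure {sW 1, sW 0} :=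
  icosahedralRelations_facet.centralElement_notMem
    (fun e => sW_mul_centralElement_ne (by rw [e, one_mul, mul_one])) sW_ne_sW.1

theorem image_indexIco_one (s : Fin 4 → W) (a : Fin 4) : s '' indexIco 4 a (a + 1) = {s a} := by
  rw [← Set.image_singleton]
  congr 1
  ext m
  rw [mem_indexIco, Set.mem_singleton_iff, Fin.ext_iff]
  omega

theorem image_indexIco_two (s : Fin 4 → W) (a b : Fin 4) (hab : (b : ℕ) = a + 1) :
    s '' indexIco 4 a (a + 2) = {s a, s b} := by
  rw [← Set.image_pair]
  congr 1
  ext m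
  rw [mem_indexIco, Set.mem_insert_iff, Set.mem_singleton_iff, Fin.ext_iff, Fin.ext_iff]
  omega

theorem image_indexIco_three (s : Fin 4 → W) (a b c : Fin 4) (hab : (b : ℕ) = a + 1)
    (hbc : (c : ℕ) = a + 2) : s '' indexIco 4 a (a + 3) = {s a, s b, s c} := by
  rw [← Set.image_singleton (f := s), ← Set.image_insert_eq, ← Set.image_insert_eq]
  congr 1
  ext m
  simp only [mem_indexIco, Set.mem_insert_iff, Set.mem_singleton_iff, Fin.ext_iff]
  omega

theorem intersectionOn_sW_two (a b : Fin 4) (hab : (b : ℕ) = a + 1) (hne : sW a ≠ sW b) :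
    IntersectionOn sW a (a + 2) := by
  refine sW_isString.intersectionOn_step (intersectionOn_succ sW a)
    (intersectionOn_succ sW (a + 1)) fun g h1 h2 => ?_
  rw [image_indexIco_one] at h1
  rw [← hab, image_indexIco_one] at h2
  rcases mem_closure_singleton_involution (sW_mul_self a) h1 with rfl | rfl
  · exact one_mem _
  · rcases mem_closure_singleton_involution (sW_mul_self b) h2 with e | e
    exacts [absurd e (sW_ne_one a), absurd e hne]

/-- The essential point is `⟨s₀, s₁⟩ ∩ ⟨s₁, s₂⟩ = ⟨s₁⟩`: the subgroup `⟨s₁⟩` is maximal in `⟨s₁,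
s₂⟩`, and `s₂` is not in `⟨s₀, s₁⟩`. -/
theorem intersectionOn_sW_zero_three : IntersectionOn sW 0 3 := by
  refine sW_isString.intersectionOn_step (intersectionOn_sW_two 0 1 rfl sW_ne_sW.1)
    (intersectionOn_sW_two 1 2 rfl sW_ne_sW.2.1) fun g h1 h2 => ?_
  erw [image_indexIco_two sW 0 1 rfl] at h1
  erw [image_indexIco_two sW 1 2 rfl, Set.pair_comm] at h2
  erw [image_indexIco_one sW 1]
  have h3 := mul_pow_eq_one_comm (sW_mul_self 1) (sW_mul_self 2) sW_pow_three
  exact mem_closure_singleton_of_mem (sW_mul_self 2) (sW_mul_self 1) h3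
    (Subgroup.subset_closure (by simp))
    (notMem_closure_pair (sW_mul_self 0) (sW_mul_self 1) sW_pow_five sW_pow_three
      sW_ne_sW.2.1.symm) h2 h1

theorem intersectionOn_sW_one_four : IntersectionOn sW 1 4 := by
  refine sW_isString.intersectionOn_step (intersectionOn_sW_two 1 2 rfl sW_ne_sW.2.1)
    (intersectionOn_sW_two 2 3 rfl sW_ne_sW.2.2) fun g h1 h2 => ?_
  erw [image_indexIco_two sW 1 2 rfl] at h1
  erw [image_indexIco_two sW 2 3 rfl, Set.pair_comm] at h2
  erw [image_indexIco_one sW 2]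
  have h3 := mul_pow_eq_one_comm (sW_mul_self 1) (sW_mul_self 2) sW_pow_three
  have h4 := mul_pow_eq_one_comm (sW_mul_self 2) (sW_mul_self 3) sW_pow_five'
  exact mem_closure_singleton_of_mem (sW_mul_self 1) (sW_mul_self 2) sW_pow_three
    (Subgroup.subset_closure (by simp))
    (notMem_closure_pair (sW_mul_self 3) (sW_mul_self 2) h4 h3 sW_ne_sW.2.1) h1 h2

/-- With `K = ⟨s₀, s₁, s₂⟩`, maximality of the triangle stabiliser `⟨s₁, s₂⟩` in the vertex-figure
group and `s₃ ∉ K` give the required intersection. -/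
theorem intersectionOn_sW : IntersectionOn sW 0 4 := by
  refine sW_isString.intersectionOn_step intersectionOn_sW_zero_three
    intersectionOn_sW_one_four fun g h1 h2 => ?_
  erw [image_indexIco_three sW 0 1 2 rfl rfl] at h1
  erw [image_indexIco_three sW 1 2 3 rfl rfl] at h2
  erw [image_indexIco_two sW 1 2 rfl, Set.pair_comm]
  rw [show ({sW 1, sW 2, sW 3} : Set W) = {sW 3, sW 2, sW 1} by ext; simp; tauto] at h2
  exact icosahedralRelations_vertexFigure.mem_closure_pair_of_mem centralElement_vertexFigure
    (Subgroup.subset_closure (by simp)) (Subgroup.subset_closure (by simp)) sW_three_notMem h2 h1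

/-- `W` is a string C-group. -/
theorem isStringCGroup_sW : IsStringCGroup sW where
  involution i := orderOf_eq_prime (by rw [sq, sW_mul_self]) (sW_ne_one i)
  generates := closure_range_sW
  string := sW_isString
  intersection I J := by
    have h1 : ∀ I : Set (Fin 4), I ⊆ indexIco 4 0 4 := fun I m _ => ⟨Nat.zero_le _, m.isLt⟩
    refine le_antisymm (fun g hg => intersectionOn_sW I J (h1 I) (h1 J) g hg.1 hg.2) ?_
    exact le_inf (closure_image_mono sW Set.inter_subset_left)
      (closure_image_mono sW Set.inter_subset_right)

end StringCGroup

end AbstractPolytope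

namespace AbstractPolytope

/-! ### Recognition of the sections, and the theorem. -/

section Sections

variable {G : Type*} [Group G] {n : ℕ} {s : Fin n → G}

theorem nonempty_trans {α β γ : Type*} [LE α] [LE β] [LE γ] (h1 : Nonempty (α ≃o β))
    (h2 : Nonempty (β ≃o γ)) : Nonempty (α ≃o γ) := ⟨h1.some.trans h2.some⟩

theorem exists_section_orderIso {h : IsStringCGroup s} {m i : ℕ} (hi : i + m ≤ n)
    {F E : CosetPoset h} (hFE : F ≤ E) (hF : (F.index : ℕ) = i) (hE : (E.index : ℕ) = i + m + 1) :
    Nonempty (Set.Icc F E ≃o CosetPoset (h.shift hi)) := by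
  obtain ⟨g, hgF, hgE⟩ := exists_smul_of_le hFE
  have h1 := exists_icc_orderIso h hi g hF hE
  rw [← cosetFace_eq_smul] at hgF hgE
  rw [hgF, hgE]
  exact h1

theorem exists_section_orderIso_polygon {h : IsStringCGroup s} {i : ℕ} (hi : i + 2 ≤ n)
    {F E : CosetPoset h} (hFE : F ≤ E) (hF : (F.index : ℕ) = i) (hE : (E.index : ℕ) = i + 3)
    {p : ℕ} (hp : 3 ≤ p) (ho : orderOf (s ⟨i, by omega⟩ * s ⟨i + 1, by omega⟩) = p) :
    Nonempty (Set.Icc F E ≃o Polygon p) := by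
  refine nonempty_trans (exists_section_orderIso hi hFE hF hE)
    (exists_polygon_orderIso _ hp ?_)
  rw [← ho, ← Subgroup.orderOf_coe]
  rfl

end Sections

theorem hasSchlafliType_W : HasSchlafliType (CosetPoset isStringCGroup_sW) ![5, 3, 5] := by
  intro i F E hFE hF hE
  rw [height_eq_index] at hF hE
  have hF' : (F.index : ℕ) = i := by exact_mod_cast hF
  have hE' : (E.index : ℕ) = i + 3 := by exact_mod_cast hE
  fin_cases i
  · exact exists_section_orderIso_polygon (i := 0) (by norm_num) hFE hF' hE' (by norm_num)
      orderOf_sW_zero_mul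
  · exact exists_section_orderIso_polygon (i := 1) (by norm_num) hFE hF' hE' (by norm_num)
      orderOf_sW_one_mul
  · exact exists_section_orderIso_polygon (i := 2) (by norm_num) hFE hF' hE' (by norm_num)
      orderOf_sW_two_mul

theorem exists_facet_orderIso {F : CosetPoset isStringCGroup_sW} (hF : IsCoatom F) :
    Nonempty (Set.Iic F ≃o Dodecahedron) := by
  have h1 : Nonempty (Set.Icc ⊥ F ≃o CosetPoset (isStringCGroup_sW.shift (i := 0) (m := 3)
      (by norm_num))) := by
    refine exists_section_orderIso _ bot_le ?_ ?_
    · rw [bot_eq_cosetFace 1]; rfl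
    · rw [index_of_isCoatom hF]
  rw [Set.Icc_bot] at h1
  -- Reversing the generators turns the facet into the dual of a poset of type `{3,5}`, to which the
  -- icosahedral criterion applies.
  refine nonempty_trans h1 (nonempty_trans (exists_rev_orderIso _) ?_)
  refine (exists_icosahedron_orderIso (h := (isStringCGroup_sW.shift (i := 0) (m := 3)
      (by norm_num)).rev) ?_ ?_).map OrderIso.dual
  · have h2 := icosahedralRelations_facet
    exact ⟨Subtype.ext h2.aa, Subtype.ext h2.bb, Subtype.ext h2.cc, Subtype.ext h2.ba,
      Subtype.ext h2.cbc, Subtype.ext h2.ca⟩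
  · intro hmem
    have h2 := Subgroup.mem_map_of_mem (Subgroup.subtype _) hmem
    rw [MonoidHom.map_closure, Set.image_pair] at h2
    exact centralElement_facet_notMem h2

theorem exists_vertexFigure_orderIso {v : CosetPoset isStringCGroup_sW} (hv : IsAtom v) :
    Nonempty (Set.Ici v ≃o HemiIcosahedron) := by
  have h1 : Nonempty (Set.Icc v ⊤ ≃o CosetPoset (isStringCGroup_sW.shift (i := 1) (m := 3)
      (by norm_num))) := by
    refine exists_section_orderIso _ le_top ?_ ?_
    · rw [index_of_isAtom (by norm_num) hv]
    · rw [top_eq_cosetFace 1]; rfl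
  rw [Set.Icc_top] at h1
  refine nonempty_trans h1 (exists_hemiIcosahedron_orderIso ?_ ?_)
  · have h2 := icosahedralRelations_vertexFigure
    exact ⟨Subtype.ext h2.aa, Subtype.ext h2.bb, Subtype.ext h2.cc, Subtype.ext h2.ba,
      Subtype.ext h2.cbc, Subtype.ext h2.ca⟩
  · exact Subtype.ext centralElement_vertexFigure

end AbstractPolytope

theorem mainTheorem1 :
    AbstractPolytope.IsStringCGroup AbstractPolytope.sW ∧
    AbstractPolytope.IsPolytope 4 AbstractPolytope.P ∧
    AbstractPolytope.IsRegular AbstractPolytope.P ∧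
    (∃ e : AbstractPolytope.W ≃* (AbstractPolytope.P ≃o AbstractPolytope.P),
      ∀ (g : AbstractPolytope.W) (x : AbstractPolytope.P), e g x = AbstractPolytope.leftMul g x) ∧
    AbstractPolytope.HasSchlafliType AbstractPolytope.P ![5, 3, 5] ∧
    (∀ F : AbstractPolytope.P, IsCoatom F →
      Nonempty (Set.Iic F ≃o AbstractPolytope.Dodecahedron)) ∧
    (∀ v : AbstractPolytope.P, IsAtom v →
      Nonempty (Set.Ici v ≃o AbstractPolytope.HemiIcosahedron)) := by
  open AbstractPolytope in
  exact ⟨isStringCGroup_sW, isPolytope_cosetPoset isStringCGroup_sW,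
    isRegular_cosetPoset isStringCGroup_sW, exists_mulEquiv_orderIso isStringCGroup_sW,
    hasSchlafliType_W, fun _ hF => exists_facet_orderIso hF,
    fun _ hv => exists_vertexFigure_orderIso hv⟩
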